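/- Fix $n\ge 2$. All graphs are finite and connected, with every vertex of valence at least $3$. A marked graph $(\Gamma,g)$ is such a graph with a marking, i.e. a homotopy equivalence $g$ from the $n$-petal rose $R_0$ to $\Gamma$ (equivalently, an identification of $F_n$ with $\pi_1(\Gamma)$ up to inner automorphisms), where $(\Gamma_1,g_1)\sim(\Gamma_2,g_2)$ if $h\circ g_1\simeq g_2$ for some graph isomorphism $h:\Gamma_1\to\Gamma_2$. The marked graphs are partially ordered by forest collapse, and the spine $K_n$ of Outer space is the order complex of this poset. A marked surface $(\Sigma,s)$ is a connected punctured orientable surface $\Sigma$ of finite type, without boundary and with at least one puncture, together with a marking $s:R_0\to\Sigma$ (a homotopy equivalence). A ribbon structure $\mathcal O$ on $\Gamma$ is a choice of a cyclic ordering of the half-edges at each vertex; $|\Gamma,\mathcal O|$ is the punctured surface obtained by gluing a once-punctured disk to $\Gamma$ along each boundary cycle of $(\Gamma,\mathcal O)$. The marked graph $(\Gamma,g)$ can be drawn in $(\Sigma,s)$ if there are a ribbon structure $\mathcal O$ on $\Gamma$ and a homeomorphism $h:|\Gamma,\mathcal O|\to\Sigma$ with $h\circ i\circ g\simeq s$,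 where $i:\Gamma\hookrightarrow|\Gamma,\mathcal O|$ is the inclusion. The ribbon graph complex $\mathfrak R_{[\Sigma,s]}$ is the subcomplex of $K_n$ spanned by the marked graphs that can be drawn in $(\Sigma,s)$. Let $\mathcal N_n$ be the nerve of the cover of $K_n$ by its ribbon graph complexes: its $k$-simplices are the collections of $k+1$ distinct ribbon graph complexes with nonempty intersection. The group $\mathrm{Out}(F_n)$ acts on the right on marked graphs by $(\Gamma,g)\cdot[\varphi]=(\Gamma,g\circ\varphi)$; this permutes the ribbon graph complexes, so $\mathrm{Out}(F_n)$ acts on $\mathcal N_n$. **Proposition.** $\mathrm{Out}(F_n)$ acts cocompactly on $\mathcal N_n$: there are only finitely many $\mathrm{Out}(F_n)$-orbits of simplices of $\mathcal N_n$; in particular, there are finitely many orbits of $k$-simplices for each $k$. Nevertheless, if $n\ge 3$, then every vertex of $\mathcal N_n$ has infinite valence, i.e. is joined by an edge to infinitely many other vertices. -/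

import Mathlib

open scoped Pointwise unitInterval

noncomputable section

namespace RibbonNerve

/-! ## Outer automorphisms and markings -/

/-- The free group of rank `n`. -/
abbrev F (n : ℕ) : Type := FreeGroup (Fin n)

instance innerNormal (G : Type*) [Group G] : (MulAut.conj : G →* MulAut G).range.Normal where
  conj_mem := by
    rintro _ ⟨x, rfl⟩ φ
    refine ⟨φ x, ?_⟩
    ext y
    simp [MulAut.conj_apply]

/-- `Out(F_n)`: automorphisms of the free group modulo inner automorphisms. -/
abbrev Out (n : ℕ) : Type := MulAut (F n) ⧸ (MulAut.conj : F n →* MulAut (F n)).range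

section FundamentalGroup

open CategoryTheory

variable {X Y Z : Type} [TopologicalSpace X] [TopologicalSpace Y] [TopologicalSpace Z]

/-- The isomorphism `π₁(X, x) ≃ π₁(X, y)` given by a path from `x` to `y`. -/
abbrev transport {x y : X} (p : Path x y) : FundamentalGroup X x ≃* FundamentalGroup X y :=
  FundamentalGroup.fundamentalGroupMulEquivOfPath p

abbrev arrow {x y : X} (p : Path x y) : FundamentalGroupoid.mk x ⟶ FundamentalGroupoid.mk y :=
  Path.Homotopic.Quotient.mk p

theorem transport_eq {x y : X} (p : Path x y) (a : FundamentalGroup X x) :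
    transport p a = Groupoid.inv (arrow p) ≫ a ≫ arrow p := rfl

theorem transport_trans {x y z : X} (p : Path x y) (q : Path y z) (a : FundamentalGroup X x) :
    transport q (transport p a) = transport (p.trans q) a := by
  have : arrow (p.trans q) = arrow p ≫ arrow q := rfl
  rw [transport_eq, transport_eq, transport_eq, this]
  simp [Groupoid.inv_eq_inv]

theorem transport_symm {x y : X} (p : Path x y) (a : FundamentalGroup X x) :
    transport p.symm (transport p a) = a := by
  have : arrow p.symm = Groupoid.inv (arrow p) := rfl
  rw [transport_eq, transport_eq, this]
  simp [Groupoid.inv_eq_inv]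

theorem exists_transport_eq_conj {x : X} (b : FundamentalGroup X x) :
    ∃ p : Path x x, ∀ a, transport p a = b * a * b⁻¹ := by
  obtain ⟨p, hp⟩ := Quotient.exists_rep (FundamentalGroup.toPath b)
  have hb : arrow p = b := hp
  refine ⟨p, fun a => ?_⟩
  rw [transport_eq, hb]
  simp only [End.mul_def]
  rfl

theorem map_transport (f : C(X, Y)) {x y : X} (p : Path x y) (a : FundamentalGroup X x) :
    FundamentalGroup.map f y (transport p a) =
      transport (p.map f.continuous) (FundamentalGroup.map f x a) := by
  have h1 : arrow (p.map f.continuous) = (FundamentalGroupoid.map f).map (arrow p) := rfl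
  have h2 : FundamentalGroup.map f x a = (FundamentalGroupoid.map f).map a := rfl
  have h3 : FundamentalGroup.map f y (transport p a) =
    (FundamentalGroupoid.map f).map (transport p a) := rfl
  have key : ∀ (G : FundamentalGroupoid X ⥤ FundamentalGroupoid Y) {u v : FundamentalGroupoid X}
      (b : u ⟶ v) (c : u ⟶ u), G.map (Groupoid.inv b ≫ c ≫ b) =
        Groupoid.inv (G.map b) ≫ G.map c ≫ G.map b := by
    intro G u v b c
    simp [Groupoid.inv_eq_inv]
  rw [h3, transport_eq, transport_eq, h1, h2]
  exact key _ _ _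

theorem map_id (x : X) (a : FundamentalGroup X x) :
    FundamentalGroup.map (ContinuousMap.id X) x a = a := by
  obtain ⟨p, rfl⟩ := Quotient.exists_rep a
  rfl

theorem map_comp (f : C(X, Y)) (g : C(Y, Z)) (x : X) (a : FundamentalGroup X x) :
    FundamentalGroup.map (g.comp f) x a =
      FundamentalGroup.map g (f x) (FundamentalGroup.map f x a) := by
  obtain ⟨p, rfl⟩ := Quotient.exists_rep a
  rfl

end FundamentalGroup

/-- A marking of a (path-connected, aspherical) space `X` by `F_n`: an identification of `F_n`
with the fundamental group of `X`. Markings are compared up to change of base point along paths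
(see `Marking.Carries`), so that these are the homotopy equivalences from the standard rose to `X`
up to free homotopy. -/
structure Marking (n : ℕ) (X : Type) [TopologicalSpace X] where
  base : X
  iso : F n ≃* FundamentalGroup X base

namespace Marking

variable {n : ℕ} {X Y Z : Type} [TopologicalSpace X] [TopologicalSpace Y] [TopologicalSpace Z]

/-- `f ∘ s ≃ t`: the map `f` carries the marking `s` to the marking `t`, up to change of base
point along a path. Taking loops `p`, this identifies markings differing by inner automorphisms. -/
def Carries (f : C(X, Y)) (s : Marking n X) (t : Marking n Y) : Prop :=
  ∃ p : Path (f s.base) t.base, ∀ w : F n,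
    t.iso w = transport p (FundamentalGroup.map f s.base (s.iso w))

/-- Change of the marking by an automorphism: `s ∘ φ`. -/
def precomp (s : Marking n X) (φ : MulAut (F n)) : Marking n X where
  base := s.base
  iso := φ.trans s.iso

theorem Carries.precomp {f : C(X, Y)} {s : Marking n X} {t : Marking n Y} (h : Carries f s t)
    (φ : MulAut (F n)) : Carries f (s.precomp φ) (t.precomp φ) := by
  obtain ⟨p, hp⟩ := h
  exact ⟨p, fun w => hp (φ w)⟩

theorem Carries.comp {f : C(X, Y)} {g : C(Y, Z)} {s : Marking n X} {t : Marking n Y}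
    {u : Marking n Z} (h : Carries f s t) (h' : Carries g t u) : Carries (g.comp f) s u := by
  obtain ⟨p, hp⟩ := h
  obtain ⟨q, hq⟩ := h'
  refine ⟨(p.map g.continuous).trans q, fun w => ?_⟩
  rw [hq, hp, map_transport, transport_trans, map_comp]

/-- Markings differing by an inner automorphism are equivalent. -/
theorem carries_conj (s : Marking n X) (a : F n) :
    Carries (ContinuousMap.id X) (s.precomp (MulAut.conj a)) s := by
  obtain ⟨p, hp⟩ := exists_transport_eq_conj (s.iso a)⁻¹
  refine ⟨p, fun w => ?_⟩
  refine Eq.trans ?_ (congrArg (transport p) (map_id s.base _)).symm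
  refine Eq.trans ?_ (hp _).symm
  change s.iso w = (s.iso a)⁻¹ * s.iso (MulAut.conj a w) * (s.iso a)⁻¹⁻¹
  rw [← map_inv, ← map_inv, ← map_mul, ← map_mul]
  congr 1
  simp [MulAut.conj_apply, mul_assoc]

theorem carries_id (s : Marking n X) : Carries (ContinuousMap.id X) s s := by
  have h := carries_conj s 1
  rw [map_one] at h
  exact h

theorem Carries.symm {f : C(X, Y)} {g : C(Y, X)} (hgf : g.comp f = ContinuousMap.id X)
    {s : Marking n X} {t : Marking n Y} (h : Carries f s t) : Carries g t s := by
  obtain ⟨p, hp⟩ := h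
  have hid : Carries (g.comp f) s s := hgf ▸ carries_id s
  obtain ⟨q, hq⟩ := hid
  refine ⟨(p.map g.continuous).symm.trans q, fun w => ?_⟩
  rw [hp, map_transport, ← transport_trans, transport_symm]
  exact (hq w).trans (congrArg (transport q) (map_comp f g s.base (s.iso w)))

end Marking

/-! ## Finite graphs and their realizations -/

/-- A finite connected graph all of whose vertices have valence at least three. `H` is the set of
half-edges; the half-edge `h` is also regarded as the directed edge that leaves the vertex `src h`
along `h`, and `inv h` is the opposite half-edge of the same edge. -/
structure Graph where
  V : Type
  H : Type
  finV : Finite V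
  finH : Finite H
  src : H → V
  inv : H → H
  inv_inv : ∀ h, inv (inv h) = h
  inv_ne : ∀ h, inv h ≠ h
  nonempty : Nonempty V
  valence : ∀ v, 3 ≤ Nat.card {h : H // src h = v}
  connected : ∀ v w, Relation.ReflTransGen (fun a b => ∃ h, src h = a ∧ src (inv h) = b) v w

namespace Graph

/-- The identifications in the realization of a graph: each edge appears once for each of its two
directions, and the directed edges starting at a common vertex are glued at their origins. -/
inductive Glue (Γ : Graph) : (_ : Γ.H) × I → (_ : Γ.H) × I → Prop
  | flip (h : Γ.H) (t : I) : Glue Γ ⟨h, t⟩ ⟨Γ.inv h, σ t⟩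
  | vertex (h h' : Γ.H) : Γ.src h = Γ.src h' → Glue Γ ⟨h, 0⟩ ⟨h', 0⟩

/-- The topological realization `|Γ|`, a 1-dimensional CW complex. -/
def Real (Γ : Graph) : Type := Quot Γ.Glue

instance (Γ : Graph) : TopologicalSpace Γ.Real := inferInstanceAs (TopologicalSpace (Quot _))

/-- The point at parameter `t` on the directed edge `h`. -/
def pt (Γ : Graph) (h : Γ.H) (t : I) : Γ.Real := Quot.mk _ ⟨h, t⟩

theorem pt_flip (Γ : Graph) (h : Γ.H) (t : I) : Γ.pt h t = Γ.pt (Γ.inv h) (σ t) :=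
  Quot.sound (.flip h t)

theorem pt_zero (Γ : Graph) {h h' : Γ.H} (e : Γ.src h = Γ.src h') : Γ.pt h 0 = Γ.pt h' 0 :=
  Quot.sound (.vertex h h' e)

theorem continuous_pt (Γ : Graph) (h : Γ.H) : Continuous (Γ.pt h) :=
  continuous_quot_mk.comp continuous_sigmaMk

theorem exists_src (Γ : Graph) (v : Γ.V) : ∃ h, Γ.src h = v := by
  have h3 := Γ.valence v
  by_contra hne
  push Not at hne
  have : IsEmpty {h : Γ.H // Γ.src h = v} := ⟨fun h => hne h.1 h.2⟩
  simp at h3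

/-- The point of the realization given by a vertex. -/
def vertexPt (Γ : Graph) (v : Γ.V) : Γ.Real := Γ.pt (Γ.exists_src v).choose 0

theorem vertexPt_src (Γ : Graph) (h : Γ.H) : Γ.vertexPt (Γ.src h) = Γ.pt h 0 :=
  Γ.pt_zero (Γ.exists_src (Γ.src h)).choose_spec

/-- Maps out of the realization. -/
def lift (Γ : Graph) {Y : Type} [TopologicalSpace Y] (f : Γ.H → I → Y)
    (hc : ∀ h, Continuous (f h)) (hflip : ∀ h t, f h t = f (Γ.inv h) (σ t))
    (hv : ∀ h h', Γ.src h = Γ.src h' → f h 0 = f h' 0) : C(Γ.Real, Y) where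
  toFun := Quot.lift (fun x => f x.1 x.2) (by
    rintro _ _ (⟨h, t⟩ | ⟨h, h', e⟩)
    · exact hflip h t
    · exact hv h h' e)
  continuous_toFun := continuous_quot_lift _ (continuous_sigma hc)

@[ext]
theorem hom_ext {Γ : Graph} {Y : Type} [TopologicalSpace Y] {f g : C(Γ.Real, Y)}
    (e : ∀ h t, f (Γ.pt h t) = g (Γ.pt h t)) : f = g := by
  ext x
  obtain ⟨⟨h, t⟩, rfl⟩ := Quot.exists_rep x
  exact e h t

/-- Isomorphisms of graphs. -/
structure Iso (Γ Γ' : Graph) where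
  onV : Γ.V ≃ Γ'.V
  onH : Γ.H ≃ Γ'.H
  src_onH : ∀ h, Γ'.src (onH h) = onV (Γ.src h)
  inv_onH : ∀ h, Γ'.inv (onH h) = onH (Γ.inv h)

/-- The map of realizations induced by an isomorphism of graphs. -/
def Iso.real {Γ Γ' : Graph} (e : Iso Γ Γ') : C(Γ.Real, Γ'.Real) :=
  Γ.lift (fun h t => Γ'.pt (e.onH h) t) (fun h => Γ'.continuous_pt _)
    (fun h t => by rw [Γ'.pt_flip, e.inv_onH])
    (fun h h' hs => Γ'.pt_zero (by rw [e.src_onH, e.src_onH, hs]))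

def Iso.refl (Γ : Graph) : Iso Γ Γ := ⟨.refl _, .refl _, fun _ => rfl, fun _ => rfl⟩

def Iso.symm {Γ Γ' : Graph} (e : Iso Γ Γ') : Iso Γ' Γ where
  onV := e.onV.symm
  onH := e.onH.symm
  src_onH h := by rw [Equiv.eq_symm_apply, ← e.src_onH, Equiv.apply_symm_apply]
  inv_onH h := by rw [Equiv.eq_symm_apply, ← e.inv_onH, Equiv.apply_symm_apply]

def Iso.trans {Γ Γ' Γ'' : Graph} (e : Iso Γ Γ') (e' : Iso Γ' Γ'') : Iso Γ Γ'' where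
  onV := e.onV.trans e'.onV
  onH := e.onH.trans e'.onH
  src_onH h := by simp [e.src_onH, e'.src_onH]
  inv_onH h := by simp [e.inv_onH, e'.inv_onH]

/-- The collapse of a forest `Φ` in `Γ`, with quotient `Γ'` (that is, `Γ' ≅ Γ / Φ`): the
half-edges of `Γ'` are those of `Γ` outside `Φ`, and its vertices are the vertices of `Γ` up to
being joined by a path in `Φ`. -/
structure ForestCollapse (Γ Γ' : Graph) where
  forest : Set Γ.H
  inv_mem : ∀ h ∈ forest, Γ.inv h ∈ forest
  /-- There is no circuit in the forest: every closed edge path `c 0, …, c k` (with cyclic indices)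
  in it backtracks. -/
  no_circuit : ∀ (k : ℕ) (c : Fin (k + 1) → Γ.H), (∀ i, c i ∈ forest) →
    (∀ i, Γ.src (c (i + 1)) = Γ.src (Γ.inv (c i))) → ∃ i, c (i + 1) = Γ.inv (c i)
  onV : Γ.V → Γ'.V
  onV_surjective : Function.Surjective onV
  onV_eq_iff : ∀ v w, onV v = onV w ↔
    Relation.ReflTransGen (fun a b => ∃ h ∈ forest, Γ.src h = a ∧ Γ.src (Γ.inv h) = b) v w
  onH : {h : Γ.H // h ∉ forest} ≃ Γ'.H
  src_onH : ∀ h, Γ'.src (onH h) = onV (Γ.src h.1)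
  inv_onH : ∀ (h : {h : Γ.H // h ∉ forest}) (h' : Γ.inv h.1 ∉ forest),
    Γ'.inv (onH h) = onH ⟨Γ.inv h.1, h'⟩

open Classical in
/-- The quotient map `q : |Γ| → |Γ / Φ|`. -/
def ForestCollapse.real {Γ Γ' : Graph} (q : ForestCollapse Γ Γ') : C(Γ.Real, Γ'.Real) :=
  Γ.lift
    (fun h t => if hh : h ∈ q.forest then Γ'.vertexPt (q.onV (Γ.src h)) else Γ'.pt (q.onH ⟨h, hh⟩) t)
    (fun h => by
      by_cases hh : h ∈ q.forest
      · simpa [hh] using continuous_const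
      · simpa [hh] using Γ'.continuous_pt _)
    (fun h t => by
      by_cases hh : h ∈ q.forest
      · have e : q.onV (Γ.src h) = q.onV (Γ.src (Γ.inv h)) :=
          (q.onV_eq_iff _ _).2 (.single ⟨h, hh, rfl, rfl⟩)
        simp [hh, q.inv_mem h hh, e]
      · have h' : Γ.inv h ∉ q.forest := fun h' => hh (by simpa [Γ.inv_inv] using q.inv_mem _ h')
        simp only [hh, h', dite_false]
        rw [Γ'.pt_flip, q.inv_onH ⟨h, hh⟩ h'])
    (fun h h' e => by
      have key : ∀ k : Γ.H, (if hh : k ∈ q.forest then Γ'.vertexPt (q.onV (Γ.src k))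
          else Γ'.pt (q.onH ⟨k, hh⟩) 0) = Γ'.vertexPt (q.onV (Γ.src k)) := by
        intro k
        split_ifs with hk
        · rfl
        · rw [← q.src_onH ⟨k, hk⟩, Γ'.vertexPt_src]
      rw [key, key, e])

end Graph

/-! ## Marked graphs and the spine of Outer space -/

theorem Graph.Iso.real_refl (Γ : Graph) : (Graph.Iso.refl Γ).real = ContinuousMap.id _ :=
  Graph.hom_ext fun _ _ => rfl

theorem Graph.Iso.real_trans {Γ Γ' Γ'' : Graph} (e : Graph.Iso Γ Γ') (e' : Graph.Iso Γ' Γ'') :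
    (e.trans e').real = e'.real.comp e.real :=
  Graph.hom_ext fun _ _ => rfl

theorem Graph.Iso.real_symm_comp {Γ Γ' : Graph} (e : Graph.Iso Γ Γ') :
    e.symm.real.comp e.real = ContinuousMap.id _ :=
  Graph.hom_ext fun h t => congrArg (fun k => Γ.pt k t) (e.onH.symm_apply_apply h)

/-- A graph together with a marking. -/
structure PreMarkedGraph (n : ℕ) where
  graph : Graph
  marking : Marking n graph.Real

namespace PreMarkedGraph

variable {n : ℕ}

/-- `(Γ₁, g₁) ∼ (Γ₂, g₂)` if there is a graph isomorphism `h : Γ₁ → Γ₂` with `g₂ ≃ h ∘ g₁`. -/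
instance setoid (n : ℕ) : Setoid (PreMarkedGraph n) where
  r A B := ∃ h : Graph.Iso A.graph B.graph, Marking.Carries h.real A.marking B.marking
  iseqv :=
    { refl := fun A => ⟨.refl _, by
        rw [Graph.Iso.real_refl]
        exact Marking.carries_id _⟩
      symm := by
        rintro A B ⟨h, hh⟩
        exact ⟨h.symm, hh.symm h.real_symm_comp⟩
      trans := by
        rintro A B C ⟨h, hh⟩ ⟨k, hk⟩
        refine ⟨h.trans k, ?_⟩
        rw [Graph.Iso.real_trans]
        exact hh.comp hk }

/-- `(Γ, g ∘ φ)`. -/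
def precomp (A : PreMarkedGraph n) (φ : MulAut (F n)) : PreMarkedGraph n :=
  ⟨A.graph, A.marking.precomp φ⟩

end PreMarkedGraph

/-- Marked graphs with fundamental group `F_n`. -/
def MarkedGraph (n : ℕ) : Type 1 := Quotient (PreMarkedGraph.setoid n)

/-- The marked graph `(Γ, g)`. -/
def MarkedGraph.mk {n : ℕ} (A : PreMarkedGraph n) : MarkedGraph n := Quotient.mk _ A

/-- Change of the marking of a marked graph by an automorphism of `F_n`. -/
def MarkedGraph.precomp {n : ℕ} (m : MarkedGraph n) (φ : MulAut (F n)) : MarkedGraph n :=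
  Quotient.map (fun A => A.precomp φ) (by
    rintro A B ⟨h, hh⟩
    exact ⟨h, hh.precomp φ⟩) m

/-- The right action of `Out(F_n)` on marked graphs: `(Γ, g) · [φ] = (Γ, g ∘ φ)`. -/
def MarkedGraph.act {n : ℕ} (m : MarkedGraph n) (ψ : Out n) : MarkedGraph n :=
  Quotient.liftOn' ψ m.precomp (by
    intro φ φ' h
    obtain ⟨a, ha⟩ := QuotientGroup.leftRel_apply.1 h
    have hφ : φ' = φ * MulAut.conj a := by rw [ha, mul_inv_cancel_left]
    induction m using Quotient.inductionOn with
    | h A =>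
      have h : Marking.Carries (Graph.Iso.refl A.graph).real (A.marking.precomp φ')
          (A.marking.precomp φ) := by
        rw [Graph.Iso.real_refl, hφ]
        exact Marking.carries_conj (A.marking.precomp φ) a
      exact (Quotient.sound (s := PreMarkedGraph.setoid n) (a := A.precomp φ')
        (b := A.precomp φ) ⟨.refl _, h⟩).symm)

/-- A right action is an action of the opposite group: `op ψ • m = m · ψ`. -/
instance (n : ℕ) : MulAction (Out n)ᵐᵒᵖ (MarkedGraph n) where
  smul ψ m := m.act ψ.unop
  one_smul m := by
    induction m using Quotient.inductionOn with
    | h A => rfl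
  mul_smul ψ χ m := by
    induction m using Quotient.inductionOn with
    | h A =>
      obtain ⟨φ, hφ⟩ := QuotientGroup.mk_surjective ψ.unop
      obtain ⟨φ', hφ'⟩ := QuotientGroup.mk_surjective χ.unop
      obtain rfl : ψ = MulOpposite.op (φ : Out n) := by rw [hφ, MulOpposite.op_unop]
      obtain rfl : χ = MulOpposite.op (φ' : Out n) := by rw [hφ', MulOpposite.op_unop]
      rfl

theorem MarkedGraph.op_smul_mk {n : ℕ} (φ : MulAut (F n)) (A : PreMarkedGraph n) :
    MulOpposite.op (φ : Out n) • MarkedGraph.mk A = MarkedGraph.mk (A.precomp φ) := rfl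

/-- `m ≤ m'`: some forest collapse takes the marked graph `m'` to `m`, i.e. `m' = (Γ, g)` and
`m = (Γ / Φ, q ∘ g)`. -/
def MarkedGraph.IsCollapse {n : ℕ} (m m' : MarkedGraph n) : Prop :=
  ∃ A A' : PreMarkedGraph n, m = .mk A ∧ m' = .mk A' ∧
    ∃ q : Graph.ForestCollapse A'.graph A.graph, Marking.Carries q.real A'.marking A.marking

/-- Simplicial complexes whose simplices have their vertices among the marked graphs. -/
abbrev GraphComplex (n : ℕ) : Type 1 := PreAbstractSimplicialComplex (MarkedGraph n)

instance (n : ℕ) : DecidableEq (MarkedGraph n) := Classical.decEq _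

instance (n : ℕ) : DecidableEq (GraphComplex n) := Classical.decEq _

/-- The spine `K_n` of Outer space: the order complex of the poset of marked graphs. -/
def spine (n : ℕ) : GraphComplex n where
  faces := {s | s.Nonempty ∧ IsChain MarkedGraph.IsCollapse (s : Set (MarkedGraph n))}
  isRelLowerSet_faces := fun _ hs =>
    ⟨hs.1, fun _ hts ht => ⟨ht, hs.2.mono (Finset.coe_subset.2 hts)⟩⟩

/-! ## Ribbon graphs and punctured surfaces -/

/-- A scheme for gluing once-punctured polygons along their sides. The sides are the elements of
`side`; `next` sends a side to the side following it in the boundary of its polygon (so the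
polygons are the cycles of `next`), and each side `h` is glued to `inv h`. -/
structure PolygonScheme where
  side : Type
  finSide : Finite side
  next : Equiv.Perm side
  inv : side → side
  inv_inv : ∀ h, inv (inv h) = h
  inv_ne : ∀ h, inv h ≠ h

namespace PolygonScheme

open NNReal in
/-- A once-punctured polygon with `l` sides is a half-open cylinder `(ℝ / lℤ) × [0, ∞)`, cut here
into `l` half-infinite strips `[0, 1] × [0, ∞)`, one over each side. Consecutive strips are glued
along their vertical edges, and the sides are then glued in pairs, reversing orientation. -/
inductive Glue (P : PolygonScheme) : (_ : P.side) × (I × ℝ≥0) → (_ : P.side) × (I × ℝ≥0) → Prop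
  | strip (h : P.side) (y : ℝ≥0) : Glue P ⟨h, (1, y)⟩ ⟨P.next h, (0, y)⟩
  | side (h : P.side) (t : I) : Glue P ⟨h, (t, 0)⟩ ⟨P.inv h, (σ t, 0)⟩

/-- The surface obtained from a gluing scheme. -/
def Surface (P : PolygonScheme) : Type := Quot P.Glue

instance (P : PolygonScheme) : TopologicalSpace P.Surface :=
  inferInstanceAs (TopologicalSpace (Quot _))

end PolygonScheme

/-- Punctured orientable surfaces (connected, of finite type, without boundary and with at least
one puncture): the connected spaces obtained from finitely many once-punctured polygons by gluing
their sides in pairs, reversing orientation. -/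
def IsPuncturedSurface (X : Type) [TopologicalSpace X] : Prop :=
  ConnectedSpace X ∧ ∃ P : PolygonScheme, Nonempty (X ≃ₜ P.Surface)

/-- A homotopy marked surface `(Σ, s)`. -/
structure MarkedSurface (n : ℕ) where
  carrier : Type
  top : TopologicalSpace carrier
  isPuncturedSurface : IsPuncturedSurface carrier
  marking : Marking n carrier

attribute [instance] MarkedSurface.top

/-- `(Σ, s ∘ φ)`. -/
def MarkedSurface.precomp {n : ℕ} (S : MarkedSurface n) (φ : MulAut (F n)) : MarkedSurface n :=
  ⟨S.carrier, S.top, S.isPuncturedSurface, S.marking.precomp φ⟩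

/-- A ribbon structure on a graph: a cyclic ordering of the half-edges at each vertex, given by
the permutation `rot` taking each half-edge to the one that directly follows it. -/
structure RibbonStructure (Γ : Graph) where
  rot : Equiv.Perm Γ.H
  sameCycle_iff : ∀ h h', rot.SameCycle h h' ↔ Γ.src h = Γ.src h'

namespace RibbonStructure

variable {Γ : Graph} (O : RibbonStructure Γ)

theorem src_rot (h : Γ.H) : Γ.src (O.rot h) = Γ.src h :=
  ((O.sameCycle_iff h (O.rot h)).1 ⟨1, by simp⟩).symm

/-- The gluing scheme whose polygons are the boundary cycles of a ribbon graph: the directed edge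
following `h` in its boundary cycle leaves along the half-edge directly following `inv h`. -/
def scheme : PolygonScheme where
  side := Γ.H
  finSide := Γ.finH
  next := (Function.Involutive.toPerm Γ.inv Γ.inv_inv).trans O.rot
  inv := Γ.inv
  inv_inv := Γ.inv_inv
  inv_ne := Γ.inv_ne

/-- The punctured surface `|Γ, O|` obtained by gluing a once-punctured disk to `Γ` along each
boundary cycle. -/
abbrev Surface : Type := O.scheme.Surface

/-- The image in `|Γ, O|` of the point at parameter `t` on the directed edge `h`. -/
def edgePt (h : Γ.H) (t : I) : O.Surface := Quot.mk _ ⟨h, (t, 0)⟩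

theorem edgePt_flip (h : Γ.H) (t : I) : O.edgePt h t = O.edgePt (Γ.inv h) (σ t) :=
  Quot.sound (.side (P := O.scheme) h t)

theorem edgePt_rot (h : Γ.H) : O.edgePt (O.rot h) 0 = O.edgePt h 0 := by
  have h1 : O.edgePt (Γ.inv h) 1 = O.edgePt (O.rot (Γ.inv (Γ.inv h))) 0 :=
    Quot.sound (.strip (P := O.scheme) (Γ.inv h) 0)
  rw [Γ.inv_inv] at h1
  rw [← h1, O.edgePt_flip h 0, unitInterval.symm_zero]

theorem edgePt_zero {h h' : Γ.H} (e : Γ.src h = Γ.src h') : O.edgePt h 0 = O.edgePt h' 0 := by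
  have := Γ.finH
  obtain ⟨k, -, rfl⟩ := ((O.sameCycle_iff h h').2 e).exists_pow_eq'
  clear e
  induction k with
  | zero => rfl
  | succ k ih => rw [pow_succ', Equiv.Perm.mul_apply, O.edgePt_rot, ih]

/-- The inclusion `i : Γ → |Γ, O|`. -/
def incl : C(Γ.Real, O.Surface) :=
  Γ.lift O.edgePt
    (fun _ => continuous_quot_mk.comp (continuous_sigmaMk.comp (by fun_prop)))
    O.edgePt_flip (fun _ _ => O.edgePt_zero)

end RibbonStructure

/-! ## The cover of the spine by ribbon graph complexes, and its nerve -/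

/-- The marked graph `m` can be drawn in the marked surface `(Σ, s)`, up to orientation:
`m = (Γ, g)` where `Γ` has a ribbon structure `O` such that some homeomorphism `h : |Γ, O| → Σ`
satisfies `h ∘ i ∘ g ≃ s`. As reversing `O` reverses the orientation of `|Γ, O|`, allowing
orientation-reversing homeomorphisms here gives the same marked graphs. -/
def MarkedGraph.CanBeDrawnIn {n : ℕ} (m : MarkedGraph n) (S : MarkedSurface n) : Prop :=
  ∃ A : PreMarkedGraph n, m = .mk A ∧ ∃ (O : RibbonStructure A.graph) (h : O.Surface ≃ₜ S.carrier),
    Marking.Carries ((h : C(O.Surface, S.carrier)).comp O.incl) A.marking S.marking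

/-- The ribbon graph complex of a marked surface: the subcomplex of `K_n` spanned by the graphs
that can be drawn in the surface. -/
def ribbonComplex {n : ℕ} (S : MarkedSurface n) : GraphComplex n where
  faces := {s | s ∈ spine n ∧ ∀ m ∈ s, m.CanBeDrawnIn S}
  isRelLowerSet_faces := fun _ hs =>
    ⟨hs.1.1, fun _ hts ht =>
      ⟨((spine n).isRelLowerSet_faces hs.1).2 hts ht, fun m hm => hs.2 m (hts hm)⟩⟩

/-- The nerve `N_n` of the cover of `K_n` by the ribbon graph complexes: its simplices are the
finite nonempty collections of ribbon graph complexes with nonempty intersection. -/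
def nerve (n : ℕ) : PreAbstractSimplicialComplex (GraphComplex n) where
  faces := {τ | τ.Nonempty ∧ (∀ R ∈ τ, ∃ S : MarkedSurface n, R = ribbonComplex S) ∧
    ∃ s : Finset (MarkedGraph n), ∀ R ∈ τ, s ∈ R}
  isRelLowerSet_faces := fun _ hτ => ⟨hτ.1, fun _ hts ht =>
    ⟨ht, fun R hR => hτ.2.1 R (hts hR), hτ.2.2.imp fun _ h R hR => h R (hts hR)⟩⟩

/-! ## The action of `Out(F_n)` on the nerve -/

/-- The action on complexes of marked graphs, through the action on vertices. -/
instance (n : ℕ) : MulAction (Out n)ᵐᵒᵖ (GraphComplex n) where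
  smul ψ K := K.map (ψ • ·)
  one_smul K := by
    apply PreAbstractSimplicialComplex.ext
    change (fun s : Finset (MarkedGraph n) => s.image _) '' K.faces = K.faces
    simp
  mul_smul ψ χ K := by
    apply PreAbstractSimplicialComplex.ext
    change (fun s : Finset (MarkedGraph n) => s.image _) '' K.faces =
      (fun s : Finset (MarkedGraph n) => s.image _) ''
        ((fun s : Finset (MarkedGraph n) => s.image _) '' K.faces)
    rw [Set.image_image]
    refine Set.image_congr fun s _ => ?_
    rw [Finset.image_image]
    exact Finset.image_congr fun m _ => mul_smul ψ χ m

theorem mem_smul_complex {n : ℕ} (ψ : (Out n)ᵐᵒᵖ) (K : GraphComplex n)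
    (s : Finset (MarkedGraph n)) : s ∈ ψ • K ↔ ∃ t ∈ K, ψ • t = s := Iff.rfl

theorem IsCollapse.smul {n : ℕ} {m m' : MarkedGraph n} (h : m.IsCollapse m') (ψ : (Out n)ᵐᵒᵖ) :
    (ψ • m).IsCollapse (ψ • m') := by
  obtain ⟨A, A', rfl, rfl, q, hq⟩ := h
  obtain ⟨φ, hφ⟩ := QuotientGroup.mk_surjective ψ.unop
  obtain rfl : ψ = MulOpposite.op (φ : Out n) := by rw [hφ, MulOpposite.op_unop]
  exact ⟨A.precomp φ, A'.precomp φ, rfl, rfl, q, hq.precomp φ⟩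

theorem smul_mem_spine {n : ℕ} (ψ : (Out n)ᵐᵒᵖ) {s : Finset (MarkedGraph n)} (hs : s ∈ spine n) :
    ψ • s ∈ spine n := by
  refine ⟨hs.1.image _, ?_⟩
  intro a ha b hb hab
  obtain ⟨a, ha', rfl⟩ := Finset.mem_smul_finset.1 (Finset.mem_coe.1 ha)
  obtain ⟨b, hb', rfl⟩ := Finset.mem_smul_finset.1 (Finset.mem_coe.1 hb)
  have hne : a ≠ b := fun e => hab (by rw [e])
  exact (hs.2 ha' hb' hne).imp (fun h => IsCollapse.smul h ψ) (fun h => IsCollapse.smul h ψ)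

theorem CanBeDrawnIn.precomp {n : ℕ} {m : MarkedGraph n} {S : MarkedSurface n}
    (h : m.CanBeDrawnIn S) (φ : MulAut (F n)) :
    (MulOpposite.op (φ : Out n) • m).CanBeDrawnIn (S.precomp φ) := by
  obtain ⟨A, rfl, O, e, he⟩ := h
  exact ⟨A.precomp φ, rfl, O, e, he.precomp φ⟩

theorem smul_ribbonComplex_le {n : ℕ} (φ : MulAut (F n)) (S : MarkedSurface n) :
    MulOpposite.op (φ : Out n) • ribbonComplex S ≤ ribbonComplex (S.precomp φ) := by
  rintro s ⟨t, ht, rfl⟩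
  refine ⟨smul_mem_spine _ ht.1, fun m hm => ?_⟩
  obtain ⟨m', hm', rfl⟩ := Finset.mem_image.1 hm
  exact CanBeDrawnIn.precomp (ht.2 m' hm') φ

/-- The action permutes the ribbon graph complexes. -/
theorem smul_ribbonComplex {n : ℕ} (φ : MulAut (F n)) (S : MarkedSurface n) :
    MulOpposite.op (φ : Out n) • ribbonComplex S = ribbonComplex (S.precomp φ) := by
  refine le_antisymm (smul_ribbonComplex_le φ S) fun s hs => ?_
  have h := smul_ribbonComplex_le φ⁻¹ (S.precomp φ)
    ((mem_smul_complex _ _ _).2 ⟨s, hs, rfl⟩)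
  have hS : (S.precomp φ).precomp φ⁻¹ = S := by
    have h : (S.marking.precomp φ).precomp φ⁻¹ = S.marking := by
      have e : (φ⁻¹).trans (φ.trans S.marking.iso) = S.marking.iso :=
        MulEquiv.ext fun w => congrArg S.marking.iso (φ.apply_symm_apply w)
      exact congrArg (Marking.mk S.marking.base) e
    exact congrArg (MarkedSurface.mk S.carrier S.top S.isPuncturedSurface) h
  rw [hS] at h
  refine (mem_smul_complex _ _ _).2 ⟨_, h, ?_⟩
  rw [QuotientGroup.mk_inv, MulOpposite.op_inv, smul_inv_smul]

/-- The simplices of the nerve, with the action of `Out(F_n)`. -/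
def nerveSimplices (n : ℕ) : SubMulAction (Out n)ᵐᵒᵖ (Finset (GraphComplex n)) where
  carrier := {τ | τ ∈ nerve n}
  smul_mem' := by
    rintro ψ τ ⟨hne, hR, s, hs⟩
    obtain ⟨φ, hφ⟩ := QuotientGroup.mk_surjective ψ.unop
    obtain rfl : ψ = MulOpposite.op (φ : Out n) := by rw [hφ, MulOpposite.op_unop]
    refine ⟨hne.image _, fun R hR' => ?_, MulOpposite.op (φ : Out n) • s, fun R hR' => ?_⟩
    · obtain ⟨R, hm, rfl⟩ := Finset.mem_image.1 hR'
      obtain ⟨S, rfl⟩ := hR R hm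
      exact ⟨S.precomp φ, smul_ribbonComplex φ S⟩
    · obtain ⟨R, hm, rfl⟩ := Finset.mem_image.1 hR'
      exact ⟨s, hs R hm, rfl⟩

/-- The `k`-dimensional simplices of the nerve, with the action of `Out(F_n)`. -/
def nerveSimplicesOfDim (n k : ℕ) : SubMulAction (Out n)ᵐᵒᵖ (Finset (GraphComplex n)) where
  carrier := {τ | τ ∈ nerve n ∧ τ.card = k + 1}
  smul_mem' := fun ψ τ hτ => ⟨(nerveSimplices n).smul_mem ψ hτ.1,
    (Finset.card_smul_finset ψ τ).trans hτ.2⟩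

/-- The vertices of the nerve joined to `R` by an edge; their number is the valence of `R`. -/
def nerveNeighbors {n : ℕ} (R : GraphComplex n) : Set (GraphComplex n) :=
  {R' | R' ≠ R ∧ {R, R'} ∈ nerve n}

end RibbonNerve

end

/-!
**Finitely many orbits.** By the valence condition an Euler characteristic count bounds the number
of half-edges of a marked graph by `6 * n` (`PreMarkedGraph.card_le`), so there are finitely many
underlying graphs up to isomorphism, hence finitely many marked graphs up to `Out(F_n)`
(`MarkedGraph.exists_finite_reps`). A marked graph lies in finitely many ribbon graph complexes,
since such a complex is determined by a ribbon structure on the graph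
(`MarkedGraph.finite_complexes`). All members of a simplex of the nerve contain a common marked
graph, which can be moved into a finite set of representatives, and then only finitely many
simplices are left (`finite_orbits_of_subset_nerve`).

**Infinite valence.** Let `R` be the ribbon graph complex of a marked surface `(Σ, s)`. By slides of
edges and removal of bivalent vertices `Σ` is the surface of a rose `Γ` with a ribbon structure `O`
(`exists_one_vertex`). For `n ≥ 3` the rose has at least three edges (`exists_third_edge`), and it
can be chosen to have a loop `f` whose two half-edges separate the other ones, in the cyclic order,
into two nonempty blocks `Z` and `A` (`exists_blockOrder`). Dragging the block `Z` around `f`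
brings the cyclic order back to itself, and so defines a homeomorphism of `|Γ, O|`, a twist
(`exists_twist`). Its powers `T k` give markings `g k` of `Γ` such that all `(Γ, g k)` can be drawn
in `(Σ, s)`. Let `O'` be another ribbon structure on `Γ`, with the marked surface `|Γ, O'|` in which
`(Γ, g k)` is drawn; its complex `R k` meets `R` in `(Γ, g k)`. It remains to see that there are
infinitely many different complexes among the `R k` (`nerveNeighbors_infinite`).

If infinitely many of them agree with `R l`, then `(Γ, g l)` can be drawn in the marked surfaces of
all those `k`, so that each boundary curve `c` of `O'`, read in `π₁(Σ)` through `g k`, is conjugate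
to a power of a boundary curve of one of the finitely many ribbon structures `O''` on `Γ`, read
through `g l`. This uses that a homeomorphism of punctured surfaces preserves peripheral curves up to
powers (`exists_isConj_boundaryHol`). But `O'` can be chosen so that the images of one boundary
curve `c` under the twists are told apart by a homomorphism to the product of a Heisenberg group with `ℤ`:
their values are the central elements `(0, 0, ± k, 1)`, whose last coordinate forces the power to be
`± 1` (`IsBlockOrder.exists_boundaryHol`). Here `c` is a single loop with one half-edge in `Z` and
the other one in `A`, if there is one, and otherwise the product of a loop in `Z` and a loop in `A`.

**Holonomies.** Instead of fundamental groups with base points, the proof works with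
holonomies (`Hol`): rules that assign elements of a group to pieces of curves, multiplicatively and
invariantly under homotopies. They can be pulled back along continuous maps and evaluated on curves
in a surface directly. Those used on graphs come from the covering of a nilmanifold by a vector
space (`Graph.exists_hol`).
-/

noncomputable section
namespace RibbonNerve

/-! ### Holonomy of curves -/

/-- A holonomy on `X` with values in `G` assigns an element of `G` to each piece `c|[a, b]` of a
curve `c` in `X`. Curves are parametrized by the whole real line, so that pieces can be cut out and
reparametrized freely. The axiom says that the holonomy is trivialized by a potential `u` along
every singular plane in `X`; it contains multiplicativity and homotopy invariance. -/
structure Hol (X : Type*) [TopologicalSpace X] (G : Type*) [Group G] where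
  val : C(ℝ, X) → ℝ → ℝ → G
  plane : ∀ E : C(ℝ × ℝ, X), ∃ u : ℝ × ℝ → G, ∀ (κ : C(ℝ, ℝ × ℝ)) (a b : ℝ),
    val (E.comp κ) a b = (u (κ a))⁻¹ * u (κ b)

namespace Hol

variable {X Y Z : Type*} [TopologicalSpace X] [TopologicalSpace Y] [TopologicalSpace Z]
  {G G' : Type*} [Group G] [Group G']

/-- Pullback of a holonomy along a continuous map. -/
def comap (ρ : Hol Y G) (f : C(X, Y)) : Hol X G where
  val c a b := ρ.val (f.comp c) a b
  plane E := ρ.plane (f.comp E)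

theorem comap_val (ρ : Hol Y G) (f : C(X, Y)) (c : C(ℝ, X)) (a b : ℝ) :
    (ρ.comap f).val c a b = ρ.val (f.comp c) a b := rfl

theorem comap_comp (ρ : Hol Z G) (g : C(Y, Z)) (f : C(X, Y)) :
    ρ.comap (g.comp f) = (ρ.comap g).comap f := rfl

/-- Change of the coefficient group. -/
def map (ρ : Hol X G) (θ : G →* G') : Hol X G' where
  val c a b := θ (ρ.val c a b)
  plane E := by
    obtain ⟨u, hu⟩ := ρ.plane E
    exact ⟨fun p => θ (u p), fun κ a b => by rw [hu, map_mul, map_inv]⟩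

variable (ρ : Hol X G)

theorem line (c : C(ℝ, X)) : ∃ u : ℝ → G, ∀ (κ : C(ℝ, ℝ)) (a b : ℝ),
    ρ.val (c.comp κ) a b = (u (κ a))⁻¹ * u (κ b) := by
  obtain ⟨u, hu⟩ := ρ.plane (c.comp ⟨Prod.fst, continuous_fst⟩)
  exact ⟨fun t => u (t, 0), fun κ a b => hu ⟨fun t => (κ t, 0), by fun_prop⟩ a b⟩

theorem val_comp (c : C(ℝ, X)) (κ : C(ℝ, ℝ)) (a b : ℝ) :
    ρ.val (c.comp κ) a b = ρ.val c (κ a) (κ b) := by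
  obtain ⟨u, hu⟩ := ρ.line c
  rw [hu, show c = c.comp (ContinuousMap.id ℝ) from rfl, hu]
  rfl

theorem val_mul (c : C(ℝ, X)) (a b d : ℝ) : ρ.val c a b * ρ.val c b d = ρ.val c a d := by
  obtain ⟨u, hu⟩ := ρ.line c
  rw [show c = c.comp (ContinuousMap.id ℝ) from rfl, hu, hu, hu]
  group

theorem val_self (c : C(ℝ, X)) (a : ℝ) : ρ.val c a a = 1 := by
  simpa using ρ.val_mul c a a a

theorem val_inv (c : C(ℝ, X)) (a b : ℝ) : (ρ.val c a b)⁻¹ = ρ.val c b a := by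
  rw [inv_eq_iff_mul_eq_one, val_mul, val_self]

/-- The holonomy of a piece of a curve depends on that piece only. -/
theorem val_congr {c c' : C(ℝ, X)} {a b : ℝ} (hab : a ≤ b)
    (h : ∀ t, a ≤ t → t ≤ b → c t = c' t) : ρ.val c a b = ρ.val c' a b := by
  let κ : C(ℝ, ℝ) := ⟨fun t => max a (min b t), by fun_prop⟩
  have ha : κ a = a := by simp [κ, hab]
  have hb : κ b = b := by simp [κ, hab]
  have e : c.comp κ = c'.comp κ := by
    ext t
    exact h _ (le_max_left _ _) (max_le hab (min_le_left _ _))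
  rw [← ha, ← hb, ← val_comp, ← val_comp, e]

theorem val_const (x : X) (a b : ℝ) : ρ.val (.const ℝ x) a b = 1 := by
  obtain ⟨u, hu⟩ := ρ.line (.const ℝ x)
  have := hu (.const ℝ 0) a b
  simpa using this

theorem val_eq_one {c : C(ℝ, X)} {a b : ℝ} (hab : a ≤ b) (x : X)
    (h : ∀ t, a ≤ t → t ≤ b → c t = x) : ρ.val c a b = 1 := by
  rw [ρ.val_congr hab (c' := .const ℝ x) h, val_const]

/-! ### Holonomy of paths and of elements of the fundamental group -/

/-- A path as a curve parametrized by the real line. -/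
def curve {x y : X} (p : Path x y) : C(ℝ, X) := ⟨p.extend, p.continuous_extend⟩

/-- The holonomy of a path. -/
def path {x y : X} (p : Path x y) : G := ρ.val (curve p) 0 1

theorem path_trans {x y z : X} (p : Path x y) (q : Path y z) :
    ρ.path (p.trans q) = ρ.path p * ρ.path q := by
  let κ : C(ℝ, ℝ) := ⟨fun t => 2 * t, by fun_prop⟩
  let κ' : C(ℝ, ℝ) := ⟨fun t => 2 * t - 1, by fun_prop⟩
  have h1 : ρ.val (curve (p.trans q)) 0 (1 / 2) = ρ.path p := by
    have : ρ.path p = ρ.val ((curve p).comp κ) 0 (1 / 2) := by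
      rw [val_comp]; simp [κ, path]
    rw [this]
    refine ρ.val_congr (by norm_num) fun t h0 h1 => ?_
    change (p.trans q).extend t = p.extend (2 * t)
    exact Path.extend_trans_of_le_half p q h1
  have h2 : ρ.val (curve (p.trans q)) (1 / 2) 1 = ρ.path q := by
    have : ρ.path q = ρ.val ((curve q).comp κ') (1 / 2) 1 := by
      rw [val_comp]; norm_num [κ', path]
    rw [this]
    refine ρ.val_congr (by norm_num) fun t h0 h1 => ?_
    change (p.trans q).extend t = q.extend (2 * t - 1)
    exact Path.extend_trans_of_half_le p q h0
  rw [← h1, ← h2, val_mul, path]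

theorem path_refl (x : X) : ρ.path (Path.refl x) = 1 :=
  ρ.val_eq_one zero_le_one x fun t _ _ => by simp [curve]

theorem path_homotopic {x y : X} {p q : Path x y} (h : p.Homotopic q) : ρ.path p = ρ.path q := by
  obtain ⟨K⟩ := h
  let E : C(ℝ × ℝ, X) := ⟨fun z => K (Set.projIcc 0 1 zero_le_one z.1,
    Set.projIcc 0 1 zero_le_one z.2), by
      have := K.continuous
      have h1 : Continuous fun z : ℝ × ℝ => (Set.projIcc (0 : ℝ) 1 zero_le_one z.1 : I) :=
        continuous_projIcc.comp continuous_fst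
      have h2 : Continuous fun z : ℝ × ℝ => (Set.projIcc (0 : ℝ) 1 zero_le_one z.2 : I) :=
        continuous_projIcc.comp continuous_snd
      exact this.comp (h1.prodMk h2)⟩
  obtain ⟨u, hu⟩ := ρ.plane E
  have e0 : ρ.val (E.comp ⟨fun t => (0, t), by fun_prop⟩) 0 1 = ρ.path p :=
    ρ.val_congr zero_le_one fun t _ _ => by
      simp [E, curve, Path.extend, Set.IccExtend, Set.projIcc_left]
  have e1 : ρ.val (E.comp ⟨fun t => (1, t), by fun_prop⟩) 0 1 = ρ.path q :=
    ρ.val_congr zero_le_one fun t _ _ => by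
      simp [E, curve, Path.extend, Set.IccExtend, Set.projIcc_right]
  have e2 : ρ.val (E.comp ⟨fun t => (t, 0), by fun_prop⟩) 0 1 = 1 :=
    ρ.val_eq_one zero_le_one x fun t _ _ => by simp [E, Set.projIcc_left]
  have e3 : ρ.val (E.comp ⟨fun t => (t, 1), by fun_prop⟩) 0 1 = 1 :=
    ρ.val_eq_one zero_le_one y fun t _ _ => by simp [E, Set.projIcc_right]
  rw [hu] at e0 e1 e2 e3
  simp only [ContinuousMap.coe_mk] at e0 e1 e2 e3
  rw [← e0, ← e1, ← inv_mul_eq_one.1 e2, ← inv_mul_eq_one.1 e3]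

/-- The holonomy of an element of the fundamental group. As Mathlib composes loops from right to
left, this is an antihomomorphism. -/
def pi {x : X} (a : FundamentalGroup X x) : G :=
  Quotient.lift (s := Path.Homotopic.setoid x x) (fun p => ρ.path p)
    (fun _ _ h => ρ.path_homotopic h) (FundamentalGroup.toPath a)

theorem pi_mk {x : X} (p : Path x x) : ρ.pi (FundamentalGroup.fromPath (.mk p)) = ρ.path p := rfl

theorem pi_mul {x : X} (a b : FundamentalGroup X x) : ρ.pi (a * b) = ρ.pi b * ρ.pi a := by
  obtain ⟨p, rfl⟩ := Quotient.exists_rep a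
  obtain ⟨q, rfl⟩ := Quotient.exists_rep b
  exact ρ.path_trans q p

theorem path_symm {x y : X} (p : Path x y) : ρ.path p.symm = (ρ.path p)⁻¹ := by
  rw [eq_inv_iff_mul_eq_one, ← path_trans,
    ρ.path_homotopic ⟨(Path.Homotopy.reflSymmTrans p).symm⟩, path_refl]

theorem pi_transport {X : Type} [TopologicalSpace X] (ρ : Hol X G) {x y : X} (p : Path x y)
    (a : FundamentalGroup X x) :
    ρ.pi (transport p a) = (ρ.path p)⁻¹ * ρ.pi a * ρ.path p := by
  obtain ⟨q, rfl⟩ := Quotient.exists_rep a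
  change ρ.path (p.symm.trans (q.trans p)) = _
  rw [path_trans, path_trans, path_symm, mul_assoc]
  rfl

theorem pi_map {X Y : Type} [TopologicalSpace X] [TopologicalSpace Y] (ρ : Hol Y G) (f : C(X, Y))
    {x : X} (a : FundamentalGroup X x) :
    ρ.pi (FundamentalGroup.map f x a) = (ρ.comap f).pi a := by
  obtain ⟨q, rfl⟩ := Quotient.exists_rep a
  change ρ.path (q.map f.continuous) = (ρ.comap f).path q
  exact ρ.val_congr zero_le_one fun t _ _ => rfl

/-- Holonomies do not see the base point of a marking, up to conjugation. -/
theorem isConj_of_carries {n : ℕ} {X Y : Type} [TopologicalSpace X] [TopologicalSpace Y]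
    (ρ : Hol Y G) {f : C(X, Y)} {s : Marking n X} {t : Marking n Y} (h : Marking.Carries f s t)
    (w : F n) : IsConj ((ρ.comap f).pi (s.iso w)) (ρ.pi (t.iso w)) := by
  obtain ⟨p, hp⟩ := h
  rw [hp, pi_transport, pi_map, isConj_iff]
  exact ⟨(ρ.path p)⁻¹, by rw [inv_inv]⟩

/-- Each closed curve in a path connected space is represented by an element of the marked
fundamental group, simultaneously for all holonomies. -/
theorem exists_isConj_pi {n : ℕ} {X : Type} [TopologicalSpace X] [PathConnectedSpace X]
    (s : Marking n X) (c : C(ℝ, X)) {a b : ℝ} (hc : c a = c b) :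
    ∃ w : F n, ∀ ρ : Hol X G, IsConj (ρ.val c a b) (ρ.pi (s.iso w)) := by
  let κ : C(ℝ, ℝ) := ⟨fun t => a + t * (b - a), by fun_prop⟩
  let p : Path (c a) (c a) :=
    { toFun := fun t => c (κ t)
      continuous_toFun := by fun_prop
      source' := by simp [κ]
      target' := by simp [κ, hc] }
  let q := PathConnectedSpace.somePath (c a) s.base
  refine ⟨s.iso.symm (transport q (FundamentalGroup.fromPath (.mk p))), fun ρ => ?_⟩
  rw [MulEquiv.apply_symm_apply, pi_transport, pi_mk, isConj_iff]
  refine ⟨(ρ.path q)⁻¹, ?_⟩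
  have : ρ.path p = ρ.val c a b := by
    have h := ρ.val_comp c κ 0 1
    simp only [κ, ContinuousMap.coe_mk, zero_mul, add_zero, one_mul, add_sub_cancel] at h
    rw [← h]
    refine ρ.val_congr zero_le_one fun t h0 h1 => ?_
    change p.extend t = _
    rw [Path.extend_apply _ ⟨h0, h1⟩]
    rfl
  rw [this, inv_inv]

end Hol

/-! ### Holonomy of a covering -/

namespace Hol

section Covering

variable {E X : Type} [TopologicalSpace E] [TopologicalSpace X] {G : Type} [Group G]
  [MulAction G E] {f : E → X} (hf : IsQuotientCoveringMap f G) {s : X → E}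
  (hs : ∀ x, f (s x) = x)

theorem exists_lift (hf : IsQuotientCoveringMap f G) {A : Type} [TopologicalSpace A]
    [SimplyConnectedSpace A] [LocallyPathConnectedSpace A] (c : C(A, X)) :
    ∃ L : C(A, E), f ∘ L = c := by
  obtain ⟨a⟩ : Nonempty A := inferInstance
  obtain ⟨e, he⟩ := hf.surjective (c a)
  obtain ⟨L, ⟨-, hL⟩, -⟩ := hf.isCoveringMap.existsUnique_continuousMap_lifts c a e he
  exact ⟨L, hL⟩

theorem exists_smul_lift (hf : IsQuotientCoveringMap f G) {A : Type} [TopologicalSpace A]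
    [SimplyConnectedSpace A] [LocallyPathConnectedSpace A] {L L' : C(A, E)} (h : f ∘ L = f ∘ L') :
    ∃ g : G, ∀ a, L' a = g • L a := by
  obtain ⟨a⟩ : Nonempty A := inferInstance
  obtain ⟨g, hg⟩ := hf.apply_eq_iff_mem_orbit.1 (congrFun h.symm a)
  have := hf.toContinuousConstSMul
  let L'' : C(A, E) := ⟨fun b => g • L b, by fun_prop⟩
  have hu := hf.isCoveringMap.existsUnique_continuousMap_lifts
    ⟨f ∘ L', hf.isCoveringMap.continuous.comp L'.continuous⟩ a (L' a) rfl
  have e : L' = L'' := hu.unique ⟨rfl, rfl⟩ ⟨hg, by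
    refine Eq.trans (funext fun b => ?_) h
    exact hf.map_smul g⟩
  exact ⟨g, fun b => by rw [e]; rfl⟩

theorem exists_frame (hf : IsQuotientCoveringMap f G) (hs : ∀ x, f (s x) = x) (e : E) :
    ∃ g : G, e = g • s (f e) := by
  obtain ⟨g, hg⟩ := hf.apply_eq_iff_mem_orbit.1 (hs (f e)).symm
  exact ⟨g, hg.symm⟩

/-- The position of a point of the total space relative to the section. -/
def frame (e : E) : G := (exists_frame hf hs e).choose

theorem frame_spec (e : E) : e = frame hf hs e • s (f e) := (exists_frame hf hs e).choose_spec

theorem frame_eq {e : E} {g : G} (h : e = g • s (f e)) : frame hf hs e = g := by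
  have := hf.isCancelSMul
  exact IsCancelSMul.right_cancel _ _ (s (f e)) ((frame_spec hf hs e).symm.trans h)

theorem frame_smul (g : G) (e : E) : frame hf hs (g • e) = g * frame hf hs e := by
  apply frame_eq
  rw [hf.map_smul, mul_smul, ← frame_spec]

/-- The holonomy of a covering by a discrete group, with respect to a section `s` (not necessarily
continuous) that provides frames in the fibres. -/
def ofCovering : Hol X G where
  val c a b := (frame hf hs ((exists_lift hf c).choose a))⁻¹ *
    frame hf hs ((exists_lift hf c).choose b)
  plane c := by
    obtain ⟨L, hL⟩ := exists_lift hf c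
    refine ⟨fun p => frame hf hs (L p), fun κ a b => ?_⟩
    have h1 := (exists_lift hf (c.comp κ)).choose_spec
    obtain ⟨g, hg⟩ := exists_smul_lift hf (L := L.comp κ)
      (L' := (exists_lift hf (c.comp κ)).choose) (by
        rw [h1]
        exact funext fun t => congrFun hL (κ t))
    rw [hg, hg, frame_smul, frame_smul]
    simp only [ContinuousMap.comp_apply]
    group

theorem ofCovering_val (L : C(ℝ, E)) (c : C(ℝ, X)) (h : f ∘ L = c) (a b : ℝ) :
    (ofCovering hf hs).val c a b = (frame hf hs (L a))⁻¹ * frame hf hs (L b) := by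
  have h1 := (exists_lift hf c).choose_spec
  obtain ⟨g, hg⟩ := exists_smul_lift hf (L := L) (L' := (exists_lift hf c).choose) (by rw [h1, h])
  change (frame hf hs ((exists_lift hf c).choose a))⁻¹ *
    frame hf hs ((exists_lift hf c).choose b) = _
  rw [hg, hg, frame_smul, frame_smul]
  group

end Covering

end Hol

/-! ### A nilpotent group acting on a real vector space -/

/-- The product of the integral Heisenberg group, with the coordinates `a`, `b` and the central
coordinate `c`, and the group `ℤ`, with the coordinate `d`. -/
@[ext]
structure Nil where
  a : ℤ
  b : ℤ
  c : ℤ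
  d : ℤ

namespace Nil

instance : One Nil := ⟨⟨0, 0, 0, 0⟩⟩
instance : Mul Nil := ⟨fun x y => ⟨x.a + y.a, x.b + y.b, x.c + y.c + x.a * y.b, x.d + y.d⟩⟩
instance : Inv Nil := ⟨fun x => ⟨-x.a, -x.b, -x.c + x.a * x.b, -x.d⟩⟩

@[simp] theorem one_a : (1 : Nil).a = 0 := rfl
@[simp] theorem one_b : (1 : Nil).b = 0 := rfl
@[simp] theorem one_c : (1 : Nil).c = 0 := rfl
@[simp] theorem one_d : (1 : Nil).d = 0 := rfl
@[simp] theorem mul_a (x y : Nil) : (x * y).a = x.a + y.a := rfl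
@[simp] theorem mul_b (x y : Nil) : (x * y).b = x.b + y.b := rfl
@[simp] theorem mul_c (x y : Nil) : (x * y).c = x.c + y.c + x.a * y.b := rfl
@[simp] theorem mul_d (x y : Nil) : (x * y).d = x.d + y.d := rfl
@[simp] theorem inv_a (x : Nil) : (x⁻¹).a = -x.a := rfl
@[simp] theorem inv_b (x : Nil) : (x⁻¹).b = -x.b := rfl
@[simp] theorem inv_c (x : Nil) : (x⁻¹).c = -x.c + x.a * x.b := rfl
@[simp] theorem inv_d (x : Nil) : (x⁻¹).d = -x.d := rfl

instance : Group Nil := Group.ofLeftAxioms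
  (fun x y z => by ext <;> simp <;> ring)
  (fun x => by ext <;> simp)
  (fun x => by ext <;> simp)

/-- The last coordinate as a homomorphism. -/
def dHom : Nil →* Multiplicative ℤ where
  toFun x := .ofAdd x.d
  map_one' := rfl
  map_mul' _ _ := rfl

/-- The space on which `Nil` acts by affine maps. -/
abbrev Space : Type := ℝ × ℝ × ℝ × ℝ

instance : MulAction Nil Space where
  smul x p := (p.1 + x.a, p.2.1 + x.b, p.2.2.1 + x.c + x.a * p.2.1, p.2.2.2 + x.d)
  one_smul p := by
    change (p.1 + ((0 : ℤ) : ℝ), p.2.1 + ((0 : ℤ) : ℝ),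
      p.2.2.1 + ((0 : ℤ) : ℝ) + ((0 : ℤ) : ℝ) * p.2.1, p.2.2.2 + ((0 : ℤ) : ℝ)) = p
    simp
  mul_smul x y p := by
    change (p.1 + ((x.a + y.a : ℤ) : ℝ), p.2.1 + ((x.b + y.b : ℤ) : ℝ),
      p.2.2.1 + ((x.c + y.c + x.a * y.b : ℤ) : ℝ) + ((x.a + y.a : ℤ) : ℝ) * p.2.1,
      p.2.2.2 + ((x.d + y.d : ℤ) : ℝ)) =
      (p.1 + (y.a : ℝ) + x.a, p.2.1 + (y.b : ℝ) + x.b,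
        p.2.2.1 + y.c + y.a * p.2.1 + x.c + x.a * (p.2.1 + y.b), p.2.2.2 + (y.d : ℝ) + x.d)
    push_cast
    ext <;> simp <;> ring

theorem smul_def (x : Nil) (p : Space) :
    x • p = (p.1 + x.a, p.2.1 + x.b, p.2.2.1 + x.c + x.a * p.2.1, p.2.2.2 + x.d) := rfl

theorem isQuotientCoveringMap :
    IsQuotientCoveringMap (Quotient.mk (MulAction.orbitRel Nil Space)) Nil where
  toIsQuotientMap := isQuotientMap_quotient_mk'
  continuous_const_smul x := by
    simp only [smul_def]
    fun_prop
  apply_eq_iff_mem_orbit := Quotient.eq''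
  disjoint e := by
    refine ⟨Metric.ball e (1 / 2), Metric.ball_mem_nhds _ (by norm_num), ?_⟩
    rintro g ⟨_, ⟨p, hp, rfl⟩, hq⟩
    have key : ∀ (u v w : ℝ) (k : ℤ), dist u w < 1 / 2 → dist v w < 1 / 2 → v = u + k → k = 0 := by
      rintro u v w k h1 h2 rfl
      have h : dist (u + k) u < 1 := by linarith [dist_triangle_right (u + k) u w]
      rw [Real.dist_eq, add_sub_cancel_left] at h
      exact_mod_cast Int.abs_lt_one_iff.1 (by exact_mod_cast h)
    simp only [smul_def, Metric.mem_ball, Prod.dist_eq, max_lt_iff] at hp hq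
    obtain ⟨h1, h2, h3, h4⟩ := hp
    obtain ⟨k1, k2, k3, k4⟩ := hq
    have ha := key _ _ _ g.a h1 k1 rfl
    ext
    · exact ha
    · exact key _ _ _ g.b h2 k2 rfl
    · exact key _ _ _ g.c h3 k3 (by simp [ha])
    · exact key _ _ _ g.d h4 k4 rfl

/-- The quotient of the vector space by `Nil`. -/
abbrev Manifold : Type := Quotient (MulAction.orbitRel Nil Space)

/-- The point at time `t` of the straight curve from the base point to its translate. -/
def ray (x : Nil) (t : ℝ) : Space := t • (x • (0 : Space))

theorem ray_def (x : Nil) (t : ℝ) : ray x t = (t * x.a, t * x.b, t * x.c, t * x.d) := by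
  simp [ray, smul_def]

theorem smul_ray_inv (x : Nil) (t : ℝ) : x • ray x⁻¹ (1 - t) = ray x t := by
  simp only [ray_def, smul_def, inv_a, inv_b, inv_c, inv_d]
  push_cast
  ext <;> simp <;> ring

end Nil

open Classical in
/-- Each antisymmetric function on the half-edges of a graph, with values in the nilpotent group
`Nil`, is the holonomy along the edges of a holonomy on the realization: it is pulled back from the
quotient of a vector space by `Nil` along a map that is straight on the edges. -/
theorem Graph.exists_hol (Γ : Graph) (φ : Γ.H → Nil) (hφ : ∀ h, φ (Γ.inv h) = (φ h)⁻¹) :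
    ∃ ρ : Hol Γ.Real Nil, ∀ (h : Γ.H) (c : C(ℝ, Γ.Real)), (∀ t : I, c t = Γ.pt h t) →
      ρ.val c 0 1 = φ h := by
  have hf := Nil.isQuotientCoveringMap
  set f : Nil.Space → Nil.Manifold := Quotient.mk (MulAction.orbitRel Nil Nil.Space) with hfdef
  let s : Nil.Manifold → Nil.Space := fun x => if x = f 0 then 0 else x.out
  have hs : ∀ x, f (s x) = x := by
    intro x
    by_cases hx : x = f 0
    · simp [s, hx]
    · simp only [s, hx, if_false]
      exact x.out_eq
  let m : C(Γ.Real, Nil.Manifold) := Γ.lift (fun h t => f (Nil.ray (φ h) t))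
    (fun h => hf.isCoveringMap.continuous.comp (by unfold Nil.ray; fun_prop))
    (fun h t => by
      rw [hφ, unitInterval.coe_symm_eq, ← hf.map_smul (φ h) (e := Nil.ray (φ h)⁻¹ _),
        Nil.smul_ray_inv])
    (fun h h' _ => by simp [Nil.ray])
  refine ⟨(Hol.ofCovering hf hs).comap m, fun h c hc => ?_⟩
  let L : C(ℝ, Nil.Space) := ⟨Nil.ray (φ h), by unfold Nil.ray; fun_prop⟩
  let c' : C(ℝ, Nil.Manifold) := ⟨f ∘ L, hf.isCoveringMap.continuous.comp L.continuous⟩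
  rw [Hol.comap_val, Hol.val_congr _ zero_le_one (c' := c'),
    Hol.ofCovering_val hf hs L c' rfl, Hol.frame_eq hf hs (g := 1), Hol.frame_eq hf hs (g := φ h)]
  · group
  · have : f (L 1) = f 0 := by
      change f (Nil.ray (φ h) 1) = f 0
      rw [Nil.ray, one_smul, hf.map_smul]
    rw [this]
    simp [s, L, Nil.ray]
  · simp [s, L, Nil.ray]
  · intro t h0 h1
    exact congrArg m (hc ⟨t, h0, h1⟩)

open scoped NNReal
/-! ### Maps out of the surface of a gluing scheme -/

namespace PolygonScheme

variable (P : PolygonScheme)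

/-- The point with coordinates `(x, y)` on the half-infinite strip over the side `h`. -/
def pt (h : P.side) (x : I) (y : ℝ≥0) : P.Surface := Quot.mk _ ⟨h, (x, y)⟩

theorem pt_strip (h : P.side) (y : ℝ≥0) : P.pt h 1 y = P.pt (P.next h) 0 y :=
  Quot.sound (.strip h y)

theorem pt_side (h : P.side) (x : I) : P.pt h x 0 = P.pt (P.inv h) (σ x) 0 :=
  Quot.sound (.side h x)

theorem continuous_pt (h : P.side) : Continuous fun z : I × ℝ≥0 => P.pt h z.1 z.2 :=
  continuous_quot_mk.comp (@continuous_sigmaMk P.side (fun _ => I × ℝ≥0) _ h)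

theorem exists_pt (p : P.Surface) : ∃ h x y, p = P.pt h x y := by
  obtain ⟨⟨h, x, y⟩, rfl⟩ := Quot.exists_rep p
  exact ⟨h, x, y, rfl⟩

/-- Maps out of the surface. -/
def lift {Y : Type} [TopologicalSpace Y] (f : P.side → I → ℝ≥0 → Y)
    (hc : ∀ h, Continuous fun z : I × ℝ≥0 => f h z.1 z.2)
    (hstrip : ∀ h y, f h 1 y = f (P.next h) 0 y)
    (hside : ∀ h x, f h x 0 = f (P.inv h) (σ x) 0) : C(P.Surface, Y) where
  toFun := Quot.lift (fun z => f z.1 z.2.1 z.2.2) (by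
    rintro _ _ (⟨h, y⟩ | ⟨h, x⟩)
    · exact hstrip h y
    · exact hside h x)
  continuous_toFun := continuous_quot_lift _ (continuous_sigma hc)

/-- The curve along a side. -/
def edge (h : P.side) : C(ℝ, P.Surface) :=
  ⟨fun t => P.pt h (Set.projIcc 0 1 (zero_le_one' ℝ) t) 0,
    (P.continuous_pt h).comp
      ((continuous_projIcc (h := zero_le_one' ℝ)).prodMk continuous_const)⟩

theorem edge_apply (h : P.side) (t : I) : P.edge h t = P.pt h t 0 := by
  simp [edge, Set.projIcc_val]

/-- The height of a point above the sides. -/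
def height : C(P.Surface, ℝ≥0) :=
  P.lift (fun _ _ y => y) (fun _ => by fun_prop) (fun _ _ => rfl) (fun _ _ => rfl)

/-- Lowering a point of the surface towards the sides, as a path in the surface. -/
def lower : C(P.Surface, C(I, P.Surface)) :=
  P.lift (fun h x y => ⟨fun l => P.pt h x (unitInterval.toNNReal l * y),
      (P.continuous_pt h).comp (continuous_const.prodMk
        (unitInterval.toNNReal_continuous.mul continuous_const))⟩)
    (fun h => by
      refine ContinuousMap.continuous_of_continuous_uncurry _ ?_
      exact (P.continuous_pt h).comp
        (f := fun z : (I × ℝ≥0) × I => (z.1.1, unitInterval.toNNReal z.2 * z.1.2))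
        ((continuous_fst.comp continuous_fst).prodMk
          ((unitInterval.toNNReal_continuous.comp continuous_snd).mul
            (continuous_snd.comp continuous_fst))))
    (fun h y => by
      ext l
      exact P.pt_strip h _)
    (fun h x => by
      ext l
      change P.pt h x (_ * 0) = P.pt (P.inv h) (σ x) (_ * 0)
      rw [mul_zero]
      exact P.pt_side h x)

end PolygonScheme

/-! ### The ribbon surface deformation retracts to the graph -/

namespace RibbonStructure

variable {Γ : Graph} (O : RibbonStructure Γ)

/-- The retraction of the ribbon surface to the graph. -/
def retr : C(O.Surface, Γ.Real) :=
  O.scheme.lift (fun h x _ => Γ.pt h x) (fun h => (Γ.continuous_pt h).comp continuous_fst)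
    (fun h _ => by
      refine (Γ.pt_flip h 1).trans ?_
      rw [unitInterval.symm_one]
      exact Γ.pt_zero (O.src_rot (Γ.inv h)).symm)
    (fun h x => Γ.pt_flip h x)

theorem retr_comp_incl : O.retr.comp O.incl = ContinuousMap.id _ :=
  Graph.hom_ext fun _ _ => rfl

theorem lower_zero (p : O.Surface) : O.scheme.lower p 0 = O.incl (O.retr p) := by
  obtain ⟨h, x, y, rfl⟩ := O.scheme.exists_pt p
  change O.scheme.pt h x (unitInterval.toNNReal 0 * y) = O.scheme.pt h x 0
  rw [unitInterval.toNNReal_zero, zero_mul]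

theorem lower_one (p : O.Surface) : O.scheme.lower p 1 = p := by
  obtain ⟨h, x, y, rfl⟩ := O.scheme.exists_pt p
  change O.scheme.pt h x (unitInterval.toNNReal 1 * y) = O.scheme.pt h x y
  rw [unitInterval.toNNReal_one, one_mul]

/-- The inclusion of the graph is a homotopy equivalence. -/
def equiv : ContinuousMap.HomotopyEquiv Γ.Real O.Surface where
  toFun := O.incl
  invFun := O.retr
  left_inv := by rw [retr_comp_incl]
  right_inv := ⟨{
    toFun := fun z => O.scheme.lower z.2 z.1
    continuous_toFun := by fun_prop
    map_zero_left := fun p => O.lower_zero p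
    map_one_left := fun p => O.lower_one p }⟩

end RibbonStructure

namespace Graph

theorem joined_pt (Γ : Graph) (h : Γ.H) (t : I) : Joined (Γ.pt h 0) (Γ.pt h t) :=
  ⟨{ toFun := fun s => Γ.pt h (s * t)
     continuous_toFun := (Γ.continuous_pt h).comp (by fun_prop)
     source' := by rw [zero_mul]
     target' := by rw [one_mul] }⟩

theorem joined_vertexPt (Γ : Graph) (v w : Γ.V) : Joined (Γ.vertexPt v) (Γ.vertexPt w) := by
  induction Γ.connected v w with
  | refl => exact .refl _
  | tail _ h ih =>
    obtain ⟨h, rfl, rfl⟩ := h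
    refine ih.trans ?_
    rw [Γ.vertexPt_src, Γ.vertexPt_src]
    have := Γ.joined_pt h 1
    rwa [Γ.pt_flip h 1, unitInterval.symm_one] at this

theorem joined_vertexPt_src (Γ : Graph) (h : Γ.H) (t : I) :
    Joined (Γ.vertexPt (Γ.src h)) (Γ.pt h t) := by
  rw [Γ.vertexPt_src]
  exact Γ.joined_pt h t

instance (Γ : Graph) : PathConnectedSpace Γ.Real where
  nonempty := ⟨Γ.vertexPt Γ.nonempty.some⟩
  joined := by
    intro p q
    obtain ⟨⟨h, t⟩, rfl⟩ := Quot.exists_rep p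
    obtain ⟨⟨k, u⟩, rfl⟩ := Quot.exists_rep q
    exact ((Γ.joined_vertexPt_src h t).symm.trans (Γ.joined_vertexPt _ _)).trans
      (Γ.joined_vertexPt_src k u)

end Graph

instance {Γ : Graph} (O : RibbonStructure Γ) : PathConnectedSpace O.Surface where
  nonempty := ⟨O.incl (Classical.arbitrary _)⟩
  joined := by
    have key : ∀ p : O.Surface, Joined (O.incl (O.retr p)) p := fun p =>
      ⟨{ toFun := O.scheme.lower p
         source' := O.lower_zero p
         target' := O.lower_one p }⟩
    intro p q
    refine ((key p).symm.trans ?_).trans (key q)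
    exact ⟨(PathConnectedSpace.somePath (O.retr p) (O.retr q)).map O.incl.continuous⟩

theorem RibbonStructure.isPuncturedSurface {Γ : Graph} (O : RibbonStructure Γ) :
    IsPuncturedSurface O.Surface :=
  ⟨inferInstance, O.scheme, ⟨Homeomorph.refl _⟩⟩

/-! ### Transfer of markings along homotopy equivalences -/

namespace Marking

variable {n : ℕ} {X Y : Type} [TopologicalSpace X] [TopologicalSpace Y]

open CategoryTheory in
/-- The isomorphism of fundamental groups induced by a homotopy equivalence. -/
theorem exists_mulEquiv (e : ContinuousMap.HomotopyEquiv X Y) (x : X) :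
    ∃ E : FundamentalGroup X x ≃* FundamentalGroup Y (e.toFun x),
      ∀ a, E a = FundamentalGroup.map e.toFun x a := by
  let K := FundamentalGroupoidFunctor.equivOfHomotopyEquiv (X := TopCat.of X) (Y := TopCat.of Y) e
  exact ⟨K.fullyFaithfulFunctor.mulEquivEnd ⟨x⟩, fun a => rfl⟩

theorem transport_refl {x : X} (a : FundamentalGroup X x) : transport (Path.refl x) a = a := by
  have : arrow (Path.refl x) = CategoryTheory.CategoryStruct.id (FundamentalGroupoid.mk x) := rfl
  rw [transport_eq, this]
  simp [CategoryTheory.Groupoid.inv_eq_inv]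

theorem exists_carries_right (e : ContinuousMap.HomotopyEquiv X Y) (s : Marking n X) :
    ∃ t : Marking n Y, Carries e.toFun s t := by
  obtain ⟨E, hE⟩ := exists_mulEquiv e s.base
  refine ⟨⟨e.toFun s.base, s.iso.trans E⟩, Path.refl _, fun w => ?_⟩
  rw [transport_refl]
  exact hE _

theorem exists_carries_left [Nonempty X] [PathConnectedSpace Y]
    (e : ContinuousMap.HomotopyEquiv X Y) (t : Marking n Y) :
    ∃ s : Marking n X, Carries e.toFun s t := by
  obtain ⟨x⟩ := ‹Nonempty X›
  obtain ⟨E, hE⟩ := exists_mulEquiv e x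
  let p := PathConnectedSpace.somePath (e.toFun x) t.base
  refine ⟨⟨x, (t.iso.trans (transport p).symm).trans E.symm⟩, p, fun w => ?_⟩
  change t.iso w = transport p (FundamentalGroup.map e.toFun x (E.symm ((transport p).symm _)))
  rw [← hE, MulEquiv.apply_symm_apply, MulEquiv.apply_symm_apply]
  rfl

end Marking

/-! ### Transfer of ribbon structures along isomorphisms of graphs -/

/-- The pullback of a ribbon structure along an isomorphism of graphs. -/
def RibbonStructure.pullback {Γ Γ' : Graph} (e : Graph.Iso Γ Γ') (O : RibbonStructure Γ') :
    RibbonStructure Γ where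
  rot := Equiv.permCongrHom e.onH.symm O.rot
  sameCycle_iff h h' := by
    rw [← e.onV.apply_eq_iff_eq, ← e.src_onH, ← e.src_onH, ← O.sameCycle_iff]
    refine exists_congr fun k => ?_
    rw [← map_zpow]
    exact e.onH.symm_apply_eq

/-- The homeomorphism of ribbon surfaces induced by an isomorphism of ribbon graphs. -/
def RibbonStructure.pullbackHomeo {Γ Γ' : Graph} (e : Graph.Iso Γ Γ') (O : RibbonStructure Γ') :
    (O.pullback e).Surface ≃ₜ O.Surface where
  toFun := (O.pullback e).scheme.lift (fun h x y => O.scheme.pt (e.onH h) x y)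
    (fun h => O.scheme.continuous_pt _)
    (fun (h : Γ.H) y => by
      refine (O.scheme.pt_strip _ _).trans (congrArg (fun k => O.scheme.pt k 0 y) ?_)
      change O.rot (Γ'.inv (e.onH h)) = e.onH (e.onH.symm (O.rot (e.onH (Γ.inv h))))
      exact (congrArg O.rot (e.inv_onH h)).trans (e.onH.apply_symm_apply _).symm)
    (fun (h : Γ.H) x => by
      exact (O.scheme.pt_side _ _).trans (congrArg (fun k => O.scheme.pt k (σ x) 0) (e.inv_onH h)))
  invFun := O.scheme.lift (fun h x y => (O.pullback e).scheme.pt (e.onH.symm h) x y)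
    (fun h => (O.pullback e).scheme.continuous_pt _)
    (fun (h : Γ'.H) y => by
      refine ((O.pullback e).scheme.pt_strip _ _).trans
        (congrArg (fun k => (O.pullback e).scheme.pt k 0 y) ?_)
      change e.onH.symm (O.rot (e.onH (Γ.inv (e.onH.symm h)))) = e.onH.symm (O.rot (Γ'.inv h))
      exact congrArg e.onH.symm (congrArg O.rot
        ((e.inv_onH _).symm.trans (congrArg Γ'.inv (e.onH.apply_symm_apply h)))))
    (fun (h : Γ'.H) x => by
      refine ((O.pullback e).scheme.pt_side _ _).trans
        (congrArg (fun k => (O.pullback e).scheme.pt k (σ x) 0) ?_)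
      change Γ.inv (e.onH.symm h) = e.onH.symm (Γ'.inv h)
      exact e.onH.eq_symm_apply.2
        ((e.inv_onH _).symm.trans (congrArg Γ'.inv (e.onH.apply_symm_apply h))))
  left_inv p := by
    obtain ⟨h, x, y, rfl⟩ := (O.pullback e).scheme.exists_pt p
    exact congrArg (fun k => (O.pullback e).scheme.pt k x y) (e.onH.symm_apply_apply h)
  right_inv p := by
    obtain ⟨h, x, y, rfl⟩ := O.scheme.exists_pt p
    exact congrArg (fun k => O.scheme.pt k x y) (e.onH.apply_symm_apply h)
  continuous_toFun := ContinuousMap.continuous _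
  continuous_invFun := ContinuousMap.continuous _

theorem RibbonStructure.pullbackHomeo_comp_incl {Γ Γ' : Graph} (e : Graph.Iso Γ Γ')
    (O : RibbonStructure Γ') :
    ((O.pullbackHomeo e : C((O.pullback e).Surface, O.Surface))).comp (O.pullback e).incl =
      O.incl.comp e.real :=
  Graph.hom_ext fun _ _ => rfl

/-- Whether a marked graph can be drawn in a surface is decided on any representative. -/
theorem MarkedGraph.canBeDrawnIn_mk_iff {n : ℕ} (A : PreMarkedGraph n) (S : MarkedSurface n) :
    (MarkedGraph.mk A).CanBeDrawnIn S ↔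
      ∃ (O : RibbonStructure A.graph) (h : O.Surface ≃ₜ S.carrier),
        Marking.Carries ((h : C(O.Surface, S.carrier)).comp O.incl) A.marking S.marking := by
  constructor
  · rintro ⟨B, hB, O, h, hh⟩
    obtain ⟨e, he⟩ := Quotient.exact hB
    refine ⟨O.pullback e, (O.pullbackHomeo e).trans h, ?_⟩
    have := he.comp hh
    rwa [ContinuousMap.comp_assoc, ← O.pullbackHomeo_comp_incl e] at this
  · rintro ⟨O, h, hh⟩
    exact ⟨A, rfl, O, h, hh⟩

/-! ### Bounding the size of a marked graph -/

namespace Graph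

/-- The path along a directed edge. -/
def edgePath (Γ : Graph) (h : Γ.H) :
    Path (Γ.vertexPt (Γ.src h)) (Γ.vertexPt (Γ.src (Γ.inv h))) where
  toFun := Γ.pt h
  continuous_toFun := Γ.continuous_pt h
  source' := (Γ.vertexPt_src h).symm
  target' := by rw [Γ.vertexPt_src, Γ.pt_flip h 1, unitInterval.symm_one]

theorem three_mul_card_le (Γ : Graph) : 3 * Nat.card Γ.V ≤ Nat.card Γ.H := by
  have := Γ.finV
  have := Γ.finH
  have := Fintype.ofFinite Γ.V
  rw [← Nat.card_congr (Equiv.sigmaFiberEquiv Γ.src), Nat.card_sigma, Nat.card_eq_fintype_card,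
    mul_comm, ← smul_eq_mul, ← Finset.card_univ]
  exact Finset.card_nsmul_le_sum _ _ _ fun v _ => Γ.valence v

/-- The set `P` contains one of the two directions of each edge. -/
theorem exists_orientation (Γ : Graph) : ∃ P : Set Γ.H, (∀ h, h ∈ P ↔ Γ.inv h ∉ P) ∧
    Nat.card Γ.H = 2 * Nat.card P := by
  have := Γ.finH
  obtain ⟨k, ⟨e⟩⟩ := Finite.exists_equiv_fin Γ.H
  have hP : ∀ h, h ∈ {h | e h < e (Γ.inv h)} ↔ Γ.inv h ∉ {h | e h < e (Γ.inv h)} := by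
    intro h
    have : e h ≠ e (Γ.inv h) := fun h' => Γ.inv_ne h (e.injective h').symm
    simp only [Set.mem_ofPred_eq, Γ.inv_inv, not_lt]
    exact ⟨le_of_lt, fun h' => lt_of_le_of_ne h' this⟩
  refine ⟨_, hP, ?_⟩
  set P : Set Γ.H := {h | e h < e (Γ.inv h)}
  have h1 : Nat.card (Pᶜ : Set Γ.H) = Nat.card P :=
    Nat.card_congr
      { toFun := fun h => ⟨Γ.inv h.1, by
          have := (hP h.1).not.1 h.2
          exact not_not.1 this⟩
        invFun := fun h => ⟨Γ.inv h.1, (hP h.1).1 h.2⟩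
        left_inv := fun h => Subtype.ext (Γ.inv_inv _)
        right_inv := fun h => Subtype.ext (Γ.inv_inv _) }
  have h2 := Nat.card_congr (Equiv.Set.sumCompl P)
  rw [Nat.card_sum, h1] at h2
  rw [← h2, two_mul]

end Graph

namespace PreMarkedGraph

variable {n : ℕ}

open Classical in
/-- The number of edges of a marked graph is at most the rank plus the number of vertices: a
function with values in `ℤ / 2` on the edges is determined by its values on generators of the
fundamental group and on paths from the base point to the vertices. -/
theorem card_edges_le (A : PreMarkedGraph n) (P : Set A.graph.H)
    (hP : ∀ h, h ∈ P ↔ A.graph.inv h ∉ P) : Nat.card P ≤ n + Nat.card A.graph.V := by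
  have := A.graph.finV
  have := A.graph.finH
  -- Functions on the edges in `P` are realized by holonomies with values in `ℤ / 2`.
  let θ : Nil →* Multiplicative (ZMod 2) :=
    (AddMonoidHom.toMultiplicative (Int.castAddHom (ZMod 2))).comp Nil.dHom
  let φ : (P → Bool) → A.graph.H → Nil := fun ε h =>
    if hh : h ∈ P then ⟨0, 0, 0, (ε ⟨h, hh⟩).toNat⟩
    else ⟨0, 0, 0, -(ε ⟨A.graph.inv h, not_not.1 ((hP h).not.1 hh)⟩).toNat⟩
  have hφ : ∀ ε h, φ ε (A.graph.inv h) = (φ ε h)⁻¹ := by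
    intro ε h
    by_cases hh : h ∈ P
    · have h' := (hP h).1 hh
      simp only [φ, hh, h', dif_pos, dif_neg, not_false_iff]
      ext <;> simp [Graph.inv_inv]
    · have h' : A.graph.inv h ∈ P := not_not.1 ((hP h).not.1 hh)
      simp only [φ, hh, h', dif_pos, dif_neg, not_false_iff]
      ext <;> simp
  choose ρ hρ using fun ε => A.graph.exists_hol (φ ε) (hφ ε)
  let μ : (P → Bool) → Hol A.graph.Real (Multiplicative (ZMod 2)) := fun ε => (ρ ε).map θ
  have hedge : ∀ ε (h : P), (μ ε).path (A.graph.edgePath h) =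
      Multiplicative.ofAdd (((ε h).toNat : ℕ) : ZMod 2) := by
    intro ε h
    change θ ((ρ ε).val (Hol.curve (A.graph.edgePath h)) 0 1) = _
    have hc : ∀ t : I, Hol.curve (A.graph.edgePath h) t = A.graph.pt h t := by
      intro t
      change (A.graph.edgePath h).extend t = _
      rw [Path.extend_apply _ t.2]
      rfl
    rw [hρ ε h _ hc]
    simp [θ, φ, Nil.dHom]
  let p : ∀ v, Path A.marking.base (A.graph.vertexPt v) := fun v => PathConnectedSpace.somePath _ _
  let π : (P → Bool) → (F n →* Multiplicative (ZMod 2)) := fun ε =>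
    { toFun := fun w => (μ ε).pi (A.marking.iso w)
      map_one' := by
        rw [map_one]
        exact (μ ε).path_refl _
      map_mul' := fun x y => by rw [map_mul, Hol.pi_mul, mul_comm] }
  let J : (P → Bool) → (Fin n → Multiplicative (ZMod 2)) × (A.graph.V → Multiplicative (ZMod 2)) :=
    fun ε => (fun i => π ε (FreeGroup.of i), fun v => (μ ε).path (p v))
  have hJ : Function.Injective J := by
    intro ε ε' h
    have h1 : π ε = π ε' := FreeGroup.ext_hom _ _ fun i => congrFun (congrArg Prod.fst h) i
    have h2 : ∀ v, (μ ε).path (p v) = (μ ε').path (p v) := congrFun (congrArg Prod.snd h)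
    have h3 : ∀ q : Path A.marking.base A.marking.base, (μ ε).path q = (μ ε').path q := by
      intro q
      have := DFunLike.congr_fun h1 (A.marking.iso.symm (FundamentalGroup.fromPath (.mk q)))
      change (μ ε).pi (A.marking.iso _) = (μ ε').pi (A.marking.iso _) at this
      rwa [MulEquiv.apply_symm_apply] at this
    funext h
    -- Close up the edge to a loop at the base point.
    have h4 := h3 ((p (A.graph.src h)).trans
      ((A.graph.edgePath h).trans (p (A.graph.src (A.graph.inv h))).symm))
    simp only [Hol.path_trans, Hol.path_symm, h2, hedge] at h4
    have h5 := mul_right_cancel (mul_left_cancel h4)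
    have h6 : (((ε h).toNat : ℕ) : ZMod 2) = ((ε' h).toNat : ℕ) := h5
    revert h6
    cases ε h <;> cases ε' h <;> decide
  have := Nat.card_le_card_of_injective J hJ
  simp only [Nat.card_prod, Nat.card_fun, Nat.card_eq_fintype_card (α := Bool), Fintype.card_bool,
    Nat.card_eq_fintype_card (α := Multiplicative (ZMod 2)), Fintype.card_multiplicative,
    ZMod.card, ← pow_add, Nat.card_eq_fintype_card (α := Fin n), Fintype.card_fin] at this
  exact (Nat.pow_le_pow_iff_right (by norm_num)).1 this

/-- As all valences are at least three, `3 * V ≤ 2 * E`, while `E ≤ n + V`. -/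
theorem card_le (A : PreMarkedGraph n) : Nat.card A.graph.H ≤ 6 * n := by
  obtain ⟨P, hP, h1⟩ := A.graph.exists_orientation
  have h2 := A.card_edges_le P hP
  have h3 := A.graph.three_mul_card_le
  omega

end PreMarkedGraph

/-! ### Finitely many marked graphs up to the action -/

/-- The isomorphism type of a graph with at most `N` half-edges and vertices is determined by a
point of this finite type. -/
abbrev GraphCode (N : ℕ) : Type :=
  Σ a : Fin (N + 1), Σ b : Fin (N + 1), (Fin a → Fin b) × (Fin a → Fin a)

theorem Graph.exists_code (Γ : Graph) {N : ℕ} (h : Nat.card Γ.H ≤ N) :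
    ∃ (c : GraphCode N) (eH : Γ.H ≃ Fin c.1) (eV : Γ.V ≃ Fin c.2.1),
      (∀ h, c.2.2.1 (eH h) = eV (Γ.src h)) ∧ ∀ h, c.2.2.2 (eH h) = eH (Γ.inv h) := by
  have := Γ.finV
  have := Γ.finH
  have hV : Nat.card Γ.V ≤ N := by have := Γ.three_mul_card_le; omega
  let eH := Finite.equivFin Γ.H
  let eV := Finite.equivFin Γ.V
  exact ⟨⟨⟨_, Nat.lt_succ_of_le h⟩, ⟨_, Nat.lt_succ_of_le hV⟩,
    fun i => eV (Γ.src (eH.symm i)), fun i => eH (Γ.inv (eH.symm i))⟩, eH, eV,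
    fun h => by simp, fun h => by simp⟩

theorem Graph.nonempty_iso_of_code {Γ Γ' : Graph} {N : ℕ} (c : GraphCode N)
    (h : ∃ (eH : Γ.H ≃ Fin c.1) (eV : Γ.V ≃ Fin c.2.1),
      (∀ h, c.2.2.1 (eH h) = eV (Γ.src h)) ∧ ∀ h, c.2.2.2 (eH h) = eH (Γ.inv h))
    (h' : ∃ (eH : Γ'.H ≃ Fin c.1) (eV : Γ'.V ≃ Fin c.2.1),
      (∀ h, c.2.2.1 (eH h) = eV (Γ'.src h)) ∧ ∀ h, c.2.2.2 (eH h) = eH (Γ'.inv h)) :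
    Nonempty (Graph.Iso Γ Γ') := by
  obtain ⟨eH, eV, h1, h2⟩ := h
  obtain ⟨eH', eV', h1', h2'⟩ := h'
  exact ⟨⟨eV.trans eV'.symm, eH.trans eH'.symm,
    fun h => by
      apply eV'.injective
      rw [← h1']
      simp [h1],
    fun h => by
      apply eH'.injective
      rw [← h2']
      simp [h2]⟩⟩

/-- Any two markings of a path connected space differ by an automorphism of the free group. -/
theorem Marking.exists_carries_precomp {n : ℕ} {X : Type} [TopologicalSpace X]
    [PathConnectedSpace X] (s t : Marking n X) :
    ∃ φ : MulAut (F n), Marking.Carries (ContinuousMap.id X) (s.precomp φ) t := by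
  let p := PathConnectedSpace.somePath s.base t.base
  refine ⟨(t.iso.trans (transport p).symm).trans s.iso.symm, p, fun w => ?_⟩
  refine Eq.trans ?_ (congrArg (transport p) (map_id s.base _)).symm
  change t.iso w = transport p (s.iso (s.iso.symm ((transport p).symm (t.iso w))))
  rw [MulEquiv.apply_symm_apply, MulEquiv.apply_symm_apply]

/-- An isomorphism of graphs as a homotopy equivalence of realizations. -/
def Graph.Iso.equiv {Γ Γ' : Graph} (e : Graph.Iso Γ Γ') :
    ContinuousMap.HomotopyEquiv Γ.Real Γ'.Real where
  toFun := e.real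
  invFun := e.symm.real
  left_inv := by rw [e.real_symm_comp]
  right_inv := by
    have := e.symm.real_symm_comp
    rw [show e.symm.symm = e from rfl] at this
    rw [this]

/-- The orbit of a marked graph only depends on the underlying graph. -/
theorem MarkedGraph.exists_smul_of_iso {n : ℕ} {A B : PreMarkedGraph n}
    (e : Graph.Iso A.graph B.graph) :
    ∃ g : (Out n)ᵐᵒᵖ, MarkedGraph.mk B = g • MarkedGraph.mk A := by
  obtain ⟨s, hs⟩ := Marking.exists_carries_left e.equiv B.marking
  obtain ⟨φ, hφ⟩ := A.marking.exists_carries_precomp s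
  refine ⟨MulOpposite.op (φ : Out n), ?_⟩
  rw [MarkedGraph.op_smul_mk]
  exact (Quotient.sound (s := PreMarkedGraph.setoid n) (a := A.precomp φ) (b := B)
    ⟨e, hφ.comp hs⟩).symm

/-- There are finitely many marked graphs up to the action of `Out(F_n)`. -/
theorem MarkedGraph.exists_finite_reps (n : ℕ) : ∃ M : Set (MarkedGraph n), M.Finite ∧
    ∀ m : MarkedGraph n, ∃ m₀ ∈ M, ∃ g : (Out n)ᵐᵒᵖ, m = g • m₀ := by
  let Q : GraphCode (6 * n) → PreMarkedGraph n → Prop := fun c A =>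
    ∃ (eH : A.graph.H ≃ Fin c.1) (eV : A.graph.V ≃ Fin c.2.1),
      (∀ h, c.2.2.1 (eH h) = eV (A.graph.src h)) ∧ ∀ h, c.2.2.2 (eH h) = eH (A.graph.inv h)
  let r : {c // ∃ A, Q c A} → MarkedGraph n := fun c => .mk c.2.choose
  refine ⟨Set.range r, Set.finite_range r, fun m => ?_⟩
  induction m using Quotient.inductionOn with
  | h A =>
    obtain ⟨c, hc⟩ := A.graph.exists_code A.card_le
    have hQ : ∃ A, Q c A := ⟨A, hc⟩
    obtain ⟨e⟩ := Graph.nonempty_iso_of_code c hQ.choose_spec hc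
    exact ⟨_, ⟨⟨c, hQ⟩, rfl⟩, MarkedGraph.exists_smul_of_iso e⟩

/-! ### Finitely many ribbon graph complexes through a marked graph -/

/-- If `f ∘ i` carries `s` to `u` and `i` carries `s` to `t`, then `f` carries `t` to `u`. -/
theorem Marking.Carries.of_comp {n : ℕ} {X Y Z : Type} [TopologicalSpace X] [TopologicalSpace Y]
    [TopologicalSpace Z] {i : C(X, Y)} {f : C(Y, Z)} {s : Marking n X} {t : Marking n Y}
    {u : Marking n Z} (h : Marking.Carries (f.comp i) s u) (h' : Marking.Carries i s t) :
    Marking.Carries f t u := by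
  obtain ⟨p, hp⟩ := h
  obtain ⟨q, hq⟩ := h'
  refine ⟨(q.map f.continuous).symm.trans p, fun w => ?_⟩
  rw [hq, map_transport, ← transport_trans, transport_symm]
  exact (hp w).trans (congrArg (transport p) (map_comp i f s.base (s.iso w)))

/-- If a marked graph can be drawn in two marked surfaces with the same ribbon structure, then these
are homeomorphic by a homeomorphism that carries one marking to the other. -/
theorem ribbonComplex_eq_of_drawn {n : ℕ} {A : PreMarkedGraph n} {O : RibbonStructure A.graph}
    {S S' : MarkedSurface n} {h : O.Surface ≃ₜ S.carrier} {h' : O.Surface ≃ₜ S'.carrier}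
    (hh : Marking.Carries ((h : C(O.Surface, S.carrier)).comp O.incl) A.marking S.marking)
    (hh' : Marking.Carries ((h' : C(O.Surface, S'.carrier)).comp O.incl) A.marking S'.marking) :
    ribbonComplex S = ribbonComplex S' := by
  have key : ∀ {S S' : MarkedSurface n} {h : O.Surface ≃ₜ S.carrier} {h' : O.Surface ≃ₜ S'.carrier},
      Marking.Carries ((h : C(O.Surface, S.carrier)).comp O.incl) A.marking S.marking →
      Marking.Carries ((h' : C(O.Surface, S'.carrier)).comp O.incl) A.marking S'.marking →
      ∀ m : MarkedGraph n, m.CanBeDrawnIn S → m.CanBeDrawnIn S' := by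
    intro S S' h h' hh hh' m hm
    obtain ⟨B, rfl, O', k, hk⟩ := hm
    obtain ⟨t, ht⟩ := Marking.exists_carries_right O.equiv A.marking
    have h1 : Marking.Carries (h.symm : C(S.carrier, O.Surface)) S.marking t :=
      Marking.Carries.symm (f := (h : C(O.Surface, S.carrier)))
        (g := (h.symm : C(S.carrier, O.Surface)))
        (ContinuousMap.ext fun x => h.symm_apply_apply x) (hh.of_comp ht)
    exact ⟨B, rfl, O', k.trans (h.symm.trans h'), (hk.comp h1).comp (hh'.of_comp ht)⟩
  apply PreAbstractSimplicialComplex.ext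
  ext s
  exact ⟨fun hs => ⟨hs.1, fun m hm => key hh hh' m (hs.2 m hm)⟩,
    fun hs => ⟨hs.1, fun m hm => key hh' hh m (hs.2 m hm)⟩⟩

instance (Γ : Graph) : Finite (RibbonStructure Γ) := by
  have := Γ.finH
  refine Finite.of_injective (β := Equiv.Perm Γ.H) (fun O => O.rot) fun O O' h => ?_
  cases O
  cases O'
  congr

/-- The ribbon graph complexes that contain a given marked graph. -/
def MarkedGraph.complexes {n : ℕ} (m : MarkedGraph n) : Set (GraphComplex n) :=
  {R | ∃ S : MarkedSurface n, R = ribbonComplex S ∧ m.CanBeDrawnIn S}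

/-- A ribbon graph complex through a marked graph is determined by the ribbon structure with which
the graph is drawn in the surface. -/
theorem MarkedGraph.finite_complexes {n : ℕ} (m : MarkedGraph n) : m.complexes.Finite := by
  induction m using Quotient.inductionOn with
  | h A =>
    change (MarkedGraph.mk A).complexes.Finite
    have hR : ∀ R : (MarkedGraph.mk A).complexes, ∃ (S : MarkedSurface n)
        (O : RibbonStructure A.graph) (h : O.Surface ≃ₜ S.carrier), R.1 = ribbonComplex S ∧
        Marking.Carries ((h : C(O.Surface, S.carrier)).comp O.incl) A.marking S.marking := by
      rintro ⟨R, S, hR, hS⟩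
      obtain ⟨O, h, hh⟩ := (MarkedGraph.canBeDrawnIn_mk_iff A S).1 hS
      exact ⟨S, O, h, hR, hh⟩
    choose S O h hS hh using hR
    refine Set.finite_coe_iff.1 (Finite.of_injective O fun R R' e => Subtype.ext ?_)
    rw [hS, hS]
    have key : ∀ (O₁ O₂ : RibbonStructure A.graph) (_ : O₁ = O₂) (S₁ S₂ : MarkedSurface n)
        (h₁ : O₁.Surface ≃ₜ S₁.carrier) (h₂ : O₂.Surface ≃ₜ S₂.carrier),
        Marking.Carries ((h₁ : C(O₁.Surface, S₁.carrier)).comp O₁.incl) A.marking S₁.marking →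
        Marking.Carries ((h₂ : C(O₂.Surface, S₂.carrier)).comp O₂.incl) A.marking S₂.marking →
        ribbonComplex S₁ = ribbonComplex S₂ := by
      rintro O₁ _ rfl S₁ S₂ h₁ h₂ hh₁ hh₂
      exact ribbonComplex_eq_of_drawn hh₁ hh₂
    exact key _ _ e _ _ _ _ (hh R) (hh R')

theorem exists_subset_complexes {n : ℕ} {τ : Finset (GraphComplex n)} (h : τ ∈ nerve n) :
    ∃ m : MarkedGraph n, ∀ R ∈ τ, R ∈ m.complexes := by
  obtain ⟨⟨R₀, h₀⟩, hS, s, hs⟩ := h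
  obtain ⟨S₀, rfl⟩ := hS R₀ h₀
  obtain ⟨m, hm⟩ := (hs _ h₀).1.1
  refine ⟨m, fun R hR => ?_⟩
  obtain ⟨S, rfl⟩ := hS R hR
  exact ⟨S, rfl, (hs _ hR).2 m hm⟩

theorem MarkedGraph.smul_mem_complexes {n : ℕ} {m : MarkedGraph n} {R : GraphComplex n}
    (h : R ∈ m.complexes) (g : (Out n)ᵐᵒᵖ) : g • R ∈ (g • m).complexes := by
  obtain ⟨S, rfl, hS⟩ := h
  obtain ⟨φ, hφ⟩ := QuotientGroup.mk_surjective g.unop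
  obtain rfl : g = MulOpposite.op (φ : Out n) := by rw [hφ, MulOpposite.op_unop]
  exact ⟨S.precomp φ, smul_ribbonComplex φ S, CanBeDrawnIn.precomp hS φ⟩

/-- Finitely many orbits of simplices of the nerve: up to the action, all members of a simplex
contain a common marked graph from a finite set of representatives. -/
theorem finite_orbits_of_subset_nerve {n : ℕ}
    (p : SubMulAction (Out n)ᵐᵒᵖ (Finset (GraphComplex n))) (hp : ∀ τ ∈ p, τ ∈ nerve n) :
    Finite (MulAction.orbitRel.Quotient (Out n)ᵐᵒᵖ p) := by
  obtain ⟨M, hM, hrep⟩ := MarkedGraph.exists_finite_reps n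
  let T : Set (Finset (GraphComplex n)) := ⋃ m ∈ M, {τ | (τ : Set (GraphComplex n)) ⊆ m.complexes}
  have hT : T.Finite := hM.biUnion fun m _ => by
    refine (m.finite_complexes.finite_subsets.preimage
      (Finset.coe_injective.injOn (s := _))).subset ?_
    intro τ hτ
    exact hτ
  have : Finite T := hT
  have hex : ∀ x : p, ∃ g : (Out n)ᵐᵒᵖ, (g • x).1 ∈ T := by
    intro x
    obtain ⟨m, hm⟩ := exists_subset_complexes (hp x.1 x.2)
    obtain ⟨m₀, hm₀, g, rfl⟩ := hrep m
    refine ⟨g⁻¹, Set.mem_biUnion hm₀ fun R hR => ?_⟩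
    obtain ⟨R', hR', rfl⟩ := Finset.mem_smul_finset.1 (Finset.mem_coe.1 hR)
    have := MarkedGraph.smul_mem_complexes (hm R' hR') g⁻¹
    rwa [inv_smul_smul] at this
  have hq : ∀ q : MulAction.orbitRel.Quotient (Out n)ᵐᵒᵖ p, ∃ x : p, Quotient.mk'' x = q ∧
      x.1 ∈ T := by
    intro q
    induction q using Quotient.inductionOn' with
    | h x =>
      obtain ⟨g, hg⟩ := hex x
      exact ⟨g • x, Quotient.sound' (MulAction.mem_orbit x g), hg⟩
  choose r hr hrT using hq
  refine Finite.of_injective (fun q => (⟨(r q).1, hrT q⟩ : T)) fun q q' h => ?_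
  have h' : r q = r q' := Subtype.ext (congrArg (fun x : T => x.1) h)
  rw [← hr q, ← hr q', h']

/-! ### Strip systems -/

/-- The part `[0, 1] × [0, ∞)` of the plane. -/
def halfStrip : Set (ℝ × ℝ) := Set.Icc 0 1 ×ˢ Set.Ici 0

/-- Real parametrizations of strips in a space `Y` which match along their boundaries as prescribed
by a gluing scheme with sides paired by `inv` and successor `ν`. Only the restrictions to the half
strip matter. -/
structure IsStripSystem {H Y : Type} [TopologicalSpace Y] (inv : H → H) (ν : Equiv.Perm H)
    (q : H → ℝ → ℝ → Y) : Prop where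
  cont : ∀ h, ContinuousOn (fun z : ℝ × ℝ => q h z.1 z.2) halfStrip
  strip : ∀ h y, 0 ≤ y → q h 1 y = q (ν h) 0 y
  edge : ∀ h x, 0 ≤ x → x ≤ 1 → q h x 0 = q (inv h) (1 - x) 0

theorem IsStripSystem.flip {H Y : Type} [TopologicalSpace Y] {inv : H → H} {ν : Equiv.Perm H}
    {q : H → ℝ → ℝ → Y} (hq : IsStripSystem inv ν q) :
    IsStripSystem inv ν⁻¹ fun h x y => q h (1 - x) y where
  cont h := (hq.cont h).comp (f := fun z : ℝ × ℝ => (1 - z.1, z.2)) (by fun_prop)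
    fun z hz => ⟨⟨sub_nonneg.2 hz.1.2, sub_le_self 1 hz.1.1⟩, hz.2⟩
  strip h y hy := by
    have := hq.strip (ν⁻¹ h) y hy
    rw [← Equiv.Perm.mul_apply, mul_inv_cancel, Equiv.Perm.one_apply] at this
    simpa using this.symm
  edge h x h0 h1 := by
    have := hq.edge h (1 - x) (sub_nonneg.2 h1) (sub_le_self 1 h0)
    simpa using this

namespace PolygonScheme

variable (P : PolygonScheme)

/-- The point with real coordinates `(x, y)` on the strip over `h`, clamped to the strip. -/
def rpt (h : P.side) (x y : ℝ) : P.Surface := P.pt h (Set.projIcc 0 1 zero_le_one x) y.toNNReal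

theorem continuous_rpt (h : P.side) : Continuous fun z : ℝ × ℝ => P.rpt h z.1 z.2 :=
  (P.continuous_pt h).comp
    (f := fun z : ℝ × ℝ => (Set.projIcc 0 1 zero_le_one z.1, z.2.toNNReal))
    ((continuous_projIcc.comp continuous_fst).prodMk
      (continuous_real_toNNReal.comp continuous_snd))

theorem rpt_coe (h : P.side) (x : I) (y : ℝ≥0) : P.rpt h x y = P.pt h x y := by
  simp [rpt, Set.projIcc_val]

theorem exists_rpt (p : P.Surface) : ∃ h x y, 0 ≤ x ∧ x ≤ 1 ∧ 0 ≤ y ∧ p = P.rpt h x y := by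
  obtain ⟨h, x, y, rfl⟩ := P.exists_pt p
  exact ⟨h, x, y, x.2.1, x.2.2, y.2, (P.rpt_coe h x y).symm⟩

theorem rpt_strip (h : P.side) (y : ℝ) : P.rpt h 1 y = P.rpt (P.next h) 0 y := by
  have := P.pt_strip h y.toNNReal
  simp only [rpt, Set.projIcc_right, Set.projIcc_left]
  exact this

theorem rpt_side (h : P.side) {x : ℝ} (h0 : 0 ≤ x) (h1 : x ≤ 1) :
    P.rpt h x 0 = P.rpt (P.inv h) (1 - x) 0 := by
  have := P.pt_side h ⟨x, h0, h1⟩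
  have h2 := P.rpt_coe h ⟨x, h0, h1⟩ 0
  have h3 := P.rpt_coe (P.inv h) (σ ⟨x, h0, h1⟩) 0
  rw [← h2, ← h3] at this
  exact this

theorem isStripSystem_rpt : IsStripSystem P.inv P.next P.rpt where
  cont h := (P.continuous_rpt h).continuousOn
  strip h y _ := P.rpt_strip h y
  edge h _ := P.rpt_side h

/-- The map out of the surface given by a strip system. -/
def desc {Y : Type} [TopologicalSpace Y] {q : P.side → ℝ → ℝ → Y}
    (hq : IsStripSystem P.inv P.next q) : C(P.Surface, Y) :=
  P.lift (fun h x y => q h x y)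
    (fun h => (hq.cont h).comp_continuous (f := fun z : I × ℝ≥0 => ((z.1 : ℝ), (z.2 : ℝ)))
      (by fun_prop) fun z => ⟨z.1.2, z.2.2⟩)
    (fun h y => hq.strip h y y.2)
    (fun h x => hq.edge h x x.2.1 x.2.2)

theorem desc_rpt {Y : Type} [TopologicalSpace Y] {q : P.side → ℝ → ℝ → Y}
    (hq : IsStripSystem P.inv P.next q) (h : P.side) {x y : ℝ} (h0 : 0 ≤ x) (h1 : x ≤ 1)
    (hy : 0 ≤ y) : P.desc hq (P.rpt h x y) = q h x y := by
  rw [rpt, Set.projIcc_of_mem _ ⟨h0, h1⟩]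
  change q h x (y.toNNReal : ℝ) = _
  rw [Real.coe_toNNReal y hy]

/-- The holonomy along a side. -/
def hol {G : Type*} [Group G] (ρ : Hol P.Surface G) (h : P.side) : G := ρ.val (P.edge h) 0 1

theorem edge_eq_rpt (h : P.side) (t : ℝ) : P.edge h t = P.rpt h t 0 := by
  simp [edge, rpt]

theorem hol_inv {G : Type*} [Group G] (ρ : Hol P.Surface G) (h : P.side) :
    P.hol ρ (P.inv h) = (P.hol ρ h)⁻¹ := by
  have h1 := ρ.val_comp (P.edge h) ⟨fun t => 1 - t, by fun_prop⟩ 0 1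
  simp only [ContinuousMap.coe_mk, sub_zero, sub_self] at h1
  rw [hol, hol, ρ.val_inv, ← h1]
  refine ρ.val_congr zero_le_one fun t h0 h1 => ?_
  change P.edge (P.inv h) t = P.edge h (1 - t)
  rw [edge_eq_rpt, edge_eq_rpt, P.rpt_side h (by linarith) (by linarith), sub_sub_cancel]

/-- The scheme with the same sides, glued in the same way, but with other polygons. -/
abbrev withNext (ν : Equiv.Perm P.side) : PolygonScheme where
  side := P.side
  finSide := P.finSide
  next := ν
  inv := P.inv
  inv_inv := P.inv_inv
  inv_ne := P.inv_ne

end PolygonScheme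

/-! ### The slide homeomorphism -/

/-- The width of the region `slideDomain` along the line `x + y = Y`. -/
def slideWidth (Y : ℝ) : ℝ := max 1 (min 2 Y)

theorem continuous_slideWidth : Continuous slideWidth := by
  unfold slideWidth
  fun_prop

theorem one_le_slideWidth (Y : ℝ) : 1 ≤ slideWidth Y := le_max_left _ _

theorem slideWidth_pos (Y : ℝ) : 0 < slideWidth Y := zero_lt_one.trans_le (one_le_slideWidth Y)

/-- The union of `[0, 1] × ℝ` and `[1, 2] × [0, ∞)`. -/
def slideDomain : Set (ℝ × ℝ) := {z | 0 ≤ z.1 ∧ z.1 ≤ 2 ∧ (z.1 ≤ 1 ∨ 0 ≤ z.2)}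

/-- The homeomorphism from the half plane-like region `slideDomain` to `[0, 1] × ℝ`, given on the
plane: the first coordinate is the relative position on the lines `x + y = Y`. -/
def slideChart (z : ℝ × ℝ) : ℝ × ℝ := (z.1 / slideWidth (z.1 + z.2), z.1 + z.2)

/-- The inverse of `slideChart`. -/
def slideChartInv (z : ℝ × ℝ) : ℝ × ℝ := (z.1 * slideWidth z.2, z.2 - z.1 * slideWidth z.2)

theorem slideChart_inv (z : ℝ × ℝ) : slideChart (slideChartInv z) = z := by
  have := (slideWidth_pos z.2).ne'
  ext <;> simp [slideChart, slideChartInv, this]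

theorem slideChartInv_chart (z : ℝ × ℝ) : slideChartInv (slideChart z) = z := by
  have := (slideWidth_pos (z.1 + z.2)).ne'
  ext <;> simp [slideChart, slideChartInv, this]

theorem continuous_slideChart : Continuous slideChart := by
  unfold slideChart
  refine Continuous.prodMk (continuous_fst.div ?_ fun z => (slideWidth_pos _).ne') (by fun_prop)
  exact continuous_slideWidth.comp (by fun_prop)

theorem continuous_slideChartInv : Continuous slideChartInv := by
  unfold slideChartInv
  have := continuous_slideWidth
  fun_prop

theorem mem_slideDomain_iff (z : ℝ × ℝ) :
    z ∈ slideDomain ↔ 0 ≤ (slideChart z).1 ∧ (slideChart z).1 ≤ 1 := by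
  have h := slideWidth_pos (z.1 + z.2)
  change _ ↔ 0 ≤ z.1 / _ ∧ z.1 / _ ≤ 1
  rw [div_le_one h, le_div_iff₀ h, zero_mul]
  simp only [slideDomain, slideWidth, Set.mem_ofPred_eq, le_max_iff, le_min_iff]
  constructor
  · rintro ⟨h0, h2, h1 | h1⟩
    · exact ⟨h0, .inl h1⟩
    · exact ⟨h0, .inr ⟨h2, by linarith⟩⟩
  · rintro ⟨h0, h1 | ⟨h1, h2⟩⟩
    · exact ⟨h0, by linarith, .inl h1⟩
    · exact ⟨h0, h1, .inr (by linarith)⟩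

/-- The involution of `slideDomain` that is `(0, y) ↦ (0, -y)` on its left boundary and reverses its
right boundary, mapping the segment `[1, 2] × 0` to itself. -/
def slideMap (z : ℝ × ℝ) : ℝ × ℝ :=
  slideChartInv ((slideChart z).1, 3 * (slideChart z).1 - (slideChart z).2)

theorem slideMap_slideMap (z : ℝ × ℝ) : slideMap (slideMap z) = z := by
  simp [slideMap, slideChart_inv, slideChartInv_chart]

theorem continuous_slideMap : Continuous slideMap := by
  have h1 := continuous_slideChart
  have h2 := continuous_slideChartInv
  exact h2.comp (h1.fst.prodMk ((continuous_const.mul h1.fst).sub h1.snd))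

theorem slideMap_mem {z : ℝ × ℝ} (hz : z ∈ slideDomain) : slideMap z ∈ slideDomain := by
  rw [mem_slideDomain_iff] at hz ⊢
  rwa [slideMap, slideChart_inv]

theorem slideMap_left (y : ℝ) : slideMap (0, y) = (0, -y) := by
  simp [slideMap, slideChart, slideChartInv]

theorem slideMap_eq {x y x' y' : ℝ} (h : x = slideWidth (x + y)) (h' : x' = slideWidth (x' + y'))
    (e : x' + y' = 3 - (x + y)) : slideMap (x, y) = (x', y') := by
  have h1 := (slideWidth_pos (x + y)).ne'
  have h2 : slideChart (x, y) = (1, x + y) := by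
    ext
    · change x / slideWidth (x + y) = 1
      rw [← h]
      rw [← h] at h1
      exact div_self h1
    · rfl
  rw [slideMap, h2]
  change (1 * slideWidth (3 * 1 - (x + y)), 3 * 1 - (x + y) - 1 * slideWidth (3 * 1 - (x + y))) = _
  rw [mul_one, ← e, ← h', one_mul, add_sub_cancel_left]

theorem slideMap_bottom {y : ℝ} (hy : 0 ≤ y) : slideMap (1, -y) = (2, y) := by
  refine slideMap_eq ?_ ?_ (by ring)
  · rw [slideWidth, max_eq_left]
    exact (min_le_right _ _).trans (by linarith)
  · rw [slideWidth, min_eq_left (by linarith), max_eq_right (by norm_num)]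

theorem slideMap_top {y : ℝ} (hy : 0 ≤ y) : slideMap (2, y) = (1, -y) := by
  rw [← slideMap_bottom hy, slideMap_slideMap]

theorem slideMap_segment {x : ℝ} (h0 : 0 ≤ x) (h1 : x ≤ 1) : slideMap (1 + x, 0) = (2 - x, 0) := by
  refine slideMap_eq ?_ ?_ (by ring)
  · rw [slideWidth, min_eq_right (by linarith), max_eq_right (by linarith), add_zero]
  · rw [slideWidth, min_eq_right (by linarith), max_eq_right (by linarith), add_zero]

section slide

variable {H Y : Type} {inv : H → H} {q : H → ℝ → ℝ → Y} {e f : H}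

/-- The map from `slideDomain` that puts the strip over `inv e` above `[0, 1]`, the strip over `e`
below it, and the strip over `f` above `[1, 2]`. -/
def slidePlane (inv : H → H) (q : H → ℝ → ℝ → Y) (e f : H) (z : ℝ × ℝ) : Y :=
  if z.1 ≤ 1 then if z.2 ≤ 0 then q e (1 - z.1) (-z.2) else q (inv e) z.1 z.2
  else q f (z.1 - 1) z.2

theorem slidePlane_bottom {x y : ℝ} (h1 : x ≤ 1) (hy : 0 ≤ y) :
    slidePlane inv q e f (x, -y) = q e (1 - x) y := by
  simp [slidePlane, hy, h1]

section

variable [TopologicalSpace Y] {ν : Equiv.Perm H}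

theorem slidePlane_top (hq : IsStripSystem inv ν q) (hinv : inv (inv e) = e) {x y : ℝ}
    (h0 : 0 ≤ x) (h1 : x ≤ 1) (hy : 0 ≤ y) : slidePlane inv q e f (x, y) = q (inv e) x y := by
  rcases hy.eq_or_lt with rfl | hy
  · simp [slidePlane, hq.edge (inv e) x h0 h1, hinv, h1]
  · simp [slidePlane, hy.not_ge, h1]

theorem slidePlane_right (hq : IsStripSystem inv ν q) (hinv : inv (inv e) = e)
    (hf : ν (inv e) = f) {x y : ℝ} (h0 : 1 ≤ x) (hy : 0 ≤ y) :
    slidePlane inv q e f (x, y) = q f (x - 1) y := by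
  rcases h0.eq_or_lt with rfl | h0
  · rw [slidePlane_top hq hinv zero_le_one le_rfl hy, hq.strip _ _ hy, hf, sub_self]
  · simp [slidePlane, h0.not_ge]

theorem continuousOn_slidePlane (hq : IsStripSystem inv ν q) (hinv : inv (inv e) = e)
    (hf : ν (inv e) = f) : ContinuousOn (slidePlane inv q e f) slideDomain := by
  let C₁ : Set (ℝ × ℝ) := Set.Icc 0 1 ×ˢ Set.Iic 0
  let C₂ : Set (ℝ × ℝ) := Set.Icc 0 1 ×ˢ Set.Ici 0
  let C₃ : Set (ℝ × ℝ) := Set.Icc 1 2 ×ˢ Set.Ici 0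
  have c₁ : ContinuousOn (slidePlane inv q e f) C₁ := by
    refine ((hq.cont e).comp (f := fun z : ℝ × ℝ => (1 - z.1, -z.2)) (by fun_prop)
      fun z hz => ⟨⟨sub_nonneg.2 hz.1.2, sub_le_self 1 hz.1.1⟩,
        neg_nonneg.2 (show z.2 ≤ 0 from hz.2)⟩).congr ?_
    rintro ⟨x, y⟩ ⟨⟨-, h1⟩, h2 : y ≤ 0⟩
    have := slidePlane_bottom (inv := inv) (q := q) (e := e) (f := f) h1 (neg_nonneg.2 h2)
    rwa [neg_neg] at this
  have c₂ : ContinuousOn (slidePlane inv q e f) C₂ :=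
    (hq.cont (inv e)).congr fun z hz => slidePlane_top hq hinv hz.1.1 hz.1.2 hz.2
  have c₃ : ContinuousOn (slidePlane inv q e f) C₃ :=
    ((hq.cont f).comp (f := fun z : ℝ × ℝ => (z.1 - 1, z.2)) (by fun_prop)
      fun z hz => ⟨⟨sub_nonneg.2 hz.1.1, by linarith [hz.1.2]⟩, hz.2⟩).congr
      fun z hz => slidePlane_right hq hinv hf hz.1.1 hz.2
  have h₁ : IsClosed C₁ := isClosed_Icc.prod isClosed_Iic
  have h₂ : IsClosed C₂ := isClosed_Icc.prod isClosed_Ici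
  have h₃ : IsClosed C₃ := isClosed_Icc.prod isClosed_Ici
  refine ((c₁.union_of_isClosed c₂ h₁ h₂).union_of_isClosed c₃ (h₁.union h₂) h₃).mono ?_
  rintro ⟨x, y⟩ ⟨h0, h2, h⟩
  simp only at h0 h2 h
  by_cases hx : x ≤ 1
  · rcases le_total y 0 with hy | hy
    · exact .inl (.inl ⟨⟨h0, hx⟩, hy⟩)
    · exact .inl (.inr ⟨⟨h0, hx⟩, hy⟩)
  · exact .inr ⟨⟨(not_le.1 hx).le, h2⟩, h.resolve_left hx⟩

end

variable [DecidableEq H]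

/-- The strip system obtained by sliding the edge `e` over the edge `f`. -/
def slideSystem (inv : H → H) (q : H → ℝ → ℝ → Y) (e f : H) : H → ℝ → ℝ → Y := fun h x y =>
  if h = inv e then slidePlane inv q e f (slideMap (x, -y))
  else if h = e then slidePlane inv q e f (slideMap (1 - x, y))
  else if h = f then slidePlane inv q e f (slideMap (2 - x, y))
  else q h x y

/-- The boundary permutation after a slide. -/
def slidePerm (inv : H → H) (ν : Equiv.Perm H) (e f : H) : Equiv.Perm H :=
  Equiv.swap e f * ν * Equiv.swap (inv e) f

theorem slideSystem_inv (x y : ℝ) :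
    slideSystem inv q e f (inv e) x y = slidePlane inv q e f (slideMap (x, -y)) := if_pos rfl

theorem slideSystem_self (hi : inv e ≠ e) (x y : ℝ) :
    slideSystem inv q e f e x y = slidePlane inv q e f (slideMap (1 - x, y)) := by
  simp [slideSystem, hi.symm]

theorem slideSystem_over (hi : f ≠ inv e) (he : f ≠ e) (x y : ℝ) :
    slideSystem inv q e f f x y = slidePlane inv q e f (slideMap (2 - x, y)) := by
  simp [slideSystem, hi, he]

theorem slideSystem_of_ne {h : H} (h1 : h ≠ inv e) (h2 : h ≠ e) (h3 : h ≠ f) (x y : ℝ) :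
    slideSystem inv q e f h x y = q h x y := by
  simp [slideSystem, h1, h2, h3]

theorem slideSystem_comp {Z : Type} (g : Y → Z) (h : H) (x y : ℝ) :
    slideSystem inv (fun h x y => g (q h x y)) e f h x y = g (slideSystem inv q e f h x y) := by
  simp only [slideSystem, slidePlane]
  split_ifs <;> rfl

/-- Sliding back is the inverse operation. In the mirror image of the surface, obtained by
`x ↦ 1 - x` on the strips, it is the slide of `inv e` over `f`. -/
theorem slideSystem_slideSystem (hinv : inv (inv e) = e) (hi : inv e ≠ e) (fi : f ≠ inv e)
    (fe : f ≠ e) (h : H) {x y : ℝ} (h0 : 0 ≤ x) (hy : 0 ≤ y) (hq : ∀ x, 0 ≤ x → x ≤ 1 →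
      q e x 0 = q (inv e) (1 - x) 0) (h1 : x ≤ 1) (hf : ∀ y, 0 ≤ y → q (inv e) 1 y = q f 0 y) :
    slideSystem inv (fun h x y => slideSystem inv q e f h (1 - x) y) (inv e) f h x y =
      q h (1 - x) y := by
  have key : ∀ z, slidePlane inv (fun h x y => slideSystem inv q e f h (1 - x) y) (inv e) f z =
      slidePlane inv q e f (slideMap z) := by
    rintro ⟨x, y⟩
    rw [slidePlane]
    simp only [hinv, slideSystem_inv, slideSystem_self hi, slideSystem_over fi fe]
    split_ifs <;> ring_nf
  have hi' : inv (inv e) ≠ inv e := by rw [hinv]; exact hi.symm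
  have fi' : f ≠ inv (inv e) := by rwa [hinv]
  by_cases he : h = e
  · subst he
    refine (if_pos hinv.symm).trans ?_
    rw [key, slideMap_slideMap, slidePlane_bottom h1 hy]
  by_cases he' : h = inv e
  · subst he'
    rw [slideSystem_self hi', key, slideMap_slideMap]
    rcases hy.eq_or_lt with rfl | hy
    · simp [slidePlane, h0, hq x h0 h1]
    · simp [slidePlane, h0, hy.not_ge]
  by_cases hf' : h = f
  · subst hf'
    rw [slideSystem_over fi' fi, key, slideMap_slideMap]
    rcases h1.eq_or_lt with rfl | h1
    · rcases hy.eq_or_lt with rfl | hy'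
      · have := hq 0 le_rfl zero_le_one
        norm_num [slidePlane, ← hf, this]
      · norm_num [slidePlane, hy'.not_ge, hf y hy]
    · have : ¬ (2 - x ≤ 1) := by linarith
      simp only [slidePlane, this, if_false]
      ring_nf
  · rw [slideSystem_of_ne (by rwa [hinv]) he' hf', slideSystem_of_ne he' he hf']

theorem mem_slideDomain_inv {x y : ℝ} (h0 : 0 ≤ x) (h1 : x ≤ 1) : (x, -y) ∈ slideDomain :=
  ⟨h0, h1.trans one_le_two, .inl h1⟩

theorem mem_slideDomain_self {x y : ℝ} (h0 : 0 ≤ x) (h1 : x ≤ 1) : (1 - x, y) ∈ slideDomain :=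
  ⟨sub_nonneg.2 h1, (sub_le_self 1 h0).trans one_le_two, .inl (sub_le_self 1 h0)⟩

theorem mem_slideDomain_over {x y : ℝ} (h0 : 0 ≤ x) (h1 : x ≤ 1) (hy : 0 ≤ y) :
    (2 - x, y) ∈ slideDomain :=
  ⟨sub_nonneg.2 (h1.trans one_le_two), sub_le_self 2 h0, .inr hy⟩

theorem slideSystem_congr {q' : H → ℝ → ℝ → Y}
    (hq : ∀ h x y, 0 ≤ x → x ≤ 1 → 0 ≤ y → q h x y = q' h x y) (h : H) {x y : ℝ} (h0 : 0 ≤ x)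
    (h1 : x ≤ 1) (hy : 0 ≤ y) : slideSystem inv q e f h x y = slideSystem inv q' e f h x y := by
  have key : ∀ z ∈ slideDomain, slidePlane inv q e f z = slidePlane inv q' e f z := by
    rintro ⟨x, y⟩ ⟨h0, h2, h⟩
    simp only at h0 h2 h
    simp only [slidePlane]
    split_ifs with h1 hy
    · exact hq _ _ _ (by linarith) (by linarith) (by linarith)
    · exact hq _ _ _ h0 h1 (by linarith)
    · exact hq _ _ _ (by linarith) (by linarith) (h.resolve_left h1)
  simp only [slideSystem]
  split_ifs
  · exact key _ (slideMap_mem (mem_slideDomain_inv h0 h1))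
  · exact key _ (slideMap_mem (mem_slideDomain_self h0 h1))
  · exact key _ (slideMap_mem (mem_slideDomain_over h0 h1 hy))
  · exact hq h x y h0 h1 hy

theorem isStripSystem_slideSystem [TopologicalSpace Y] {ν : Equiv.Perm H}
    (hq : IsStripSystem inv ν q) (hinv : ∀ h, inv (inv h) = h)
    (hne : ∀ h, inv h ≠ h) (hf : ν (inv e) = f) (fi : f ≠ inv e) (fe : f ≠ e) :
    IsStripSystem inv (slidePerm inv ν e f) (slideSystem inv q e f) where
  cont h := by
    have key : ∀ g : ℝ × ℝ → ℝ × ℝ, Continuous g → (∀ z ∈ halfStrip, g z ∈ slideDomain) →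
        ContinuousOn (fun z => slidePlane inv q e f (slideMap (g z))) halfStrip := fun g hg hm =>
      (continuousOn_slidePlane hq (hinv e) hf).comp
        (continuous_slideMap.comp hg).continuousOn fun z hz => slideMap_mem (hm z hz)
    by_cases h1 : h = inv e
    · subst h1
      refine (key (fun z => (z.1, -z.2)) (by fun_prop) ?_).congr fun z _ => slideSystem_inv _ _
      exact fun z hz => mem_slideDomain_inv hz.1.1 hz.1.2
    by_cases h2 : h = e
    · subst h2
      refine (key (fun z => (1 - z.1, z.2)) (by fun_prop) ?_).congr
        fun z _ => slideSystem_self (hne h) _ _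
      exact fun z hz => mem_slideDomain_self hz.1.1 hz.1.2
    by_cases h3 : h = f
    · subst h3
      refine (key (fun z => (2 - z.1, z.2)) (by fun_prop) ?_).congr
        fun z _ => slideSystem_over fi fe _ _
      exact fun z hz => mem_slideDomain_over hz.1.1 hz.1.2 hz.2
    · exact (hq.cont h).congr fun z _ => slideSystem_of_ne h1 h2 h3 _ _
  strip h y hy := by
    -- Up to the slide, the right side of each strip and the left side of the next are unchanged.
    have hr : ∀ k, k ≠ inv e →
        slideSystem inv q e f (Equiv.swap (inv e) f k) 1 y = q k 1 y := by
      intro k hk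
      by_cases k3 : k = f
      · subst k3
        rw [Equiv.swap_apply_right, slideSystem_inv, slideMap_bottom hy,
          slidePlane_right hq (hinv e) hf one_le_two hy]
        norm_num
      rw [Equiv.swap_apply_of_ne_of_ne hk k3]
      by_cases k2 : k = e
      · subst k2
        rw [slideSystem_self (hne k), sub_self, slideMap_left, slidePlane_bottom zero_le_one hy,
          sub_zero]
      · rw [slideSystem_of_ne hk k2 k3]
    have hl : ∀ k, k ≠ f → slideSystem inv q e f (Equiv.swap e f k) 0 y = q k 0 y := by
      intro k k3
      by_cases k2 : k = e
      · subst k2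
        rw [Equiv.swap_apply_left, slideSystem_over fi fe, sub_zero, slideMap_top hy,
          slidePlane_bottom le_rfl hy, sub_self]
      rw [Equiv.swap_apply_of_ne_of_ne k2 k3]
      by_cases k1 : k = inv e
      · subst k1
        rw [slideSystem_inv, slideMap_left, neg_neg,
          slidePlane_top hq (hinv e) le_rfl zero_le_one hy]
      · rw [slideSystem_of_ne k1 k2 k3]
    obtain ⟨k, rfl⟩ := (Equiv.swap (inv e) f).surjective h
    have hk : slidePerm inv ν e f (Equiv.swap (inv e) f k) = Equiv.swap e f (ν k) := by
      simp [slidePerm]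
    rw [hk]
    by_cases k1 : k = inv e
    · subst k1
      rw [hf, Equiv.swap_apply_left, Equiv.swap_apply_right, slideSystem_over fi fe,
        slideSystem_self (hne e)]
      norm_num
    · rw [hr k k1, hq.strip k y hy, hl]
      intro h'
      exact k1 (ν.injective (h'.trans hf.symm))
  edge h x h0 h1 := by
    have hff : ∀ x, 0 ≤ x → x ≤ 1 → slideSystem inv q e f f x 0 = q f x 0 := by
      intro x h0 h1
      rw [slideSystem_over fi fe, ← slideMap_segment h0 h1, slideMap_slideMap,
        slidePlane_right hq (hinv e) hf (by linarith) le_rfl, add_sub_cancel_left]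
    have gen : ∀ h, h ≠ inv e → h ≠ e → ∀ x, 0 ≤ x → x ≤ 1 →
        slideSystem inv q e f h x 0 = q h x 0 := by
      intro h k1 k2 x h0 h1
      by_cases k3 : h = f
      · subst k3
        exact hff x h0 h1
      · exact slideSystem_of_ne k1 k2 k3 _ _
    by_cases k1 : h = inv e
    · subst k1
      rw [hinv, slideSystem_inv, slideSystem_self (hne e)]
      norm_num
    by_cases k2 : h = e
    · subst k2
      rw [slideSystem_inv, slideSystem_self (hne h)]
      norm_num
    rw [gen h k1 k2 x h0 h1, gen (inv h) (fun h' => k2 ?_) (fun h' => k1 ?_) (1 - x)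
      (by linarith) (by linarith), hq.edge h x h0 h1]
    · rw [← hinv h, h', hinv]
    · rw [← hinv h, h']

end slide

namespace PolygonScheme

variable (P : PolygonScheme) [DecidableEq P.side] {e f : P.side}

/-- The scheme obtained by sliding the edge `e` over the edge `f` that follows it in the rotation
at its origin. -/
abbrev slide (e f : P.side) : PolygonScheme := P.withNext (slidePerm P.inv P.next e f)

theorem isStripSystem_slide (hf : P.next (P.inv e) = f) (fi : f ≠ P.inv e) (fe : f ≠ e) :
    IsStripSystem (P.slide e f).inv (P.slide e f).next (slideSystem P.inv P.rpt e f) :=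
  isStripSystem_slideSystem P.isStripSystem_rpt P.inv_inv P.inv_ne hf fi fe

/-- The homeomorphism from the surface of the scheme after a slide to the original surface. -/
def slideHomeo (hf : P.next (P.inv e) = f) (fi : f ≠ P.inv e) (fe : f ≠ e) :
    (P.slide e f).Surface ≃ₜ P.Surface := by
  let P' := P.slide e f
  have hsys := P.isStripSystem_slide hf fi fe
  have hν : slidePerm P.inv P.next e f f = e := by
    simp [slidePerm, hf]
  have hν' : slidePerm P.inv (slidePerm P.inv P.next e f)⁻¹ (P.inv e) f = P.next⁻¹ := by
    simp [slidePerm, mul_assoc, P.inv_inv]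
  have hf' : (slidePerm P.inv P.next e f)⁻¹ (P.inv (P.inv e)) = f := by
    rw [P.inv_inv, Equiv.Perm.inv_eq_iff_eq, hν]
  have hsys' : IsStripSystem P.inv P.next fun h x y =>
      slideSystem P.inv (fun h x y => P'.rpt h (1 - x) y) (P.inv e) f h (1 - x) y := by
    have h := isStripSystem_slideSystem (f := f) (e := P.inv e) P'.isStripSystem_rpt.flip
      P.inv_inv P.inv_ne hf' (by rwa [P.inv_inv]) fi
    have h' := h.flip
    rwa [show slidePerm P'.inv P'.next⁻¹ (P.inv e) f = P.next⁻¹ from hν', _root_.inv_inv] at h'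
  let s : C(P'.Surface, P.Surface) := P'.desc hsys
  let s' : C(P.Surface, P'.Surface) := P.desc hsys'
  have hs : ∀ h x y, 0 ≤ x → x ≤ 1 → 0 ≤ y → s (P'.rpt h x y) =
    slideSystem P.inv P.rpt e f h x y := fun h x y h0 h1 hy => P'.desc_rpt hsys h h0 h1 hy
  have hs' : ∀ h x y, 0 ≤ x → x ≤ 1 → 0 ≤ y → s' (P.rpt h x y) =
      slideSystem P.inv (fun h x y => P'.rpt h (1 - x) y) (P.inv e) f h (1 - x) y :=
    fun h x y h0 h1 hy => P.desc_rpt hsys' h h0 h1 hy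
  have e1 : ∀ p, s (s' p) = p := by
    intro p
    obtain ⟨h, x, y, h0, h1, hy, rfl⟩ := P.exists_rpt p
    rw [hs' h x y h0 h1 hy, ← slideSystem_comp (g := s)]
    refine (slideSystem_congr (q' := fun h x y => slideSystem P.inv P.rpt e f h (1 - x) y)
      (fun h x y h0 h1 hy => hs h _ y (by linarith) (by linarith) hy) h (by linarith) (by linarith)
      hy).trans ?_
    rw [slideSystem_slideSystem (P.inv_inv e) (P.inv_ne e) fi fe h (by linarith) hy
      (fun x => P.rpt_side e) (by linarith) (fun y _ => by rw [P.rpt_strip, hf]), sub_sub_cancel]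
  have e2 : ∀ p, s' (s p) = p := by
    intro p
    obtain ⟨h, x, y, h0, h1, hy, rfl⟩ := P'.exists_rpt p
    rw [hs h x y h0 h1 hy, ← slideSystem_comp (g := s')]
    refine (slideSystem_congr (q' := fun h x y => slideSystem P.inv
        (fun h x y => P'.rpt h (1 - x) y) (P.inv e) f h (1 - x) y)
      (fun h x y h0 h1 hy => hs' h x y h0 h1 hy) h h0 h1 hy).trans ?_
    have := slideSystem_slideSystem (inv := P.inv) (q := fun h x y => P'.rpt h (1 - x) y)
      (e := P.inv e) (f := f) (by rw [P.inv_inv]) (P.inv_ne _) (by rwa [P.inv_inv]) fi h h0 hy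
      (fun x => P'.isStripSystem_rpt.flip.edge _ x) h1 (fun y hy => by
        have := P'.isStripSystem_rpt.flip.strip (P.inv (P.inv e)) y hy
        rw [this]
        exact congrArg (fun k => P'.rpt k (1 - 0) y) hf')
    rw [P.inv_inv, sub_sub_cancel] at this
    exact this
  exact
    { toFun := s
      invFun := s'
      left_inv := e2
      right_inv := e1
      continuous_toFun := s.continuous
      continuous_invFun := s'.continuous }

theorem slideHomeo_rpt (hf : P.next (P.inv e) = f) (fi : f ≠ P.inv e) (fe : f ≠ e) (h : P.side)
    {x y : ℝ} (h0 : 0 ≤ x) (h1 : x ≤ 1) (hy : 0 ≤ y) :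
    P.slideHomeo hf fi fe ((P.slide e f).rpt h x y) = slideSystem P.inv P.rpt e f h x y :=
  (P.slide e f).desc_rpt (P.isStripSystem_slide hf fi fe) h h0 h1 hy

theorem slide_hol_of_ne {G : Type*} [Group G] (ρ : Hol P.Surface G) (hf : P.next (P.inv e) = f)
    (fi : f ≠ P.inv e) (fe : f ≠ e) {h : P.side} (hi : h ≠ P.inv e) (he : h ≠ e) :
    (P.slide e f).hol (ρ.comap (P.slideHomeo hf fi fe : C(_, P.Surface))) h = P.hol ρ h := by
  refine ρ.val_congr zero_le_one fun t h0 h1 => ?_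
  change P.slideHomeo hf fi fe ((P.slide e f).edge h t) = P.edge h t
  rw [edge_eq_rpt, edge_eq_rpt, P.slideHomeo_rpt hf fi fe h h0 h1 le_rfl]
  by_cases h3 : h = f
  · subst h3
    rw [slideSystem_over fi fe, ← slideMap_segment h0 h1, slideMap_slideMap,
      slidePlane_right P.isStripSystem_rpt (P.inv_inv e) hf (by linarith) le_rfl,
      add_sub_cancel_left]
  · exact slideSystem_of_ne hi he h3 _ _

/-- After the slide, the edge `e` runs along `f` backwards before it follows its old course. -/
theorem slide_hol_self {G : Type*} [Group G] (ρ : Hol P.Surface G) (hf : P.next (P.inv e) = f)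
    (fi : f ≠ P.inv e) (fe : f ≠ e) :
    (P.slide e f).hol (ρ.comap (P.slideHomeo hf fi fe : C(_, P.Surface))) e =
      (P.hol ρ f)⁻¹ * P.hol ρ e := by
  -- All three paths lie in the image of `slideDomain`. This is a retract of the plane by `c`, so
  -- that the holonomy has a potential `u` there.
  let c : ℝ × ℝ → ℝ × ℝ := fun z => slideChartInv (max 0 (min 1 z.1), z.2)
  have hc : Continuous c := continuous_slideChartInv.comp (by fun_prop)
  have hcD : ∀ z, c z ∈ slideDomain := fun z => by
    rw [mem_slideDomain_iff, slideChart_inv]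
    exact ⟨le_max_left _ _, max_le zero_le_one (min_le_left _ _)⟩
  have hcc : ∀ z ∈ slideDomain, c (slideChart z) = z := fun z hz => by
    rw [mem_slideDomain_iff] at hz
    change slideChartInv (_, _) = z
    rw [min_eq_right hz.2, max_eq_right hz.1]
    exact slideChartInv_chart z
  let E : C(ℝ × ℝ, P.Surface) := ⟨fun z => slidePlane P.inv P.rpt e f (c z),
    (continuousOn_slidePlane P.isStripSystem_rpt (P.inv_inv e) hf).comp_continuous hc hcD⟩
  have hE : ∀ z ∈ slideDomain, E (slideChart z) = slidePlane P.inv P.rpt e f z := fun z hz =>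
    congrArg (slidePlane P.inv P.rpt e f) (hcc z hz)
  obtain ⟨u, hu⟩ := ρ.plane E
  have key : ∀ (k : C(ℝ, P.Surface)) (g : ℝ → ℝ × ℝ) (hg : Continuous g),
      (∀ t, 0 ≤ t → t ≤ 1 → g t ∈ slideDomain ∧ k t = slidePlane P.inv P.rpt e f (g t)) →
      ρ.val k 0 1 = (u (slideChart (g 0)))⁻¹ * u (slideChart (g 1)) := by
    intro k g hg h
    refine Eq.trans ?_ (hu ⟨fun t => slideChart (g t), continuous_slideChart.comp hg⟩ 0 1)
    refine ρ.val_congr zero_le_one fun t h0 h1 => ?_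
    obtain ⟨h2, h3⟩ := h t h0 h1
    exact h3.trans (hE _ h2).symm
  have k1 := key (P.edge f) (fun t => (1 + t, 0)) (by fun_prop) fun t h0 h1 =>
    ⟨⟨by simp only; linarith, by simp only; linarith, .inr le_rfl⟩, by
      rw [slidePlane_right P.isStripSystem_rpt (P.inv_inv e) hf (by linarith) le_rfl,
        add_sub_cancel_left, edge_eq_rpt]⟩
  have k2 := key (P.edge e) (fun t => (1 - t, 0)) (by fun_prop) fun t h0 h1 =>
    ⟨mem_slideDomain_self h0 h1, by
      have := slidePlane_bottom (inv := P.inv) (q := P.rpt) (e := e) (f := f) (x := 1 - t)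
        (by linarith) (le_refl (0 : ℝ))
      rw [neg_zero, sub_sub_cancel] at this
      rw [this, edge_eq_rpt]⟩
  have k3 := key ((P.slideHomeo hf fi fe : C(_, P.Surface)).comp ((P.slide e f).edge e))
    (fun t => slideMap (1 - t, 0)) (continuous_slideMap.comp (by fun_prop)) fun t h0 h1 =>
    ⟨slideMap_mem (mem_slideDomain_self h0 h1), by
      change P.slideHomeo hf fi fe ((P.slide e f).edge e t) = _
      rw [edge_eq_rpt, P.slideHomeo_rpt hf fi fe e h0 h1 le_rfl, slideSystem_self (P.inv_ne e)]⟩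
  have m1 : slideMap (1, 0) = (2, 0) := by simpa using slideMap_bottom (le_refl (0 : ℝ))
  have m2 : slideMap (0, 0) = (0, 0) := by simpa using slideMap_left 0
  refine k3.trans ?_
  rw [hol, hol, k1, k2]
  norm_num [m1, m2]

end PolygonScheme

/-! ### Removing bivalent vertices -/

/-- Two strips side by side, compressed to one. -/
def doubleStrip {H Y : Type} (q : H → ℝ → ℝ → Y) (a b : H) (x y : ℝ) : Y :=
  if x ≤ 1 / 2 then q a (2 * x) y else q b (2 * x - 1) y

namespace PolygonScheme

variable (P : PolygonScheme)

/-- The hypothesis that the half-edges at the origin of `f` are `f` and `z`, and that `f` is not a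
loop; moreover the other end of `f` is not univalent. -/
structure IsBivalent (f z : P.side) : Prop where
  next_inv : P.next (P.inv f) = z
  next_inv' : P.next (P.inv z) = f
  ne : z ≠ f
  ne_inv : z ≠ P.inv f
  next_ne : P.next f ≠ P.inv f

variable {P} {f z : P.side}

namespace IsBivalent

theorem inv_ne_left (hb : P.IsBivalent f z) : P.inv z ≠ f := fun h =>
  hb.ne_inv (by rw [← h, P.inv_inv])

theorem inv_ne_inv (hb : P.IsBivalent f z) : P.inv z ≠ P.inv f := fun h =>
  hb.ne (by rw [← P.inv_inv z, h, P.inv_inv])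

theorem next_ne_self (hb : P.IsBivalent f z) : P.next f ≠ f := fun h =>
  hb.inv_ne_left (P.next.injective (hb.next_inv'.trans h.symm))

theorem next_ne_left (hb : P.IsBivalent f z) : P.next f ≠ z := fun h =>
  P.inv_ne f (P.next.injective (hb.next_inv.trans h.symm))

variable [DecidableEq P.side]

/-- The successor once the sides `f` and `inv f` are left out. -/
theorem mergePerm_apply (hb : P.IsBivalent f z) (h : P.side) :
    (Equiv.swap (P.inv f) z * Equiv.swap f (P.next f) * P.next) h =
      if h = f then f else if h = P.inv f then P.inv f else if h = P.inv z then P.next f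
      else if P.next h = P.inv f then z else P.next h := by
  simp only [Equiv.Perm.mul_apply]
  split_ifs with h1 h2 h3 h4
  · rw [h1, Equiv.swap_apply_right, Equiv.swap_apply_of_ne_of_ne (P.inv_ne f).symm hb.ne.symm]
  · rw [h2, hb.next_inv, Equiv.swap_apply_of_ne_of_ne hb.ne hb.next_ne_left.symm,
      Equiv.swap_apply_right]
  · rw [h3, hb.next_inv', Equiv.swap_apply_left,
      Equiv.swap_apply_of_ne_of_ne hb.next_ne hb.next_ne_left]
  · rw [h4, Equiv.swap_apply_of_ne_of_ne (P.inv_ne f) hb.next_ne.symm, Equiv.swap_apply_left]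
  · have h5 : P.next h ≠ f := fun h' => h3 (P.next.injective (h'.trans hb.next_inv'.symm))
    have h6 : P.next h ≠ P.next f := fun h' => h1 (P.next.injective h')
    have h7 : P.next h ≠ z := fun h' => h2 (P.next.injective (h'.trans hb.next_inv.symm))
    rw [Equiv.swap_apply_of_ne_of_ne h5 h6, Equiv.swap_apply_of_ne_of_ne h4 h7]

theorem mergePerm_mem (hb : P.IsBivalent f z) (h : P.side) (hh : h ≠ f ∧ h ≠ P.inv f) :
    (Equiv.swap (P.inv f) z * Equiv.swap f (P.next f) * P.next) h ≠ f ∧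
      (Equiv.swap (P.inv f) z * Equiv.swap f (P.next f) * P.next) h ≠ P.inv f := by
  have e1 := hb.mergePerm_apply f
  have e2 := hb.mergePerm_apply (P.inv f)
  rw [if_pos rfl] at e1
  rw [if_neg (P.inv_ne f), if_pos rfl] at e2
  constructor
  · intro h'
    exact hh.1 (Equiv.injective _ (h'.trans e1.symm))
  · intro h'
    exact hh.2 (Equiv.injective _ (h'.trans e2.symm))

/-- The scheme in which the edges of `f` and `z` are merged to one. -/
abbrev merge (hb : P.IsBivalent f z) : PolygonScheme where
  side := {h : P.side // h ≠ f ∧ h ≠ P.inv f}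
  finSide := by
    have := P.finSide
    infer_instance
  next := (Equiv.swap (P.inv f) z * Equiv.swap f (P.next f) * P.next).subtypePerm fun h => by
    refine ⟨fun hh => ?_, hb.mergePerm_mem h⟩
    by_contra hc
    rw [hb.mergePerm_apply] at hh
    by_cases h1 : h = f
    · rw [if_pos h1] at hh
      exact hh.1 rfl
    · by_cases h2 : h = P.inv f
      · rw [if_neg h1, if_pos h2] at hh
        exact hh.2 rfl
      · exact hc ⟨h1, h2⟩
  inv h := ⟨P.inv h.1, fun h' => h.2.2 ((P.inv_inv h.1).symm.trans (congrArg P.inv h')),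
    fun h' => h.2.1 ((P.inv_inv h.1).symm.trans ((congrArg P.inv h').trans (P.inv_inv f)))⟩
  inv_inv h := Subtype.ext (P.inv_inv _)
  inv_ne h := fun h' => P.inv_ne h.1 (congrArg Subtype.val h')

/-- The merged edge. -/
def mid (hb : P.IsBivalent f z) : hb.merge.side := ⟨z, hb.ne, hb.ne_inv⟩

theorem merge_next (hb : P.IsBivalent f z) (h : hb.merge.side) :
    (hb.merge.next h).1 = if h.1 = P.inv z then P.next f
      else if P.next h.1 = P.inv f then z else P.next h.1 := by
  refine (hb.mergePerm_apply h.1).trans ?_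
  rw [if_neg h.2.1, if_neg h.2.2]

/-- The strips of the original surface, joined along the removed vertex. -/
def joinSystem (_ : P.IsBivalent f z) (h : {h : P.side // h ≠ f ∧ h ≠ P.inv f}) (x y : ℝ) :
    P.Surface :=
  if h.1 = z then doubleStrip P.rpt (P.inv f) z x y
  else if h.1 = P.inv z then doubleStrip P.rpt (P.inv z) f x y
  else P.rpt h.1 x y

/-- The strips of the merged surface, cut at the removed vertex. -/
def cutSystem (hb : P.IsBivalent f z) (h : P.side) (x y : ℝ) : hb.merge.Surface :=
  if h1 : h = P.inv f then hb.merge.rpt hb.mid (x / 2) y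
  else if h2 : h = f then hb.merge.rpt (hb.merge.inv hb.mid) ((x + 1) / 2) y
  else if h = z then hb.merge.rpt hb.mid ((x + 1) / 2) y
  else if h = P.inv z then hb.merge.rpt (hb.merge.inv hb.mid) (x / 2) y
  else hb.merge.rpt ⟨h, h2, h1⟩ x y

theorem continuous_doubleStrip (P : PolygonScheme) (a b : P.side) (hab : P.next a = b) :
    Continuous fun w : ℝ × ℝ => doubleStrip P.rpt a b w.1 w.2 := by
  unfold doubleStrip
  refine Continuous.if_le ?_ ?_ continuous_fst continuous_const ?_
  · exact (P.continuous_rpt a).comp (f := fun w : ℝ × ℝ => (2 * w.1, w.2)) (by fun_prop)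
  · exact (P.continuous_rpt b).comp (f := fun w : ℝ × ℝ => (2 * w.1 - 1, w.2)) (by fun_prop)
  · intro w hw
    rw [hw]
    norm_num
    rw [P.rpt_strip, hab]

theorem isStripSystem_join (hb : P.IsBivalent f z) :
    IsStripSystem hb.merge.inv hb.merge.next hb.joinSystem where
  cont h := by
    refine Continuous.continuousOn ?_
    unfold joinSystem
    split_ifs
    · exact continuous_doubleStrip P _ _ hb.next_inv
    · exact continuous_doubleStrip P _ _ hb.next_inv'
    · exact P.continuous_rpt h.1
  strip h y hy := by
    have hl : ∀ h : hb.merge.side,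
        hb.joinSystem h 0 y = P.rpt (if h.1 = z then P.inv f else h.1) 0 y := by
      intro h
      unfold joinSystem doubleStrip
      split_ifs <;> simp_all
    have hr : hb.joinSystem h 1 y = P.rpt (if h.1 = P.inv z then f else h.1) 1 y := by
      unfold joinSystem doubleStrip
      have := P.inv_ne z
      split_ifs <;> norm_num at * <;> simp_all
    rw [hl, hr, P.rpt_strip, hb.merge_next]
    congr 1
    have h1 : h.1 ≠ P.inv f := h.2.2
    have h2 : P.next h.1 ≠ z := fun h' => h1 (P.next.injective (h'.trans hb.next_inv.symm))
    have h3 := hb.next_ne_left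
    split_ifs <;> simp_all
  edge h x h0 h1 := by
    have hzz := P.inv_ne z
    have key : ∀ x, 0 ≤ x → x ≤ 1 → doubleStrip P.rpt (P.inv f) z x 0 =
        doubleStrip P.rpt (P.inv z) f (1 - x) 0 := by
      intro x h0 h1
      unfold doubleStrip
      split_ifs with h2 h3 h3
      · have : x = 1 / 2 := by linarith
        subst this
        norm_num
        rw [P.rpt_strip, P.rpt_strip, hb.next_inv, hb.next_inv',
          P.rpt_side z le_rfl zero_le_one, sub_zero, P.rpt_strip, hb.next_inv']
      · rw [P.rpt_side (P.inv f) (by linarith) (by linarith), P.inv_inv]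
        ring_nf
      · rw [P.rpt_side z (by linarith) (by linarith)]
        ring_nf
      · linarith
    change hb.joinSystem h x 0 = hb.joinSystem (hb.merge.inv h) (1 - x) 0
    have hi : (hb.merge.inv h).1 = P.inv h.1 := rfl
    unfold joinSystem
    rw [hi]
    by_cases e1 : h.1 = z
    · rw [if_pos e1, e1, if_neg hzz, if_pos rfl, key x h0 h1]
    · by_cases e2 : h.1 = P.inv z
      · rw [if_neg e1, if_pos e2, e2, P.inv_inv, if_pos rfl,
          key (1 - x) (by linarith) (by linarith),
          sub_sub_cancel]
      · rw [if_neg e1, if_neg e2, if_neg, if_neg, P.rpt_side h.1 h0 h1]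
        · intro h'
          exact e1 (by rw [← P.inv_inv h.1, h', P.inv_inv])
        · intro h'
          exact e2 (by rw [← h', P.inv_inv])

theorem isStripSystem_cut (hb : P.IsBivalent f z) :
    IsStripSystem P.inv P.next hb.cutSystem where
  cont h := by
    have c := hb.merge.continuous_rpt
    refine Continuous.continuousOn ?_
    unfold cutSystem
    split_ifs
    · exact (c _).comp (f := fun w : ℝ × ℝ => (w.1 / 2, w.2)) (by fun_prop)
    · exact (c _).comp (f := fun w : ℝ × ℝ => ((w.1 + 1) / 2, w.2)) (by fun_prop)
    · exact (c _).comp (f := fun w : ℝ × ℝ => ((w.1 + 1) / 2, w.2)) (by fun_prop)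
    · exact (c _).comp (f := fun w : ℝ × ℝ => (w.1 / 2, w.2)) (by fun_prop)
    · exact c _
  strip h y hy := by
    have hzz := P.inv_ne z
    have hff := P.inv_ne f
    have hl : ∀ (h : P.side) (h1 : h ≠ P.inv f) (h2 : h ≠ f) (h3 : h ≠ z),
        hb.cutSystem h 0 y = hb.merge.rpt ⟨h, h2, h1⟩ 0 y := by
      intro h h1 h2 h3
      unfold cutSystem
      rw [dif_neg h1, dif_neg h2, if_neg h3]
      split_ifs with h4
      · subst h4
        norm_num
        rfl
      · rfl
    have hr : ∀ (h : P.side) (h1 : h ≠ P.inv f) (h2 : h ≠ f) (h3 : h ≠ P.inv z),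
        hb.cutSystem h 1 y = hb.merge.rpt ⟨h, h2, h1⟩ 1 y := by
      intro h h1 h2 h3
      unfold cutSystem
      rw [dif_neg h1, dif_neg h2]
      split_ifs with h4
      · subst h4
        norm_num
        rfl
      · rfl
    by_cases h1 : h = P.inv f
    · subst h1
      rw [hb.next_inv]
      unfold cutSystem
      rw [dif_pos rfl, dif_neg hb.ne_inv, dif_neg hb.ne, if_pos rfl]
      norm_num
    by_cases h2 : h = P.inv z
    · subst h2
      rw [hb.next_inv']
      unfold cutSystem
      rw [dif_neg h1, dif_neg hb.inv_ne_left, if_neg hzz, if_pos rfl, dif_neg hff.symm,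
        dif_pos rfl]
      norm_num
    by_cases h3 : h = f
    · subst h3
      rw [hl (P.next h) hb.next_ne hb.next_ne_self hb.next_ne_left]
      unfold cutSystem
      rw [dif_neg h1, dif_pos rfl]
      norm_num
      rw [hb.merge.rpt_strip]
      congr 1
      apply Subtype.ext
      rw [hb.merge_next]
      exact if_pos rfl
    rw [hr h h1 h3 h2, hb.merge.rpt_strip]
    have h5 : P.next h ≠ f := fun h' => h2 (P.next.injective (h'.trans hb.next_inv'.symm))
    have h7 : P.next h ≠ z := fun h' => h1 (P.next.injective (h'.trans hb.next_inv.symm))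
    have h8 := hb.merge_next ⟨h, h3, h1⟩
    rw [if_neg h2] at h8
    by_cases h4 : P.next h = P.inv f
    · rw [if_pos h4] at h8
      rw [h4]
      unfold cutSystem
      rw [dif_pos rfl, zero_div]
      exact congrArg (fun k => hb.merge.rpt k 0 y) (Subtype.ext h8)
    · rw [if_neg h4] at h8
      rw [hl _ h4 h5 h7]
      exact congrArg (fun k => hb.merge.rpt k 0 y) (Subtype.ext h8)
  edge h x h0 h1 := by
    have hzz := P.inv_ne z
    have hff := P.inv_ne f
    have hzf := hb.inv_ne_left
    have hzf' := hb.inv_ne_inv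
    have k := fun x h0 h1 => hb.merge.rpt_side hb.mid (x := x) h0 h1
    unfold cutSystem
    by_cases e1 : h = P.inv f
    · subst e1
      rw [dif_pos rfl, P.inv_inv, dif_neg hff.symm, dif_pos rfl, k _ (by linarith) (by linarith)]
      ring_nf
    by_cases e2 : h = f
    · subst e2
      rw [dif_neg e1, dif_pos rfl, dif_pos rfl, k _ (by linarith) (by linarith)]
      ring_nf
    by_cases e3 : h = z
    · subst e3
      rw [dif_neg e1, dif_neg e2, if_pos rfl, dif_neg hzf', dif_neg hzf, if_neg hzz, if_pos rfl,
        k _ (by linarith) (by linarith)]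
      ring_nf
    by_cases e4 : h = P.inv z
    · subst e4
      rw [dif_neg e1, dif_neg e2, if_neg e3, if_pos rfl, P.inv_inv, dif_neg hb.ne_inv,
        dif_neg hb.ne, if_pos rfl, k _ (by linarith) (by linarith)]
      ring_nf
    have inj : ∀ a b : P.side, P.inv a = b → a = P.inv b := fun a b h' => by
      rw [← h', P.inv_inv]
    have i1 : P.inv h ≠ P.inv f := fun h' => e2 ((inj _ _ h').trans (P.inv_inv f))
    have i2 : P.inv h ≠ f := fun h' => e1 (inj _ _ h')
    have i3 : P.inv h ≠ z := fun h' => e4 (inj _ _ h')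
    have i4 : P.inv h ≠ P.inv z := fun h' => e3 ((inj _ _ h').trans (P.inv_inv z))
    rw [dif_neg e1, dif_neg e2, if_neg e3, if_neg e4, dif_neg i1, dif_neg i2, if_neg i3, if_neg i4,
      hb.merge.rpt_side _ h0 h1]

/-- Merging edges at a bivalent vertex does not change the surface. -/
def mergeHomeo (hb : P.IsBivalent f z) : hb.merge.Surface ≃ₜ P.Surface where
  toFun := hb.merge.desc hb.isStripSystem_join
  invFun := P.desc hb.isStripSystem_cut
  left_inv p := by
    obtain ⟨h, x, y, h0, h1, hy, rfl⟩ := hb.merge.exists_rpt p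
    have d := fun k x h0 h1 => P.desc_rpt hb.isStripSystem_cut k (x := x) h0 h1 hy
    have hzz := P.inv_ne z
    have hff := P.inv_ne f
    rw [hb.merge.desc_rpt _ h h0 h1 hy]
    unfold joinSystem
    by_cases e1 : h.1 = z
    · have e1' : h = hb.mid := Subtype.ext e1
      rw [if_pos e1, doubleStrip, e1']
      split_ifs with hx
      · rw [d _ _ (by linarith) (by linarith), cutSystem, dif_pos rfl]
        ring_nf
      · rw [d _ _ (by linarith) (by linarith), cutSystem, dif_neg hb.ne_inv, dif_neg hb.ne,
          if_pos rfl]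
        ring_nf
    by_cases e2 : h.1 = P.inv z
    · have e2' : h = hb.merge.inv hb.mid := Subtype.ext e2
      rw [if_neg e1, if_pos e2, doubleStrip, e2']
      split_ifs with hx
      · rw [d _ _ (by linarith) (by linarith), cutSystem, dif_neg hb.inv_ne_inv,
          dif_neg hb.inv_ne_left, if_neg hzz, if_pos rfl]
        ring_nf
      · rw [d _ _ (by linarith) (by linarith), cutSystem, dif_neg hff.symm, dif_pos rfl]
        ring_nf
    · rw [if_neg e1, if_neg e2, d _ _ h0 h1, cutSystem, dif_neg h.2.2, dif_neg h.2.1, if_neg e1,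
        if_neg e2]
  right_inv p := by
    obtain ⟨h, x, y, h0, h1, hy, rfl⟩ := P.exists_rpt p
    have d := fun k x h0 h1 => hb.merge.desc_rpt hb.isStripSystem_join k (x := x) h0 h1 hy
    have hzz := P.inv_ne z
    have hm : (hb.mid).1 = z := rfl
    have hm' : (hb.merge.inv hb.mid).1 = P.inv z := rfl
    have jm : ∀ x, hb.joinSystem hb.mid x y = doubleStrip P.rpt (P.inv f) z x y := fun x => by
      rw [joinSystem, if_pos hm]
    have jm' : ∀ x, hb.joinSystem (hb.merge.inv hb.mid) x y = doubleStrip P.rpt (P.inv z) f x y :=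
      fun x => by rw [joinSystem, hm', if_neg hzz, if_pos rfl]
    have second : ∀ a b, P.next a = b → doubleStrip P.rpt a b ((x + 1) / 2) y = P.rpt b x y := by
      intro a b hab
      rw [doubleStrip]
      split_ifs with hx
      · have : x = 0 := by linarith
        subst this
        norm_num
        rw [P.rpt_strip, hab]
      · ring_nf
    have first : ∀ a b, doubleStrip P.rpt a b (x / 2) y = P.rpt a x y := by
      intro a b
      rw [doubleStrip, if_pos (by linarith)]
      ring_nf
    rw [P.desc_rpt _ h h0 h1 hy]
    unfold cutSystem
    split_ifs with e1 e2 e3 e4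
    · rw [d _ _ (by linarith) (by linarith), jm, first, e1]
    · rw [d _ _ (by linarith) (by linarith), jm', second _ _ hb.next_inv', e2]
    · rw [d _ _ (by linarith) (by linarith), jm, second _ _ hb.next_inv, e3]
    · rw [d _ _ (by linarith) (by linarith), jm', first, e4]
    · rw [d _ _ h0 h1, joinSystem, if_neg e3, if_neg e4]
  continuous_toFun := (hb.merge.desc hb.isStripSystem_join).continuous
  continuous_invFun := (P.desc hb.isStripSystem_cut).continuous

end IsBivalent

end PolygonScheme

/-! ### Reduction to one vertex -/

namespace PolygonScheme

/-- The rotation about the vertices: the successor of the half-edge `h` in the cyclic order at its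
origin. -/
def rot (P : PolygonScheme) : Equiv.Perm P.side :=
  (Function.Involutive.toPerm P.inv P.inv_inv).trans P.next

theorem rot_apply (P : PolygonScheme) (h : P.side) : P.rot h = P.next (P.inv h) := rfl

/-- In a connected surface, no proper nonempty set of sides is closed under gluing and
succession. -/
theorem eq_univ_of_closed (P : PolygonScheme) [ConnectedSpace P.Surface] {S : Set P.side}
    (hS : S.Nonempty) (hi : ∀ h, h ∈ S ↔ P.inv h ∈ S) (hn : ∀ h, h ∈ S ↔ P.next h ∈ S)
    (h : P.side) :
    h ∈ S := by
  obtain ⟨k, hk⟩ := hS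
  let d : C(P.Surface, Bool) := P.lift (fun h _ _ => @decide (h ∈ S) (Classical.dec _))
    (fun _ => continuous_const) (fun h y => by simp [hn h]) (fun h x => by simp [hi h])
  have := PreconnectedSpace.constant inferInstance d.continuous (x := P.pt k 0 0) (y := P.pt h 0 0)
  have h2 : @decide (k ∈ S) (Classical.dec _) = @decide (h ∈ S) (Classical.dec _) := this
  simpa [hk] using h2.symm

theorem merge_next_ne {P : PolygonScheme} [DecidableEq P.side] {f z : P.side}
    (hb : P.IsBivalent f z) (hP : ∀ h, P.next h ≠ P.inv h) (h : hb.merge.side) :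
    hb.merge.next h ≠ hb.merge.inv h := by
  intro e
  have e' : (hb.merge.next h).1 = P.inv h.1 := congrArg Subtype.val e
  rw [hb.merge_next] at e'
  split_ifs at e' with h1 h2
  · rw [h1, P.inv_inv] at e'
    exact hb.next_ne_left e'
  · exact h1 (by rw [e', P.inv_inv])
  · exact hP _ e'

section slide

variable {P : PolygonScheme} [DecidableEq P.side] {e f : P.side}

theorem slide_rot (e f : P.side) (h : P.side) :
    (P.slide e f).rot h = Equiv.swap e f (P.rot (Equiv.swap e (P.inv f) h)) := by
  change (Equiv.swap e f * P.next * Equiv.swap (P.inv e) f) (P.inv h) = _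
  have : Equiv.swap (P.inv e) f (P.inv h) = P.inv (Equiv.swap e (P.inv f) h) := by
    simp only [Equiv.swap_apply_def, apply_ite P.inv, P.inv_inv]
    have i : ∀ a b : P.side, P.inv a = P.inv b ↔ a = b :=
      fun a b => ⟨fun h => by rw [← P.inv_inv a, h, P.inv_inv], congrArg _⟩
    have i' : ∀ a b : P.side, P.inv a = b ↔ a = P.inv b :=
      fun a b => ⟨fun h => by rw [← h, P.inv_inv], fun h => by rw [h, P.inv_inv]⟩
    simp only [i, i']
  simp only [Equiv.Perm.mul_apply, this, rot_apply]

end slide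

/-- Each connected surface of a gluing scheme without univalent vertices has a gluing scheme with
one vertex: while there is an edge with two different ends, the other edges at one end of it are
slid over it, and then it is merged with the last one. -/
theorem exists_one_vertex (N : ℕ) : ∀ (P : PolygonScheme), Nat.card P.side ≤ N →
    ConnectedSpace P.Surface → (∀ h, P.next h ≠ P.inv h) →
    ∃ P' : PolygonScheme, Nonempty (P'.Surface ≃ₜ P.Surface) ∧ ∀ h h', P'.rot.SameCycle h h' := by
  classical
  induction N with
  | zero =>
    intro P hN _ _
    have := P.finSide
    have : IsEmpty P.side := Finite.card_eq_zero_iff.1 (Nat.le_zero.1 hN)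
    exact ⟨P, ⟨.refl _⟩, fun h => isEmptyElim h⟩
  | succ N ih =>
    -- Induction on the size of a set `S` of half-edges that is closed under rotation and contains
    -- the half-edges at the origin of `f`, but not those at the other end of `f`.
    have inner : ∀ (k : ℕ) (P : PolygonScheme), Nat.card P.side ≤ N + 1 →
        ConnectedSpace P.Surface → (∀ h, P.next h ≠ P.inv h) →
        ∀ (f : P.side) (S : Set P.side), f ∈ S → P.inv f ∉ S → (∀ h, h ∈ S ↔ P.rot h ∈ S) →
        S.ncard ≤ k →
        ∃ P' : PolygonScheme, Nonempty (P'.Surface ≃ₜ P.Surface) ∧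
          ∀ h h', P'.rot.SameCycle h h' := by
      intro k
      induction k with
      | zero =>
        intro P _ _ _ f S hf _ _ hk
        have := P.finSide
        have := (Set.ncard_eq_zero (Set.toFinite S)).1 (Nat.le_zero.1 hk)
        rw [this] at hf
        exact absurd hf (Set.notMem_empty f)
      | succ k ih' =>
        intro P hN hc hP f S hf hf' hS hk
        have := P.finSide
        by_cases hz : P.rot (P.rot f) = f
        -- The origin of `f` is bivalent and can be removed.
        · have hb : P.IsBivalent f (P.rot f) :=
            { next_inv := rfl
              next_inv' := hz
              ne := fun h => hP (P.inv f) (by rw [P.inv_inv]; exact h)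
              ne_inv := fun h => hf' (by rw [← h]; exact (hS f).1 hf)
              next_ne := hP f }
          have hc' : ConnectedSpace hb.merge.Surface :=
            hb.mergeHomeo.symm.surjective.connectedSpace hb.mergeHomeo.symm.continuous
          obtain ⟨P', ⟨g⟩, h'⟩ := ih hb.merge (by
            have : Nat.card hb.merge.side < Nat.card P.side :=
              Finite.card_subtype_lt (x := f) fun h => h.1 rfl
            omega) hc' (merge_next_ne hb hP)
          exact ⟨P', ⟨g.trans hb.mergeHomeo⟩, h'⟩
        -- The half-edge `e` before `f` can be slid to the other end of `f`.
        · obtain ⟨e, he⟩ := P.rot.surjective f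
          have heS : e ∈ S := (hS e).2 (by rwa [he])
          have hef : f ≠ e := fun h => hP (P.inv e) (by
            rw [P.inv_inv]
            exact he.trans h)
          have hef' : e ≠ P.inv f := fun h => hf' (h ▸ heS)
          have hfe' : f ≠ P.inv e := fun h => hef' (by rw [h, P.inv_inv])
          let g := P.slideHomeo (e := e) (f := f) he hfe' hef
          have r1 : (P.slide e f).rot e = P.rot (P.inv f) := by
            rw [slide_rot, Equiv.swap_apply_left, Equiv.swap_apply_of_ne_of_ne]
            · exact fun h => hf' ((hS _).2 (by rw [h]; exact heS))
            · exact fun h => hf' ((hS _).2 (by rw [h]; exact hf))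
          have r2 : (P.slide e f).rot (P.inv f) = e := by
            rw [slide_rot, Equiv.swap_apply_right, he, Equiv.swap_apply_right]
          have r3 : ∀ h, h ≠ e → h ≠ P.inv f → (P.slide e f).rot h = Equiv.swap e f (P.rot h) := by
            intro h h1 h2
            rw [slide_rot, Equiv.swap_apply_of_ne_of_ne h1 h2]
          have r4 : ∀ h, P.rot h = f ↔ h = e := fun h =>
            ⟨fun h' => P.rot.injective (h'.trans he.symm), fun h' => h' ▸ he⟩
          have hc' : ConnectedSpace (P.slide e f).Surface :=
            g.symm.surjective.connectedSpace g.symm.continuous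
          have hP' : ∀ h, (P.slide e f).rot h ≠ h := by
            intro h h'
            by_cases h1 : h = e
            · rw [h1, r1] at h'
              exact hf' ((hS _).2 (by rw [h']; exact heS))
            by_cases h2 : h = P.inv f
            · rw [h2, r2] at h'
              exact hef' h'
            rw [r3 h h1 h2, Equiv.swap_apply_eq_iff] at h'
            by_cases h3 : h = f
            · rw [h3, Equiv.swap_apply_right] at h'
              exact hz (by rw [h', he])
            · rw [Equiv.swap_apply_of_ne_of_ne h1 h3] at h'
              exact hP (P.inv h) (by rw [P.inv_inv]; exact h')
          have hS' : ∀ h, h ∈ S \ {e} ↔ (P.slide e f).rot h ∈ S \ {e} := by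
            intro h
            by_cases h1 : h = e
            · rw [h1, r1]
              simp [← hS, hf']
            by_cases h2 : h = P.inv f
            · rw [h2, r2]
              simp [hf']
            rw [r3 h h1 h2]
            by_cases h3 : P.rot h = e
            · rw [h3, Equiv.swap_apply_left]
              have : h ∈ S := (hS h).2 (by rwa [h3])
              simp [this, h1, hf, hef]
            · rw [Equiv.swap_apply_of_ne_of_ne h3 (by rwa [Ne, r4])]
              simp [h1, h3, hS h]
          obtain ⟨P', ⟨g'⟩, h'⟩ := ih' (P.slide e f) hN hc'
            (fun h h' => hP' (P.inv h) (by
              change (P.slide e f).next (P.inv (P.inv h)) = _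
              rw [P.inv_inv]
              exact h')) f (S \ {e}) ⟨hf, hef⟩ (fun h => hf' h.1) hS' (by
                have := Set.ncard_sdiff_singleton_lt_of_mem heS
                omega)
          exact ⟨P', ⟨g'.trans g⟩, h'⟩
    intro P hN hc hP
    by_cases h : ∃ (f : P.side) (S : Set P.side), f ∈ S ∧ P.inv f ∉ S ∧ ∀ h, h ∈ S ↔ P.rot h ∈ S
    · obtain ⟨f, S, hf, hf', hS⟩ := h
      exact inner _ P hN hc hP f S hf hf' hS le_rfl
    -- If there is no such edge, then the orbits of the rotation are closed under gluing.
    · push Not at h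
      have key : ∀ (S : Set P.side), (∀ h, h ∈ S ↔ P.rot h ∈ S) → ∀ h, h ∈ S ↔ P.inv h ∈ S := by
        intro S hS
        have : ∀ h, h ∈ S → P.inv h ∈ S := by
          intro k hk
          by_contra hk'
          obtain ⟨h', hh'⟩ := h k S hk hk'
          rcases hh' with h1 | h1
          · exact h1.2 ((hS _).1 h1.1)
          · exact h1.1 ((hS _).2 h1.2)
        exact fun h => ⟨this h, fun h' => by simpa [P.inv_inv] using this _ h'⟩
      refine ⟨P, ⟨.refl _⟩, fun a => ?_⟩
      have hS : ∀ h, h ∈ {b | P.rot.SameCycle a b} ↔ P.rot h ∈ {b | P.rot.SameCycle a b} :=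
        fun h => Equiv.Perm.sameCycle_apply_right.symm
      have hi := key _ hS
      exact P.eq_univ_of_closed (S := {b | P.rot.SameCycle a b}) ⟨a, Equiv.Perm.SameCycle.refl _ _⟩
        hi fun h => by
        rw [hi h, hS (P.inv h), rot_apply, P.inv_inv]

end PolygonScheme

/-! ### The sides of a gluing scheme with one vertex generate the fundamental group -/

namespace Hol

theorem val_congr_uIcc {X G : Type*} [TopologicalSpace X] [Group G] (ρ : Hol X G) {c c' : C(ℝ, X)}
    {a b : ℝ} (h : ∀ t ∈ Set.uIcc a b, c t = c' t) : ρ.val c a b = ρ.val c' a b := by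
  rcases le_total a b with hab | hab
  · rw [Set.uIcc_of_le hab] at h
    exact ρ.val_congr hab fun t h0 h1 => h t ⟨h0, h1⟩
  · rw [Set.uIcc_of_ge hab] at h
    rw [← ρ.val_inv c, ← ρ.val_inv c', ρ.val_congr hab fun t h0 h1 => h t ⟨h0, h1⟩]

/-- If a function is locally a potential for the holonomy along a curve, then it is a potential. -/
theorem val_eq_of_locally {X G : Type*} [TopologicalSpace X] [Group G] (ρ : Hol X G) (c : C(ℝ, X))
    (u : ℝ → G) (h : ∀ t₀ : ℝ, ∃ U ∈ nhds t₀, ∀ t, Set.uIcc t₀ t ⊆ U →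
      ρ.val c t₀ t = (u t₀)⁻¹ * u t) (a b : ℝ) : ρ.val c a b = (u a)⁻¹ * u b := by
  let W : ℝ → G := fun t => ρ.val c a t * (u t)⁻¹
  have hW : IsLocallyConstant W := by
    rw [IsLocallyConstant.iff_eventually_eq]
    intro t₀
    obtain ⟨U, hU, h⟩ := h t₀
    obtain ⟨ε, hε, hb⟩ := Metric.mem_nhds_iff.1 hU
    filter_upwards [Metric.ball_mem_nhds t₀ hε] with t ht
    have h1 := h t
      (((convex_ball t₀ ε).ordConnected.uIcc_subset (Metric.mem_ball_self hε) ht).trans hb)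
    simp only [W]
    rw [← ρ.val_mul c a t₀ t, h1]
    group
  have h1 : W a = W b := hW.apply_eq_of_isPreconnected isPreconnected_univ trivial trivial
  simp only [W, val_self, one_mul] at h1
  rw [h1]
  group

end Hol

namespace PolygonScheme

variable (P : PolygonScheme)

/-- The distance from the vertical sides of the strips. -/
def margin : C(P.Surface, ℝ) :=
  P.desc (q := fun _ x _ => min x (1 - x))
    { cont := fun h => Continuous.continuousOn (by fun_prop)
      strip := fun h y _ => by simp
      edge := fun h x _ _ => by rw [sub_sub_cancel, min_comm] }

/-- The stretching of the unit interval that is constant near both ends. -/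
def stretch (x : ℝ) : ℝ := max 0 (min 1 (3 * x - 1))

theorem continuous_stretch : Continuous stretch := by
  unfold stretch
  fun_prop

theorem stretch_one_sub (x : ℝ) : stretch (1 - x) = 1 - stretch x := by
  unfold stretch
  rcases le_total (3 * x - 1) 0 with h | h <;> rcases le_total 1 (3 * x - 1) with h' | h'
  · linarith
  · rw [min_eq_right h', max_eq_left h, min_eq_left (by linarith)]
    norm_num
  · rw [min_eq_left h', min_eq_right (by linarith), max_eq_left (by linarith)]
    norm_num
  · rw [min_eq_right h', max_eq_right h, min_eq_right (by linarith), max_eq_right (by linarith)]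
    ring

theorem stretch_eq_zero {x : ℝ} (h : x ≤ 1 / 3) : stretch x = 0 :=
  max_eq_left ((min_le_right _ _).trans (by linarith))

theorem stretch_eq_one {x : ℝ} (h : 2 / 3 ≤ x) : stretch x = 1 := by
  unfold stretch
  rw [min_eq_left (by linarith), max_eq_right zero_le_one]

theorem stretch_mem (x : ℝ) : 0 ≤ stretch x ∧ stretch x ≤ 1 :=
  ⟨le_max_left _ _, max_le zero_le_one (min_le_left _ _)⟩

/-- A homotopy from the identity to a map into the union of the sides that collapses the
neighbourhood `margin ≤ 1 / 3` of the vertices. -/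
def collapse : C(P.Surface, C(I, P.Surface)) :=
  P.desc (q := fun h x y => ⟨fun l : I => P.rpt h ((1 - l) * x + l * stretch x) ((1 - l) * y), by
      have := P.continuous_rpt h
      exact this.comp (f := fun l : I => ((1 - (l : ℝ)) * x + l * stretch x, (1 - (l : ℝ)) * y))
        (by fun_prop)⟩)
    { cont := fun h => by
        refine Continuous.continuousOn ?_
        refine ContinuousMap.continuous_of_continuous_uncurry _ ?_
        have := continuous_stretch
        exact (P.continuous_rpt h).comp (f := fun z : (ℝ × ℝ) × I =>
          ((1 - (z.2 : ℝ)) * z.1.1 + z.2 * stretch z.1.1, (1 - (z.2 : ℝ)) * z.1.2)) (by fun_prop)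
      strip := fun h y _ => by
        ext l
        change P.rpt h _ _ = P.rpt _ _ _
        rw [stretch_eq_zero (x := 0) (by norm_num), stretch_eq_one (x := 1) (by norm_num)]
        simpa using P.rpt_strip h ((1 - l) * y)
      edge := fun h x h0 h1 => by
        ext l
        change P.rpt h _ _ = P.rpt _ _ _
        have h2 := stretch_mem x
        rw [stretch_one_sub, mul_zero, P.rpt_side h]
        · ring_nf
        · exact add_nonneg (mul_nonneg (sub_nonneg.2 l.2.2) h0) (mul_nonneg l.2.1 h2.1)
        · have := mul_le_mul_of_nonneg_left h1 (sub_nonneg.2 l.2.2)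
          have := mul_le_mul_of_nonneg_left h2.2 l.2.1
          linarith }

theorem collapse_rpt (h : P.side) {x y : ℝ} (h0 : 0 ≤ x) (h1 : x ≤ 1) (hy : 0 ≤ y) (l : I) :
    P.collapse (P.rpt h x y) l = P.rpt h ((1 - l) * x + l * stretch x) ((1 - l) * y) :=
  DFunLike.congr_fun (P.desc_rpt _ h h0 h1 hy) l

theorem collapse_zero (p : P.Surface) : P.collapse p 0 = p := by
  obtain ⟨h, x, y, h0, h1, hy, rfl⟩ := P.exists_rpt p
  rw [P.collapse_rpt h h0 h1 hy]
  simp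

theorem collapse_one (h : P.side) {x y : ℝ} (h0 : 0 ≤ x) (h1 : x ≤ 1) (hy : 0 ≤ y) :
    P.collapse (P.rpt h x y) 1 = P.edge h (stretch x) := by
  rw [P.collapse_rpt h h0 h1 hy, edge_eq_rpt]
  simp

open Classical in
/-- The position along the side `h`, on the strips over `h` and `inv h`; it is modified near their
vertical sides to be continuous. -/
def position (h : P.side) : C(P.Surface, ℝ) :=
  P.desc (q := fun k x _ => if k = h then min x (3 * (1 - x))
      else if k = P.inv h then min (1 - x) (3 * x) else 0)
    { cont := fun k => by
        refine Continuous.continuousOn ?_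
        split_ifs <;> fun_prop
      strip := fun k y _ => by
        have h1 : ∀ k, (if k = h then min (1 : ℝ) (3 * (1 - 1))
            else if k = P.inv h then min (1 - 1) (3 * 1) else 0) = 0 := by
          intro k
          split_ifs <;> norm_num
        have h2 : ∀ k, (if k = h then min (0 : ℝ) (3 * (1 - 0))
            else if k = P.inv h then min (1 - 0) (3 * 0) else 0) = 0 := by
          intro k
          split_ifs <;> norm_num
        rw [h1, h2]
      edge := fun k x _ _ => by
        have hh := P.inv_ne h
        by_cases h1 : k = h
        · subst h1
          rw [if_pos rfl, if_neg hh, if_pos rfl]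
          ring_nf
        by_cases h2 : k = P.inv h
        · subst h2
          rw [if_neg h1, if_pos rfl, P.inv_inv, if_pos rfl]
          ring_nf
        · rw [if_neg h1, if_neg h2, if_neg, if_neg]
          · exact fun h' => h1 (by rw [← P.inv_inv k, h', P.inv_inv])
          · exact fun h' => h2 (by rw [← h', P.inv_inv]) }

open Classical in
theorem position_rpt (h k : P.side) {x y : ℝ} (h0 : 0 ≤ x) (h1 : x ≤ 1) (hy : 0 ≤ y) :
    P.position h (P.rpt k x y) = if k = h then min x (3 * (1 - x))
      else if k = P.inv h then min (1 - x) (3 * x) else 0 :=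
  P.desc_rpt _ k h0 h1 hy

theorem margin_rpt (k : P.side) {x y : ℝ} (h0 : 0 ≤ x) (h1 : x ≤ 1) (hy : 0 ≤ y) :
    P.margin (P.rpt k x y) = min x (1 - x) :=
  P.desc_rpt _ k h0 h1 hy

theorem edge_inv (h : P.side) {x : ℝ} (h0 : 0 ≤ x) (h1 : x ≤ 1) :
    P.edge (P.inv h) x = P.edge h (1 - x) := by
  rw [edge_eq_rpt, edge_eq_rpt, P.rpt_side h (by linarith) (by linarith), sub_sub_cancel]

theorem val_edge_inv {G : Type*} [Group G] (ρ : Hol P.Surface G) (h : P.side) {x x' : ℝ}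
    (h0 : 0 ≤ x) (h1 : x ≤ 1) (h0' : 0 ≤ x') (h1' : x' ≤ 1) :
    ρ.val (P.edge (P.inv h)) x x' = ρ.val (P.edge h) (1 - x) (1 - x') := by
  refine (ρ.val_congr_uIcc (c' := (P.edge h).comp ⟨fun t => 1 - t, by fun_prop⟩)
    fun t ht => ?_).trans (ρ.val_comp _ _ _ _)
  rw [Set.mem_uIcc] at ht
  exact P.edge_inv h (by rcases ht with ht | ht <;> linarith [ht.1])
    (by rcases ht with ht | ht <;> linarith [ht.2])

variable {P} {G : Type*} [Group G] (ρ : Hol P.Surface G)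

theorem hol_trivial_val (hρ : ∀ h, P.hol ρ h = 1) (h : P.side) (x : ℝ) :
    ρ.val (P.edge h) 1 x = ρ.val (P.edge h) 0 x := by
  rw [← ρ.val_mul (P.edge h) 0 1 x, show ρ.val (P.edge h) 0 1 = 1 from hρ h, one_mul]

/-- The holonomy from the vertex to the point where `collapse` ends, provided that the holonomy is
trivial along all sides. -/
def potential (hρ : ∀ h, P.hol ρ h = 1) : P.Surface → G :=
  Quot.lift (fun z => ρ.val (P.edge z.1) 0 (stretch z.2.1)) (by
    rintro _ _ (⟨h, y⟩ | ⟨h, x⟩)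
    · simp only [Set.Icc.coe_one, Set.Icc.coe_zero]
      rw [stretch_eq_zero (x := 0) (by norm_num), stretch_eq_one (x := 1) (by norm_num),
        ρ.val_self]
      exact hρ h
    · simp only [unitInterval.coe_symm_eq]
      have := stretch_mem x
      rw [P.val_edge_inv ρ h le_rfl zero_le_one (stretch_mem _).1 (stretch_mem _).2, sub_zero,
        hol_trivial_val ρ hρ, stretch_one_sub, sub_sub_cancel])

theorem potential_rpt (hρ : ∀ h, P.hol ρ h = 1) (h : P.side) {x y : ℝ} (h0 : 0 ≤ x) (h1 : x ≤ 1) :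
    potential ρ hρ (P.rpt h x y) = ρ.val (P.edge h) 0 (stretch x) := by
  rw [rpt, Set.projIcc_of_mem _ ⟨h0, h1⟩]
  rfl

/-- Away from the vertices, `collapse` moves points to the edge of `h` and the potential is that of
the edge. -/
theorem of_position_pos (hρ : ∀ h, P.hol ρ h = 1) {h : P.side} {p : P.Surface}
    (hp : 0 < P.position h p) (hm : 1 / 4 < P.margin p) :
    P.collapse p 1 = P.edge h (stretch (P.position h p)) ∧
      potential ρ hρ p = ρ.val (P.edge h) 0 (stretch (P.position h p)) := by
  obtain ⟨k, x, y, h0, h1, hy, rfl⟩ := P.exists_rpt p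
  rw [P.margin_rpt k h0 h1 hy, lt_min_iff] at hm
  rw [P.position_rpt h k h0 h1 hy] at hp ⊢
  rw [P.collapse_one k h0 h1 hy, potential_rpt ρ hρ k h0 h1]
  split_ifs at hp ⊢ with h2 h3
  · rw [min_eq_left (by linarith), h2]
    exact ⟨rfl, rfl⟩
  · have := stretch_mem x
    rw [min_eq_left (by linarith), h3, P.edge_inv h this.1 this.2,
      P.val_edge_inv ρ h le_rfl zero_le_one this.1 this.2, sub_zero, hol_trivial_val ρ hρ,
      stretch_one_sub]
    exact ⟨rfl, rfl⟩
  · exact absurd hp (lt_irrefl _)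

theorem edge_zero_eq (hP : ∀ h h', P.rot.SameCycle h h') (h h' : P.side) :
    P.edge h 0 = P.edge h' 0 := by
  have := P.finSide
  have key : ∀ k, P.edge (P.rot k) 0 = P.edge k 0 := fun k => by
    rw [rot_apply, edge_eq_rpt, ← P.rpt_strip, ← edge_eq_rpt, P.edge_inv k zero_le_one le_rfl,
      sub_self]
  obtain ⟨m, -, rfl⟩ := (hP h h').exists_pow_eq'
  induction m with
  | zero => rfl
  | succ m ih => rw [pow_succ', Equiv.Perm.mul_apply, key, ih]

/-- Near the vertices, `collapse` moves points to the only vertex. -/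
theorem of_margin_lt (hP : ∀ h h', P.rot.SameCycle h h') (hρ : ∀ h, P.hol ρ h = 1) {p : P.Surface}
    (hm : P.margin p < 1 / 3) (k : P.side) :
    P.collapse p 1 = P.edge k 0 ∧ potential ρ hρ p = 1 := by
  obtain ⟨h, x, y, h0, h1, hy, rfl⟩ := P.exists_rpt p
  rw [P.margin_rpt h h0 h1 hy, min_lt_iff] at hm
  rw [P.collapse_one h h0 h1 hy, potential_rpt ρ hρ h h0 h1]
  rcases hm with hm | hm
  · rw [stretch_eq_zero hm.le, ρ.val_self]
    exact ⟨edge_zero_eq hP _ _, rfl⟩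
  · rw [stretch_eq_one (by linarith)]
    refine ⟨?_, hρ h⟩
    have := P.edge_inv h (x := 0) le_rfl zero_le_one
    rw [sub_zero] at this
    rw [← this]
    exact edge_zero_eq hP _ _

/-- If there is one vertex, then a holonomy that is trivial along the sides is trivial on all
loops. -/
theorem val_loop_eq_one (hP : ∀ h h', P.rot.SameCycle h h') (hρ : ∀ h, P.hol ρ h = 1)
    (c : C(ℝ, P.Surface)) {a b : ℝ} (hc : c a = c b) : ρ.val c a b = 1 := by
  obtain ⟨k₀, -, -, -, -, -, -⟩ := P.exists_rpt (c a)
  let d : C(ℝ, P.Surface) := ⟨fun t => P.collapse (c t) 1, by fun_prop⟩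
  -- The holonomy along the collapsed curve.
  have h1 : ρ.val d a b = (potential ρ hρ (c a))⁻¹ * potential ρ hρ (c b) := by
    refine ρ.val_eq_of_locally d (fun t => potential ρ hρ (c t)) (fun t₀ => ?_) a b
    have cm : Continuous fun t => P.margin (c t) := by fun_prop
    rcases lt_or_ge (P.margin (c t₀)) (1 / 3) with hm | hm
    · refine ⟨{t | P.margin (c t) < 1 / 3}, (isOpen_lt cm continuous_const).mem_nhds hm,
        fun t ht => ?_⟩
      rw [(of_margin_lt ρ hP hρ (ht Set.left_mem_uIcc) k₀).2,
        (of_margin_lt ρ hP hρ (ht Set.right_mem_uIcc) k₀).2,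
        ρ.val_congr_uIcc (c' := .const ℝ (P.edge k₀ 0))
          fun s hs => (of_margin_lt ρ hP hρ (ht hs) k₀).1, ρ.val_const]
      simp
    · obtain ⟨h, x, y, h0, h1, hy, e⟩ := P.exists_rpt (c t₀)
      have hp : 0 < P.position h (c t₀) := by
        rw [e, P.margin_rpt h h0 h1 hy, le_min_iff] at hm
        rw [e, P.position_rpt h h h0 h1 hy, if_pos rfl, lt_min_iff]
        constructor <;> linarith
      have cp : Continuous fun t => P.position h (c t) := by fun_prop
      refine ⟨{t | 1 / 4 < P.margin (c t)} ∩ {t | 0 < P.position h (c t)},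
        ((isOpen_lt continuous_const cm).inter (isOpen_lt continuous_const cp)).mem_nhds
        ⟨show 1 / 4 < P.margin (c t₀) by linarith, hp⟩, fun t ht => ?_⟩
      let κ : C(ℝ, ℝ) := ⟨fun t => stretch (P.position h (c t)), continuous_stretch.comp cp⟩
      have hl := ht Set.left_mem_uIcc
      have hr := ht Set.right_mem_uIcc
      rw [(of_position_pos ρ hρ hl.2 hl.1).2, (of_position_pos ρ hρ hr.2 hr.1).2,
        ρ.val_congr_uIcc (c' := (P.edge h).comp κ)
          fun s hs => (of_position_pos ρ hρ (ht hs).2 (ht hs).1).1, ρ.val_comp, ρ.val_inv,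
        ρ.val_mul]
      rfl
  rw [hc, inv_mul_cancel] at h1
  -- The curve is freely homotopic to the collapsed curve.
  let E : C(ℝ × ℝ, P.Surface) := ⟨fun z => P.collapse (c z.1) (Set.projIcc 0 1 zero_le_one z.2), by
    have h1 : Continuous fun z : ℝ × ℝ => (Set.projIcc (0 : ℝ) 1 zero_le_one z.2 : I) :=
      continuous_projIcc.comp continuous_snd
    fun_prop⟩
  obtain ⟨u, hu⟩ := ρ.plane E
  have e0 : c = E.comp ⟨fun t => (t, 0), by fun_prop⟩ := by
    ext t
    simp [E, collapse_zero]
  have e1 : d = E.comp ⟨fun t => (t, 1), by fun_prop⟩ := by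
    ext t
    simp [E, d]
  have e2 : ρ.val (E.comp ⟨fun t => (a, t), by fun_prop⟩) 0 1 =
      ρ.val (E.comp ⟨fun t => (b, t), by fun_prop⟩) 0 1 := by
    refine ρ.val_congr zero_le_one fun t _ _ => ?_
    simp [E, hc]
  rw [e1, hu] at h1
  rw [hu, hu] at e2
  rw [e0, hu]
  simp only [ContinuousMap.coe_mk] at h1 e2 ⊢
  have e3 : u (a, 1) = u (b, 1) := inv_mul_eq_one.1 h1
  rw [e3] at e2
  rw [inv_inj.1 (mul_right_cancel e2), inv_mul_cancel]

end PolygonScheme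

/-! ### The holonomy given by a homomorphism to an abelian group -/

namespace Hol

open CategoryTheory

variable {X : Type} [TopologicalSpace X] {G : Type*} [CommGroup G] {x₀ : X}
  (p : ∀ x, Path x₀ x) (χ : FundamentalGroup X x₀ →* G)

/-- The value of a homomorphism on a path, closed up along chosen paths from the base point. -/
def ofHomAux {x y : X} (f : FundamentalGroupoid.mk x ⟶ FundamentalGroupoid.mk y) : G :=
  χ (arrow (p x) ≫ f ≫ Groupoid.inv (arrow (p y)) :
    FundamentalGroupoid.mk x₀ ⟶ FundamentalGroupoid.mk x₀)

theorem ofHomAux_comp {x y z : X} (f : FundamentalGroupoid.mk x ⟶ FundamentalGroupoid.mk y)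
    (g : FundamentalGroupoid.mk y ⟶ FundamentalGroupoid.mk z) :
    ofHomAux p χ (f ≫ g) = ofHomAux p χ f * ofHomAux p χ g := by
  rw [mul_comm, ofHomAux, ofHomAux, ofHomAux, ← map_mul]
  congr 1
  change _ = (_ ≫ _ : FundamentalGroupoid.mk x₀ ⟶ FundamentalGroupoid.mk x₀)
  simp [Groupoid.inv_eq_inv]

theorem ofHomAux_loop (f : FundamentalGroup X x₀) : ofHomAux p χ f = χ f := by
  let A : FundamentalGroup X x₀ := arrow (p x₀)
  let B : FundamentalGroup X x₀ := Groupoid.inv (arrow (p x₀))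
  have h1 : ofHomAux p χ f = χ (B * f * A) := rfl
  have h2 : A * B = 1 := Groupoid.inv_comp (arrow (p x₀))
  rw [h1, map_mul, map_mul, mul_comm, ← mul_assoc, ← map_mul, h2, map_one, one_mul]

theorem arrow_map_eq {Z : Type} [TopologicalSpace Z] [SimplyConnectedSpace Z] (E : C(Z, X))
    {z w : Z} (q q' : Path z w) : arrow (q.map E.continuous) = arrow (q'.map E.continuous) :=
  Quotient.sound ((SimplyConnectedSpace.paths_homotopic q q').map E)

/-- The holonomy that extends a homomorphism from the fundamental group to an abelian group. -/
def ofHom : Hol X G where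
  val c a b := ofHomAux p χ (arrow ((PathConnectedSpace.somePath a b).map c.continuous))
  plane E := by
    let s : ∀ z w, Path z w := fun z w : ℝ × ℝ => PathConnectedSpace.somePath z w
    refine ⟨fun z => ofHomAux p χ (arrow ((s 0 z).map E.continuous)), fun κ a b => ?_⟩
    rw [eq_inv_mul_iff_mul_eq, ← ofHomAux_comp]
    congr 1
    have h1 : arrow ((PathConnectedSpace.somePath a b).map (E.comp κ).continuous) =
        arrow ((s (κ a) (κ b)).map E.continuous) :=
      arrow_map_eq E ((PathConnectedSpace.somePath a b).map κ.continuous) _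
    refine (congrArg (arrow ((s 0 (κ a)).map E.continuous) ≫ ·) h1).trans ?_
    have h2 := arrow_map_eq E ((s 0 (κ a)).trans (s (κ a) (κ b))) (s 0 (κ b))
    rw [Path.map_trans] at h2
    exact h2

theorem ofHom_val_eq (c : C(ℝ, X)) {x y : X} (q : Path x y) {a b : ℝ}
    (h : ∀ t : I, c (a + t * (b - a)) = q t) :
    (ofHom p χ).val c a b = ofHomAux p χ (arrow q) := by
  obtain rfl : c a = x := by simpa using h 0
  obtain rfl : c b = y := by simpa using h 1
  let r : Path a b :=
    { toFun := fun t => a + t * (b - a)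
      continuous_toFun := by fun_prop
      source' := by simp
      target' := by simp }
  have e : r.map c.continuous = q := Path.ext (funext h)
  rw [← e]
  exact congrArg (ofHomAux p χ) (arrow_map_eq c _ _)

theorem ofHom_pi (a : FundamentalGroup X x₀) : (ofHom p χ).pi a = χ a := by
  obtain ⟨q, rfl⟩ := Quotient.exists_rep a
  refine (ofHom_val_eq p χ _ q fun t => ?_).trans (ofHomAux_loop p χ _)
  change q.extend _ = q t
  rw [sub_zero, mul_one, zero_add, Path.extend_apply _ t.2]

end Hol

/-- If the fundamental group has rank at least three, then a gluing scheme with one vertex has at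
least three edges: homomorphisms to `ℤ / 2` are determined by their values on the edges. -/
theorem PolygonScheme.exists_third_edge {P : PolygonScheme} [PathConnectedSpace P.Surface] {n : ℕ}
    (hP : ∀ h h', P.rot.SameCycle h h') (t : Marking n P.Surface) (hn : 3 ≤ n) (a b : P.side) :
    ∃ c : P.side, c ≠ a ∧ c ≠ P.inv a ∧ c ≠ b ∧ c ≠ P.inv b := by
  by_contra hc
  push Not at hc
  -- If there are only the edges `a` and `b`, then the `2 ^ n` homomorphisms from the fundamental
  -- group to `ℤ / 2` are determined by two values each.
  let A := Multiplicative (ZMod 2)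
  let p : ∀ x, Path t.base x := fun x => PathConnectedSpace.somePath _ _
  let χ : (Fin n → A) → (FundamentalGroup P.Surface t.base →* A) := fun ε =>
    (FreeGroup.lift ε).comp t.iso.symm.toMonoidHom
  let ρ : (Fin n → A) → Hol P.Surface A := fun ε => Hol.ofHom p (χ ε)
  let J : (Fin n → A) → A × A := fun ε => (P.hol (ρ ε) a, P.hol (ρ ε) b)
  have hχ : ∀ ε ε', χ (ε * ε') = χ ε * χ ε' := by
    intro ε ε'
    have : FreeGroup.lift (ε * ε') = FreeGroup.lift ε * FreeGroup.lift ε' :=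
      FreeGroup.ext_hom _ _ fun i => by simp
    ext w
    exact DFunLike.congr_fun this (t.iso.symm w)
  have hmul : ∀ ε ε' h, P.hol (ρ (ε * ε')) h = P.hol (ρ ε) h * P.hol (ρ ε') h := by
    intro ε ε' h
    change (Hol.ofHom p (χ (ε * ε'))).val _ _ _ = _
    rw [hχ]
    rfl
  have hsq : ∀ x y : A, x * y = 1 → x = y := by decide
  have hJ : Function.Injective J := by
    intro ε ε' h
    have ha : P.hol (ρ ε) a = P.hol (ρ ε') a := congrArg Prod.fst h
    have hb : P.hol (ρ ε) b = P.hol (ρ ε') b := congrArg Prod.snd h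
    have hsq' : ∀ x : A, x * x = 1 := by decide
    have ha' : P.hol (ρ (ε * ε')) a = 1 := by rw [hmul, ha, hsq']
    have hb' : P.hol (ρ (ε * ε')) b = 1 := by rw [hmul, hb, hsq']
    have h1 : ∀ h, P.hol (ρ (ε * ε')) h = 1 := by
      intro h
      by_cases h1 : h = a
      · rw [h1, ha']
      by_cases h2 : h = P.inv a
      · rw [h2, P.hol_inv, ha', inv_one]
      by_cases h3 : h = b
      · rw [h3, hb']
      · rw [hc h h1 h2 h3, P.hol_inv, hb', inv_one]
    funext i
    refine hsq _ _ ?_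
    have h2 : (ρ (ε * ε')).pi (t.iso (FreeGroup.of i)) = 1 := by
      obtain ⟨q, hq⟩ := Quotient.exists_rep (t.iso (FreeGroup.of i))
      rw [← hq]
      exact val_loop_eq_one _ hP h1 (Hol.curve q) (by simp [Hol.curve])
    rw [Hol.ofHom_pi] at h2
    simpa [χ] using h2
  have := Nat.card_le_card_of_injective J hJ
  simp only [A, Nat.card_prod, Nat.card_fun,
    Nat.card_eq_fintype_card (α := Multiplicative (ZMod 2)),
    Fintype.card_multiplicative, ZMod.card, Nat.card_eq_fintype_card (α := Fin n),
    Fintype.card_fin] at this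
  have h8 : 2 ^ 3 ≤ 2 ^ n := Nat.pow_le_pow_right (by norm_num) hn
  omega

/-! ### Cyclic orders as lists, and slides along them -/

section lists

variable {α : Type*} [DecidableEq α]

/-- Moving the element `e` from before `f` to after `g` in a cyclic order. -/
theorem formPerm_move {e f g : α} {Z A : List α} (h : (g :: (Z ++ [e]) ++ f :: A).Nodup) :
    (g :: e :: Z ++ f :: A).formPerm =
      Equiv.swap e f * (g :: (Z ++ [e]) ++ f :: A).formPerm * Equiv.swap e g := by
  have r1 : g :: (Z ++ [e]) ++ f :: A ~r e :: f :: (A ++ g :: Z) := ⟨(g :: Z).length, by simp⟩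
  have r2 : f :: (A ++ g :: Z) ~r Z ++ f :: A ++ [g] :=
    ⟨(f :: (A ++ [g])).length, by
      simpa using List.rotate_append_length_eq (f :: (A ++ [g])) Z⟩
  have r3 : g :: e :: Z ++ f :: A ~r Z ++ f :: A ++ [g, e] := ⟨2, by simp⟩
  have p3 : (g :: (Z ++ [e]) ++ f :: A).Perm (g :: e :: Z ++ f :: A) := by
    simp only [List.cons_append, List.append_assoc]
    exact List.Perm.cons _ List.perm_middle
  have n1 : (e :: f :: (A ++ g :: Z)).Nodup := r1.nodup_iff.1 h
  rw [List.formPerm_eq_of_isRotated h r1, List.formPerm_cons_cons, ← mul_assoc, Equiv.swap_mul_self,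
    one_mul, List.formPerm_eq_of_isRotated n1.of_cons r2,
    List.formPerm_eq_of_isRotated (p3.nodup_iff.1 h) r3, List.formPerm_append_pair,
    Equiv.swap_comm g e]

/-- A cyclic permutation as a list that starts with a given element. -/
theorem exists_formPerm_eq [Finite α] {r : Equiv.Perm α} (hr : ∀ x y, r.SameCycle x y) {x y : α}
    (hxy : x ≠ y) : ∃ l : List α, (x :: l).Nodup ∧ (∀ z, z ∈ x :: l) ∧ r = (x :: l).formPerm := by
  have := Fintype.ofFinite α
  have hx : x ∈ r.support := by
    rw [Equiv.Perm.mem_support]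
    intro h
    obtain ⟨k, hk⟩ := hr x y
    exact hxy ((Equiv.Perm.zpow_apply_eq_self_of_apply_eq_self h k).symm.trans hk)
  have hf : (r.toList x).formPerm = r := by
    rw [Equiv.Perm.formPerm_toList]
    ext z
    rw [(hr x z).cycleOf_apply]
  have h0 := Equiv.Perm.toList_getElem_zero r x hx
  have hm : ∀ z, z ∈ r.toList x := fun z => Equiv.Perm.mem_toList_iff.2 ⟨hr x z, hx⟩
  have hn := Equiv.Perm.nodup_toList r x
  rcases e : r.toList x with _ | ⟨x', l⟩
  · exact absurd (hm x) (by simp [e])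
  · simp only [e, List.getElem_cons_zero] at h0
    subst h0
    rw [e] at hn hf hm
    exact ⟨l, hn, hm, hf.symm⟩

end lists

namespace PolygonScheme

variable (P : PolygonScheme)

/-- The scheme with the same sides, glued in the same way, whose rotation is `r`. -/
abbrev withRot (r : Equiv.Perm P.side) : PolygonScheme :=
  P.withNext ((Function.Involutive.toPerm P.inv P.inv_inv).trans r)

theorem withRot_rot (r : Equiv.Perm P.side) : (P.withRot r).rot = r := by
  ext h
  change r (P.inv (P.inv h)) = r h
  rw [P.inv_inv]

theorem withRot_eq {r : Equiv.Perm P.side} (h : P.rot = r) : P.withRot r = P := by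
  subst h
  have : (Function.Involutive.toPerm P.inv P.inv_inv).trans P.rot = P.next := by
    ext h
    change P.next (P.inv (P.inv h)) = _
    rw [P.inv_inv]
  rw [withRot, withNext, this]

open Classical in
/-- The correction at the origin of `h` when the origins of the half-edges in `Z` are dragged along
a loop with holonomy `x`. -/
def dragFactor {H G : Type*} [Group G] (Z : Set H) (x : G) (h : H) : G :=
  if h ∈ Z then x else 1

theorem dragFactor_of_mem {H G : Type*} [Group G] {Z : Set H} (x : G) {h : H} (hh : h ∈ Z) :
    dragFactor Z x h = x := if_pos hh

theorem dragFactor_of_notMem {H G : Type*} [Group G] {Z : Set H} (x : G) {h : H} (hh : h ∉ Z) :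
    dragFactor Z x h = 1 := if_neg hh

/-- `T` is a homeomorphism from the surface with rotation `r'` to the surface with rotation `r` that
drags the origins of the half-edges in `Z` backwards `k` times along the loop `f`, on the level of
holonomies. -/
def IsDrag {r r' : Equiv.Perm P.side} (T : (P.withRot r').Surface ≃ₜ (P.withRot r).Surface)
    (f : P.side) (k : ℕ) (Z : Set P.side) : Prop :=
  ∀ (G : Type) [Group G] (ρ : Hol (P.withRot r).Surface G) (h : P.side),
    (P.withRot r').hol (ρ.comap (T : C(_, (P.withRot r).Surface))) h =
      (dragFactor Z ((P.withRot r).hol ρ f ^ k) h)⁻¹ * (P.withRot r).hol ρ h *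
        dragFactor Z ((P.withRot r).hol ρ f ^ k) (P.inv h)

variable {P}

theorem exists_drag_refl {r r' : Equiv.Perm P.side} (h : r' = r) (f : P.side) :
    ∃ T : (P.withRot r').Surface ≃ₜ (P.withRot r).Surface, P.IsDrag T f 1 ∅ := by
  subst h
  refine ⟨.refl _, fun G _ ρ h => ?_⟩
  rw [dragFactor_of_notMem _ (Set.notMem_empty _), dragFactor_of_notMem _ (Set.notMem_empty _),
    inv_one, one_mul, mul_one]
  rfl

theorem IsDrag.trans_union {r r' r'' : Equiv.Perm P.side}
    {T : (P.withRot r').Surface ≃ₜ (P.withRot r).Surface}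
    {T' : (P.withRot r'').Surface ≃ₜ (P.withRot r').Surface} {f : P.side} {k : ℕ}
    {Z Z' : Set P.side}
    (hT : P.IsDrag T f k Z) (hT' : P.IsDrag T' f k Z') (hf : f ∉ Z) (hf' : P.inv f ∉ Z)
    (hZ : ∀ h ∈ Z, h ∉ Z') : P.IsDrag (T'.trans T) f k (Z ∪ Z') := by
  intro G _ ρ h
  have h1 := hT' G (ρ.comap (T : C(_, (P.withRot r).Surface))) h
  rw [hT, hT, dragFactor_of_notMem _ hf, dragFactor_of_notMem _ hf', inv_one, one_mul,
    mul_one] at h1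
  have key : ∀ (x : G) h, dragFactor (Z ∪ Z') x h = dragFactor Z x h * dragFactor Z' x h := by
    intro x h
    by_cases h1 : h ∈ Z
    · rw [dragFactor_of_mem _ h1, dragFactor_of_notMem _ (hZ h h1), mul_one,
        dragFactor_of_mem _ (Set.mem_union_left Z' h1)]
    · rw [dragFactor_of_notMem _ h1, one_mul]
      by_cases h2 : h ∈ Z'
      · rw [dragFactor_of_mem _ h2, dragFactor_of_mem _ (Set.mem_union_right Z h2)]
      · rw [dragFactor_of_notMem _ h2,
          dragFactor_of_notMem (Z := Z ∪ Z') _ (fun h' => h'.elim h1 h2)]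
  refine h1.trans ?_
  rw [key, key]
  group

theorem IsDrag.trans_add {r : Equiv.Perm P.side}
    {T T' : (P.withRot r).Surface ≃ₜ (P.withRot r).Surface} {f : P.side} {k k' : ℕ} {Z : Set P.side}
    (hT : P.IsDrag T f k Z) (hT' : P.IsDrag T' f k' Z) (hf : f ∉ Z) (hf' : P.inv f ∉ Z) :
    P.IsDrag (T'.trans T) f (k + k') Z := by
  intro G _ ρ h
  have h1 := hT' G (ρ.comap (T : C(_, (P.withRot r).Surface))) h
  rw [hT, hT, dragFactor_of_notMem _ hf, dragFactor_of_notMem _ hf', inv_one, one_mul,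
    mul_one] at h1
  have key : ∀ (x : G) h, dragFactor Z (x ^ (k + k')) h =
      dragFactor Z (x ^ k) h * dragFactor Z (x ^ k') h := by
    intro x h
    by_cases h1 : h ∈ Z
    · rw [dragFactor_of_mem _ h1, dragFactor_of_mem _ h1, dragFactor_of_mem _ h1, pow_add]
    · rw [dragFactor_of_notMem _ h1, dragFactor_of_notMem _ h1, dragFactor_of_notMem _ h1, one_mul]
  refine h1.trans ?_
  rw [key, key]
  group

variable [DecidableEq P.side]

/-- The slide of the half-edge `e` over the half-edge `f` following it. -/
theorem exists_drag_single {r : Equiv.Perm P.side} {e f : P.side} (hf : r e = f)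
    (fi : f ≠ P.inv e) (fe : f ≠ e) {r' : Equiv.Perm P.side}
    (hr' : r' = Equiv.swap e f * r * Equiv.swap e (P.inv f)) :
    ∃ T : (P.withRot r').Surface ≃ₜ (P.withRot r).Surface, P.IsDrag T f 1 {e} := by
  have hf' : (P.withRot r).next ((P.withRot r).inv e) = f := by
    change r (P.inv (P.inv e)) = f
    rw [P.inv_inv, hf]
  have key : ∀ ν : Equiv.Perm P.side, ν = slidePerm P.inv (P.withRot r).next e f →
      ∃ T : (P.withNext ν).Surface ≃ₜ (P.withRot r).Surface,
      ∀ (G : Type) [Group G] (ρ : Hol (P.withRot r).Surface G),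
        (P.withNext ν).hol (ρ.comap (T : C(_, (P.withRot r).Surface))) e =
          ((P.withRot r).hol ρ f)⁻¹ * (P.withRot r).hol ρ e ∧
        ∀ h, h ≠ P.inv e → h ≠ e →
          (P.withNext ν).hol (ρ.comap (T : C(_, (P.withRot r).Surface))) h =
            (P.withRot r).hol ρ h := by
    rintro _ rfl
    exact ⟨(P.withRot r).slideHomeo hf' fi fe, fun G _ ρ =>
      ⟨(P.withRot r).slide_hol_self ρ hf' fi fe,
        fun h h1 h2 => (P.withRot r).slide_hol_of_ne ρ hf' fi fe h1 h2⟩⟩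
  obtain ⟨T, hT⟩ := key ((Function.Involutive.toPerm P.inv P.inv_inv).trans r') (by
    ext h
    have := slide_rot (P := P.withRot r) e f (P.inv h)
    rw [withRot_rot] at this
    change (slidePerm P.inv (P.withRot r).next e f) (P.inv (P.inv h)) = _ at this
    rw [P.inv_inv] at this
    rw [this, hr']
    rfl)
  refine ⟨T, fun G _ ρ h => ?_⟩
  by_cases h1 : h = e
  · subst h1
    rw [dragFactor_of_mem _ (Set.mem_singleton h),
      dragFactor_of_notMem (Z := {h}) _ (P.inv_ne h), mul_one, pow_one]
    exact (hT G ρ).1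
  by_cases h2 : h = P.inv e
  · subst h2
    rw [dragFactor_of_notMem (Z := {e}) _ h1, P.inv_inv, dragFactor_of_mem _ (Set.mem_singleton e),
      inv_one, one_mul, pow_one]
    refine ((P.withRot r').hol_inv _ e).trans ?_
    rw [(P.withRot r).hol_inv ρ e]
    refine (congrArg _ (hT G ρ).1).trans ?_
    rw [mul_inv_rev, _root_.inv_inv]
  · rw [dragFactor_of_notMem (Z := {e}) _ h1, dragFactor_of_notMem _
      (show P.inv h ∉ ({e} : Set P.side) from fun h' => h2 (by rw [← show P.inv h = e from h',
        P.inv_inv])), inv_one, one_mul, mul_one]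
    exact (hT G ρ).2 h h2 h1

/-- The half-edges in a block `Z` between the two half-edges of the loop `f` can be dragged along
that loop, one after the other. -/
theorem exists_drag {f : P.side} {A : List P.side} (Z : List P.side) : ∀ (W : List P.side),
    (P.inv f :: (W ++ Z) ++ f :: A).Nodup →
    ∃ T : (P.withRot (P.inv f :: (Z ++ W) ++ f :: A).formPerm).Surface ≃ₜ
      (P.withRot (P.inv f :: (W ++ Z) ++ f :: A).formPerm).Surface, P.IsDrag T f 1 {h | h ∈ Z} := by
  induction Z using List.reverseRecOn with
  | nil =>
    intro W _
    obtain ⟨T, hT⟩ := exists_drag_refl (P := P) (r := (P.inv f :: (W ++ []) ++ f :: A).formPerm)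
      (r' := (P.inv f :: ([] ++ W) ++ f :: A).formPerm) (by simp) f
    refine ⟨T, ?_⟩
    have : {h : P.side | h ∈ ([] : List P.side)} = ∅ := by ext; simp
    rwa [this]
  | append_singleton Z e ih =>
    intro W hn
    have e1 : W ++ (Z ++ [e]) = (W ++ Z) ++ [e] := (List.append_assoc _ _ _).symm
    have e2 : (Z ++ [e]) ++ W = Z ++ e :: W := by simp
    rw [e1] at hn ⊢
    rw [e2]
    have hmove := formPerm_move hn
    have p : (P.inv f :: (W ++ Z ++ [e]) ++ f :: A).Perm (P.inv f :: (e :: W ++ Z) ++ f :: A) := by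
      simp only [List.cons_append, List.append_assoc]
      refine List.Perm.cons _ ?_
      rw [← List.append_assoc]
      refine (List.perm_middle).trans ?_
      simp
    have hn' := p.nodup_iff.1 hn
    have hre : (P.inv f :: (W ++ Z ++ [e]) ++ f :: A).formPerm e = f := by
      have r1 : P.inv f :: (W ++ Z ++ [e]) ++ f :: A ~r e :: f :: (A ++ P.inv f :: (W ++ Z)) :=
        ⟨(P.inv f :: (W ++ Z)).length, by
          simpa using List.rotate_append_length_eq (P.inv f :: (W ++ Z)) (e :: f :: A)⟩
      rw [List.formPerm_eq_of_isRotated hn r1]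
      exact List.formPerm_apply_head _ _ _ (r1.nodup_iff.1 hn)
    have m1 : e ≠ f ∧ e ≠ P.inv f ∧ e ∉ Z := by
      simp only [List.cons_append, List.nodup_cons, List.nodup_append, List.mem_append,
        List.mem_cons] at hn'
      grind
    obtain ⟨T, hT⟩ := exists_drag_single hre
      (fun h => m1.2.1 (by rw [h, P.inv_inv])) m1.1.symm hmove
    obtain ⟨T', hT'⟩ := ih (e :: W) hn'
    refine ⟨T'.trans T, ?_⟩
    have h1 := hT.trans_union hT' (fun h => m1.1 h.symm) (fun h => m1.2.1 h.symm)
      (fun h hh => by rw [show h = e from hh]; exact m1.2.2)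
    have h2 : {h | h ∈ Z ++ [e]} = ({e} : Set P.side) ∪ {h | h ∈ Z} := by
      ext h
      simp [or_comm]
    rw [h2]
    exact h1

/-- Dragging the whole block `Z` around the loop `f` brings the cyclic order back to itself: this is
a twist. Its powers drag the block around several times. -/
theorem exists_twist {f : P.side} {Z A : List P.side} (hn : (P.inv f :: Z ++ f :: A).Nodup)
    (k : ℕ) : ∃ T : (P.withRot (P.inv f :: Z ++ f :: A).formPerm).Surface ≃ₜ
      (P.withRot (P.inv f :: Z ++ f :: A).formPerm).Surface, P.IsDrag T f k {h | h ∈ Z} := by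
  have hf : f ∉ Z ∧ P.inv f ∉ Z := by
    simp only [List.cons_append, List.nodup_cons, List.nodup_append, List.mem_append,
      List.mem_cons] at hn
    grind
  have h1 := exists_drag (P := P) (f := f) (A := A) Z [] hn
  rw [List.append_nil, List.nil_append] at h1
  obtain ⟨T₁, h1⟩ := h1
  induction k with
  | zero =>
    refine ⟨.refl _, fun G _ ρ h => ?_⟩
    have key : ∀ (x : G) h, dragFactor {h | h ∈ Z} (x ^ 0) h = 1 := fun x h => by
      rw [pow_zero, dragFactor, ite_self]
    rw [key, key, inv_one, one_mul, mul_one]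
    rfl
  | succ k ih =>
    obtain ⟨T, hT⟩ := ih
    exact ⟨T₁.trans T, hT.trans_add h1 hf.1 hf.2⟩

/-- A cyclic order of all half-edges in which both blocks between the half-edges of `f` are
nonempty. -/
structure IsBlockOrder (f : P.side) (Z A : List P.side) : Prop where
  nodup : (P.inv f :: Z ++ f :: A).Nodup
  mem : ∀ h, h ∈ P.inv f :: Z ++ f :: A
  left_ne : Z ≠ []
  right_ne : A ≠ []

/-- A surface with one vertex and at least three edges has a block order, perhaps after a slide. -/
theorem exists_blockOrder (hP : ∀ h h', P.rot.SameCycle h h')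
    (h3 : ∀ a b : P.side, ∃ c, c ≠ a ∧ c ≠ P.inv a ∧ c ≠ b ∧ c ≠ P.inv b) (b₀ : P.side) :
    ∃ f Z A, P.IsBlockOrder f Z A ∧
      Nonempty ((P.withRot (P.inv f :: Z ++ f :: A).formPerm).Surface ≃ₜ P.Surface) := by
  have := P.finSide
  -- Any cyclic order given by the rotation will do.
  have good : ∀ (L : List P.side), L.Nodup → (∀ h, h ∈ L) → P.rot = L.formPerm →
      ∀ f Z A, Z ≠ [] → A ≠ [] → L ~r P.inv f :: Z ++ f :: A → ∃ f Z A, P.IsBlockOrder f Z A ∧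
        Nonempty ((P.withRot (P.inv f :: Z ++ f :: A).formPerm).Surface ≃ₜ P.Surface) := by
    intro L hn hm hL f Z A hZ hA hr
    refine ⟨f, Z, A, ⟨hr.nodup_iff.1 hn, fun h => hr.mem_iff.1 (hm h), hZ, hA⟩, ?_⟩
    rw [P.withRot_eq (hL.trans (List.formPerm_eq_of_isRotated hn hr))]
    exact ⟨.refl _⟩
  -- Otherwise the half-edges of each edge are adjacent. Start with the half-edges of one edge.
  have adj : (∃ f Z A, P.IsBlockOrder f Z A ∧
      Nonempty ((P.withRot (P.inv f :: Z ++ f :: A).formPerm).Surface ≃ₜ P.Surface)) ∨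
      ∃ b A, (P.inv b :: b :: A).Nodup ∧ (∀ h, h ∈ P.inv b :: b :: A) ∧
        P.rot = (P.inv b :: b :: A).formPerm := by
    obtain ⟨M, hn, hm, hM⟩ := exists_formPerm_eq hP (P.inv_ne b₀)
    obtain ⟨Z, A, rfl⟩ := List.append_of_mem
      ((List.mem_cons.1 (hm b₀)).resolve_left (P.inv_ne b₀).symm)
    by_cases hA : A = []
    · subst hA
      have hr : P.inv b₀ :: (Z ++ [b₀]) ~r P.inv (P.inv b₀) :: P.inv b₀ :: Z :=
        ⟨(P.inv b₀ :: Z).length, by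
          rw [P.inv_inv]
          simp⟩
      exact .inr ⟨P.inv b₀, Z, hr.nodup_iff.1 hn, fun h => hr.mem_iff.1 (hm h),
        hM.trans (List.formPerm_eq_of_isRotated hn hr)⟩
    by_cases hZ : Z = []
    · subst hZ
      exact .inr ⟨b₀, A, hn, hm, hM⟩
    · exact .inl (good _ hn hm hM b₀ Z A hZ hA (.refl _))
  obtain h | ⟨b, A, hn, hm, hA⟩ := adj
  · exact h
  obtain ⟨x, h1, h2, -, -⟩ := h3 b b
  rcases A with _ | ⟨e, A⟩
  · have := hm x
    simp [h1, h2] at this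
  have he := P.inv_ne e
  have heb : P.inv e ≠ P.inv b := fun h => by
    have : e = b := by rw [← P.inv_inv e, h, P.inv_inv]
    simp [this] at hn
  have heb' : P.inv e ≠ b := fun h => by
    have : e = P.inv b := by rw [← h, P.inv_inv]
    simp [this] at hn
  have hmem : P.inv e ∈ A := by
    have := hm (P.inv e)
    simpa [he, heb, heb'] using this
  obtain ⟨U, V, rfl⟩ := List.append_of_mem hmem
  by_cases hU : U = []
  · subst hU
    rw [List.nil_append] at hn hm hA
    have hV : V ≠ [] := by
      rintro rfl
      obtain ⟨y, h1, h2, h3, h4⟩ := h3 b e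
      have := hm y
      simp [h1, h2, h3, h4] at this
    -- Slide `b` over the edge of `e`.
    have hr : P.inv b :: b :: e :: P.inv e :: V ~r
        P.inv e :: (V ++ [P.inv b] ++ [b]) ++ e :: [] :=
      ⟨3, by simp⟩
    have hn' := hr.nodup_iff.1 hn
    have hmove := formPerm_move hn'
    have hr' : P.inv e :: b :: (V ++ [P.inv b]) ++ e :: [] ~r
        P.inv b :: [e, P.inv e] ++ b :: V :=
      ⟨(P.inv e :: b :: V).length, by
        simp⟩
    have p : (P.inv b :: b :: e :: P.inv e :: V).Perm (P.inv b :: [e, P.inv e] ++ b :: V) := by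
      simp only [List.cons_append, List.nil_append]
      refine List.Perm.cons _ ?_
      exact (List.perm_middle (l₁ := [e, P.inv e]) (l₂ := V) (a := b)).symm
    have hnew := p.nodup_iff.1 hn
    refine ⟨b, [e, P.inv e], V, ⟨hnew, fun h => p.mem_iff.1 (hm h), by simp, hV⟩, ?_⟩
    have hrot : (P.inv b :: b :: e :: P.inv e :: V).formPerm b = e := by
      have r1 : P.inv b :: b :: e :: P.inv e :: V ~r b :: e :: (P.inv e :: V ++ [P.inv b]) :=
        ⟨1, by simp⟩
      rw [List.formPerm_eq_of_isRotated hn r1]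
      exact List.formPerm_apply_head _ _ _ (r1.nodup_iff.1 hn)
    rw [← List.formPerm_eq_of_isRotated (hr'.nodup_iff.2 hnew) hr', hmove,
      ← List.formPerm_eq_of_isRotated hn hr]
    have hee : e ≠ b := fun h => by simp [h] at hn
    have hee' : e ≠ P.inv b := fun h => by simp [h] at hn
    obtain ⟨T, -⟩ := exists_drag_single (P := P) hrot hee' hee rfl
    obtain ⟨T'⟩ : Nonempty
        ((P.withRot (P.inv b :: b :: e :: P.inv e :: V).formPerm).Surface ≃ₜ P.Surface) := by
      rw [P.withRot_eq hA]
      exact ⟨.refl _⟩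
    exact ⟨T.trans T'⟩
  · refine good _ hn hm hA (P.inv e) U (V ++ [P.inv b, b]) hU (by simp) ⟨2, ?_⟩
    simp [P.inv_inv]

end PolygonScheme

/-! ### Boundary curves and punctures -/

namespace PolygonScheme

variable (P : PolygonScheme)

/-- The number of sides of the polygon of the side `a`. -/
def len (a : P.side) : ℕ := Function.minimalPeriod P.next a

theorem len_pos (a : P.side) : 0 < P.len a := by
  have := P.finSide
  exact Function.minimalPeriod_pos_of_mem_periodicPts
    (Function.Injective.mem_periodicPts P.next.injective a)

theorem zpow_apply_eq_self_iff (a : P.side) (k : ℤ) : (P.next ^ k) a = a ↔ (P.len a : ℤ) ∣ k :=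
  MulAction.zpow_smul_eq_iff_minimalPeriod_dvd (a := P.next) (b := a)

theorem zpow_apply_eq_iff (a : P.side) (k m : ℤ) :
    (P.next ^ k) a = (P.next ^ m) a ↔ (P.len a : ℤ) ∣ k - m := by
  rw [← zpow_apply_eq_self_iff, sub_eq_neg_add, zpow_add, Equiv.Perm.mul_apply, zpow_neg,
    Equiv.Perm.inv_eq_iff_eq]

/-- The universal cover of the closed polygon of the side `a`, a half plane, mapped to the
surface. -/
def unrollFun (a : P.side) (z : ℝ × ℝ) : P.Surface :=
  P.rpt ((P.next ^ ⌊z.1⌋) a) (Int.fract z.1) z.2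

theorem unrollFun_eq (a : P.side) (k : ℤ) {x : ℝ} (h0 : k ≤ x) (h1 : x ≤ k + 1) (y : ℝ) :
    P.unrollFun a (x, y) = P.rpt ((P.next ^ k) a) (x - k) y := by
  rcases h1.eq_or_lt with rfl | h1
  · have h2 : ⌊(k : ℝ) + 1⌋ = k + 1 := by
      rw [Int.floor_add_one, Int.floor_intCast]
    rw [unrollFun, h2, add_sub_cancel_left, P.rpt_strip, ← Equiv.Perm.mul_apply, ← zpow_one_add,
      add_comm 1 k]
    simp
  · have h2 : ⌊x⌋ = k := Int.floor_eq_iff.2 ⟨h0, h1⟩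
    rw [unrollFun, h2, Int.fract, h2]

theorem continuous_unrollFun (a : P.side) : Continuous (P.unrollFun a) := by
  have key : ∀ k : ℤ, ContinuousOn (P.unrollFun a) (Set.Icc (k : ℝ) (k + 1) ×ˢ Set.univ) := by
    intro k
    refine (((P.continuous_rpt ((P.next ^ k) a)).comp (f := fun z : ℝ × ℝ => (z.1 - k, z.2))
      (by fun_prop)).continuousOn).congr ?_
    rintro ⟨x, y⟩ ⟨⟨h0, h1⟩, -⟩
    exact P.unrollFun_eq a k h0 h1 y
  have hcl : ∀ k : ℤ, IsClosed (Set.Icc (k : ℝ) (k + 1) ×ˢ (Set.univ : Set ℝ)) := fun k =>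
    isClosed_Icc.prod isClosed_univ
  rw [continuous_iff_continuousAt]
  rintro ⟨x, y⟩
  refine ((key (⌊x⌋ - 1)).union_of_isClosed (key ⌊x⌋) (hcl _) (hcl _)).continuousAt ?_
  have h1 : Set.Ioo ((⌊x⌋ : ℝ) - 1) (⌊x⌋ + 1) ×ˢ (Set.univ : Set ℝ) ∈ nhds (x, y) :=
    (isOpen_Ioo.prod isOpen_univ).mem_nhds
      ⟨⟨by linarith [Int.floor_le x], Int.lt_floor_add_one x⟩, trivial⟩
  filter_upwards [h1]
  rintro ⟨x', y'⟩ ⟨⟨h0, h1⟩, -⟩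
  simp only at h0 h1
  rcases le_total x' ⌊x⌋ with h | h
  · exact .inl ⟨⟨by push_cast; linarith, by push_cast; linarith⟩, trivial⟩
  · exact .inr ⟨⟨h, h1.le⟩, trivial⟩

/-- The universal cover of the closed polygon of the side `a`, as a map from the plane that is
constant in the vertical direction below the boundary. -/
def unroll (a : P.side) : C(ℝ × ℝ, P.Surface) := ⟨P.unrollFun a, P.continuous_unrollFun a⟩

theorem unroll_add (a : P.side) (k : ℤ) (x y : ℝ) :
    P.unroll a (x + k * P.len a, y) = P.unroll a (x, y) := by
  have h1 : ⌊x + k * P.len a⌋ = ⌊x⌋ + k * P.len a := by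
    have := Int.floor_add_intCast x (k * P.len a)
    push_cast at this
    exact this
  have h2 : Int.fract (x + k * P.len a) = Int.fract x := by
    rw [Int.fract, h1, Int.fract]
    push_cast
    ring
  change P.rpt _ _ _ = P.rpt _ _ _
  simp only
  rw [h1, h2]
  congr 1
  rw [zpow_apply_eq_iff]
  simp

variable {G : Type*} [Group G]

/-- The holonomy along the boundary of the polygon of the side `a`. -/
def boundaryHol (ρ : Hol P.Surface G) (a : P.side) : G :=
  ρ.val ((P.unroll a).comp ⟨fun t => (t, 0), by fun_prop⟩) 0 (P.len a)

/-- A closed curve in a closed polygon is freely homotopic to a multiple of the boundary, so that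
the holonomies are conjugate. -/
theorem isConj_boundaryHol_zpow (ρ : Hol P.Surface G) (a : P.side) (κ : C(ℝ, ℝ × ℝ)) {s t : ℝ}
    (j : ℤ) (h1 : (κ t).1 = (κ s).1 + j * P.len a) (h2 : (κ t).2 = (κ s).2) :
    IsConj (ρ.val ((P.unroll a).comp κ) s t) (P.boundaryHol ρ a ^ j) := by
  obtain ⟨u, hu⟩ := ρ.plane (P.unroll a)
  -- The potential changes by a constant factor under deck transformations.
  have shift : ∀ z w : ℝ × ℝ,
      (u z)⁻¹ * u w = (u (z.1 + P.len a, z.2))⁻¹ * u (w.1 + P.len a, w.2) := by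
    intro z w
    let c : C(ℝ, ℝ × ℝ) := ⟨fun t => (z.1 + t * (w.1 - z.1), z.2 + t * (w.2 - z.2)), by fun_prop⟩
    let c' : C(ℝ, ℝ × ℝ) := ⟨fun t => ((c t).1 + P.len a, (c t).2), by fun_prop⟩
    have e : (P.unroll a).comp c = (P.unroll a).comp c' := by
      ext t
      have := P.unroll_add a 1 (c t).1 (c t).2
      rw [Int.cast_one, one_mul] at this
      exact this.symm
    have e1 := hu c 0 1
    rw [e, hu] at e1
    simpa [c, c'] using e1.symm
  let m : G := u (P.len a, 0) * (u (0, 0))⁻¹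
  have hm : ∀ x y, u (x + P.len a, y) = m * u (x, y) := by
    intro x y
    have := shift (0, 0) (x, y)
    simp only [zero_add] at this
    simp only [m]
    rw [mul_assoc, this, mul_inv_cancel_left]
  have hmj : ∀ (j : ℤ) x y, u (x + j * P.len a, y) = m ^ j * u (x, y) := by
    intro j
    induction j using Int.induction_on with
    | zero => simp
    | succ i ih =>
      intro x y
      have : x + ((i + 1 : ℤ) : ℝ) * P.len a = (x + (i : ℤ) * P.len a) + P.len a := by
        push_cast
        ring
      rw [this, hm, ih, ← mul_assoc, ← zpow_one_add, add_comm 1 (i : ℤ)]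
    | pred i ih =>
      intro x y
      have := hm (x + ((-i - 1 : ℤ) : ℝ) * P.len a) y
      have e : x + ((-i - 1 : ℤ) : ℝ) * P.len a + P.len a = x + ((-i : ℤ) : ℝ) * P.len a := by
        push_cast
        ring
      rw [e, ih] at this
      rw [← inv_mul_eq_iff_eq_mul] at this
      rw [← this, ← mul_assoc, ← zpow_neg_one, ← zpow_add]
      congr 2
      ring
  have hD : P.boundaryHol ρ a = (u (0, 0))⁻¹ * m * u (0, 0) := by
    rw [boundaryHol, hu]
    simp [m, mul_assoc]
  have hv : ρ.val ((P.unroll a).comp κ) s t = (u (κ s))⁻¹ * m ^ j * u (κ s) := by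
    rw [hu, show κ t = ((κ s).1 + j * P.len a, (κ s).2) from Prod.ext h1 h2, hmj, mul_assoc]
  have hc : ∀ x y : G, IsConj (x⁻¹ * y * x) y := fun x y =>
    isConj_iff.2 ⟨x, by group⟩
  rw [hv, hD]
  have h3 : ((u (0, 0))⁻¹ * m * u (0, 0)) ^ j = (u (0, 0))⁻¹ * m ^ j * u (0, 0) := by
    have := (conj_zpow (i := j) (a := (u (0, 0))⁻¹) (b := m))
    rwa [_root_.inv_inv] at this
  rw [h3]
  exact (hc _ _).trans (hc _ _).symm

theorem exp_index_congr {l : ℕ} (hl : 0 < l) {i k : ℤ} (h : (l : ℤ) ∣ i - k) :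
    Complex.exp (2 * Real.pi * Complex.I * (i / l)) =
      Complex.exp (2 * Real.pi * Complex.I * (k / l)) := by
  obtain ⟨m, hm⟩ := h
  have hi : i = k + l * m := by omega
  have hl' : (l : ℂ) ≠ 0 := by exact_mod_cast hl.ne'
  rw [Complex.exp_eq_exp_iff_exists_int]
  refine ⟨m, ?_⟩
  rw [hi]
  push_cast
  field_simp

open Classical in
/-- The position of a side in its polygon, counted from the side `b`. -/
def index (b h : P.side) : ℤ := if hh : ∃ i : ℤ, (P.next ^ i) b = h then hh.choose else 0

theorem zpow_index {b h : P.side} (hh : P.next.SameCycle b h) : (P.next ^ P.index b h) b = h := by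
  have hh' : ∃ i : ℤ, (P.next ^ i) b = h := hh
  rw [index, dif_pos hh']
  exact hh'.choose_spec

open Classical Complex in
/-- The punctured polygon of the side `b` as the punctured plane, with polar coordinates given by
the position along the boundary and the height; the rest of the surface is sent to `0`. -/
def polar (b : P.side) : C(P.Surface, ℂ) :=
  P.desc (q := fun h x y => if P.next.SameCycle b h then
      y * exp (2 * Real.pi * Complex.I * ((P.index b h + x) / P.len b)) else 0)
    { cont := fun h => by
        refine Continuous.continuousOn ?_
        split_ifs
        · fun_prop
        · exact continuous_const
      strip := fun h y _ => by
        by_cases hh : P.next.SameCycle b h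
        · have hh' : P.next.SameCycle b (P.next h) := Equiv.Perm.sameCycle_apply_right.2 hh
          rw [if_pos hh, if_pos hh']
          have key := exp_index_congr (P.len_pos b) (i := P.index b h + 1)
            (k := P.index b (P.next h)) (by
              rw [← zpow_apply_eq_iff, P.zpow_index hh', add_comm, zpow_one_add,
                Equiv.Perm.mul_apply, P.zpow_index hh])
          push_cast at key ⊢
          rw [add_zero, key]
        · have hh' : ¬ P.next.SameCycle b (P.next h) := fun h' =>
            hh (Equiv.Perm.sameCycle_apply_right.1 h')
          rw [if_neg hh, if_neg hh']
      edge := fun h x _ _ => by simp }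

open Classical Complex in
theorem polar_rpt (b h : P.side) {x y : ℝ} (h0 : 0 ≤ x) (h1 : x ≤ 1) (hy : 0 ≤ y) :
    P.polar b (P.rpt h x y) = if P.next.SameCycle b h then
      y * exp (2 * Real.pi * Complex.I * ((P.index b h + x) / P.len b)) else 0 :=
  P.desc_rpt _ h h0 h1 hy

theorem height_rpt (h : P.side) (x : ℝ) {y : ℝ} (hy : 0 ≤ y) : (P.height (P.rpt h x y) : ℝ) = y :=
  Real.coe_toNNReal y hy

theorem norm_exp_index (x y : ℝ) :
    ‖Complex.exp (2 * Real.pi * Complex.I * ((x : ℂ) / (y : ℂ)))‖ = 1 := by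
  rw [Complex.norm_exp]
  have : (2 * Real.pi * Complex.I * ((x : ℂ) / (y : ℂ))) =
      ((2 * Real.pi * (x / y) : ℝ) : ℂ) * Complex.I := by
    push_cast
    ring
  rw [this, Complex.re_ofReal_mul, Complex.I_re, mul_zero, Real.exp_zero]

/-- The norm of `polar` is the height on the punctured polygon of `b` and `0` elsewhere. This makes
the punctured polygon both open and closed above the sides. -/
theorem norm_polar (b : P.side) (p : P.Surface) :
    ‖P.polar b p‖ = P.height p ∨ P.polar b p = 0 := by
  obtain ⟨h, x, y, h0, h1, hy, rfl⟩ := P.exists_rpt p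
  rw [P.polar_rpt b h h0 h1 hy, P.height_rpt h x hy]
  split_ifs
  · left
    have := norm_exp_index (P.index b h + x) (P.len b)
    push_cast at this
    rw [norm_mul, this, mul_one, Complex.norm_real, Real.norm_of_nonneg hy]
  · exact .inr rfl

/-- A point of the punctured polygon of `b` is determined by its polar coordinates. -/
theorem eq_unroll_of_polar {b : P.side} {p : P.Surface} {w : ℂ} (hw : P.polar b p = Complex.exp w) :
    p = P.unroll b (w.im / (2 * Real.pi) * P.len b, P.height p) := by
  obtain ⟨h, x, y, h0, h1, hy, rfl⟩ := P.exists_rpt p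
  rw [P.height_rpt h x hy]
  rw [P.polar_rpt b h h0 h1 hy] at hw
  have hl : (P.len b : ℝ) ≠ 0 := by exact_mod_cast (P.len_pos b).ne'
  have hpi := Real.pi_ne_zero
  split_ifs at hw with hb
  · have hy' : (y : ℂ) ≠ 0 := by
      intro h'
      rw [h', zero_mul] at hw
      exact Complex.exp_ne_zero w hw.symm
    rw [← Complex.exp_log hy', ← Complex.exp_add, Complex.exp_eq_exp_iff_exists_int] at hw
    obtain ⟨m, hm⟩ := hw
    have him := congrArg Complex.im hm
    have e1 : (2 * Real.pi * Complex.I * ((P.index b h + x) / P.len b) : ℂ) =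
        ((2 * Real.pi * ((P.index b h + x) / P.len b) : ℝ) : ℂ) * Complex.I := by
      push_cast
      ring
    have e2 : (m * (2 * Real.pi * Complex.I) : ℂ) = ((m * (2 * Real.pi) : ℝ) : ℂ) * Complex.I := by
      push_cast
      ring
    rw [e1, e2, ← Complex.ofReal_log hy] at him
    simp only [Complex.add_im, Complex.ofReal_im, Complex.im_ofReal_mul, Complex.I_im, mul_one,
      zero_add] at him
    have hx : (P.index b h : ℝ) + x = w.im / (2 * Real.pi) * P.len b + m * P.len b := by
      field_simp at him ⊢
      linarith
    rw [← P.unroll_add b m, ← hx]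
    change _ = P.unrollFun b _
    rw [P.unrollFun_eq b (P.index b h) (by linarith) (by linarith), P.zpow_index hb,
      add_sub_cancel_left]
  · exact absurd hw.symm (Complex.exp_ne_zero w)

theorem isCompact_bottom : IsCompact {p : P.Surface | P.height p = 0} := by
  have := P.finSide
  have e : {p : P.Surface | P.height p = 0} = ⋃ h : P.side, Set.range fun x : I => P.pt h x 0 := by
    ext p
    obtain ⟨h, x, y, rfl⟩ := P.exists_pt p
    simp only [Set.mem_iUnion, Set.mem_range, Set.mem_ofPred_eq]
    constructor
    · intro h'
      have : y = 0 := h'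
      exact ⟨h, x, by rw [this]⟩
    · rintro ⟨h', x', e⟩
      rw [← e]
      rfl
  rw [e]
  exact isCompact_iUnion fun h => isCompact_range
    ((P.continuous_pt h).comp (f := fun x : I => (x, (0 : ℝ≥0))) (by fun_prop))

/-- A homeomorphism of punctured surfaces preserves the peripheral curves up to powers: far out, the
boundary curve of a polygon is mapped into a punctured polygon. -/
theorem exists_isConj_boundaryHol {P₁ P₂ : PolygonScheme} (g : P₂.Surface ≃ₜ P₁.Surface)
    (ρ : Hol P₁.Surface G) (a : P₁.side) : ∃ (b : P₂.side) (j : ℤ),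
    IsConj (P₁.boundaryHol ρ a)
      (P₂.boundaryHol (ρ.comap (g : C(P₂.Surface, P₁.Surface))) b ^ j) := by
  -- Above the height `N` there is no point of the image of the sides of `P₂`.
  obtain ⟨N, hN⟩ : ∃ N : ℝ≥0, ∀ p, P₂.height p = 0 → P₁.height (g p) < N := by
    have hc : IsCompact ((fun p => P₁.height (g p)) '' {p | P₂.height p = 0}) :=
      P₂.isCompact_bottom.image (P₁.height.continuous.comp g.continuous)
    obtain ⟨N, hN⟩ := hc.bddAbove
    exact ⟨N + 1, fun p hp => (hN ⟨p, hp, rfl⟩).trans_lt (lt_add_one N)⟩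
  let κ₁ : C(ℝ, ℝ × ℝ) := ⟨fun t => (t, N), by fun_prop⟩
  let γ : C(ℝ, P₂.Surface) := (g.symm : C(P₁.Surface, P₂.Surface)).comp ((P₁.unroll a).comp κ₁)
  have hgγ : ∀ t, g (γ t) = P₁.unroll a (t, N) := fun t => g.apply_symm_apply _
  have hpos : ∀ t, P₂.height (γ t) ≠ 0 := fun t h => by
    have h1 := hN _ h
    rw [hgγ] at h1
    have h2 : (P₁.height (P₁.unroll a (t, N)) : ℝ) = N := P₁.height_rpt _ _ N.2
    exact h1.ne (NNReal.coe_injective h2)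
  obtain ⟨b, x₀, y₀, h0, h1, hy, e⟩ := P₂.exists_rpt (γ 0)
  -- The curve stays in the punctured polygon of `b`.
  have hne : ∀ t, P₂.polar b (γ t) ≠ 0 := by
    let U : Set ℝ := {t | P₂.polar b (γ t) ≠ 0}
    have hU : IsClopen U := by
      constructor
      · have : U = {t | ‖P₂.polar b (γ t)‖ = P₂.height (γ t)} := by
          ext t
          refine ⟨fun h => (P₂.norm_polar b (γ t)).resolve_right h, fun h h' => hpos t ?_⟩
          have h : ‖P₂.polar b (γ t)‖ = P₂.height (γ t) := h
          rw [h', norm_zero] at h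
          exact NNReal.coe_injective h.symm
        rw [this]
        exact isClosed_eq (by fun_prop) (by fun_prop)
      · exact isOpen_ne_fun (by fun_prop) continuous_const
    have h0U : (0 : ℝ) ∈ U := by
      change P₂.polar b (γ 0) ≠ 0
      rw [e, P₂.polar_rpt b b h0 h1 hy, if_pos (Equiv.Perm.SameCycle.refl _ _)]
      refine mul_ne_zero (fun h => hpos 0 ?_) (Complex.exp_ne_zero _)
      refine NNReal.coe_injective ?_
      rw [e, P₂.height_rpt b x₀ hy, Complex.ofReal_eq_zero.1 h]
      rfl
    have hU' := hU.eq_univ ⟨0, h0U⟩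
    intro t
    have : t ∈ U := hU' ▸ Set.mem_univ t
    exact this
  -- Lift the curve to the universal cover of the punctured polygon.
  let f : C(ℝ, {z : ℂ // z ≠ 0}) := ⟨fun t => ⟨P₂.polar b (γ t), hne t⟩, by fun_prop⟩
  obtain ⟨L, ⟨-, hL⟩, -⟩ := Complex.isCoveringMap_exp.existsUnique_continuousMap_lifts f 0
    (Complex.log (f 0).1) (Subtype.ext (Complex.exp_log (f 0).2))
  have hL' : ∀ t, P₂.polar b (γ t) = Complex.exp (L t) := fun t =>
    (congrArg Subtype.val (congrFun hL t)).symm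
  let κ₂ : C(ℝ, ℝ × ℝ) := ⟨fun t => ((L t).im / (2 * Real.pi) * P₂.len b, P₂.height (γ t)), by
    have := Complex.continuous_im
    fun_prop⟩
  have hγ : γ = (P₂.unroll b).comp κ₂ := by
    ext t
    exact P₂.eq_unroll_of_polar (hL' t)
  have hper : γ (P₁.len a) = γ 0 := by
    have := P₁.unroll_add a 1 0 N
    rw [Int.cast_one, one_mul, zero_add] at this
    exact congrArg g.symm this
  have hexp : Complex.exp (L (P₁.len a)) = Complex.exp (L 0) := by
    rw [← hL', ← hL', hper]
  obtain ⟨j, hj⟩ := Complex.exp_eq_exp_iff_exists_int.1 hexp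
  refine ⟨b, j, ?_⟩
  have c1 := P₁.isConj_boundaryHol_zpow ρ a κ₁ (s := 0) (t := P₁.len a) 1 (by simp [κ₁]) rfl
  rw [zpow_one] at c1
  have c2 := P₂.isConj_boundaryHol_zpow (ρ.comap (g : C(P₂.Surface, P₁.Surface))) b κ₂ (s := 0)
    (t := P₁.len a) j (by
      have him := congrArg Complex.im hj
      have e2 : (j * (2 * Real.pi * Complex.I) : ℂ) =
          ((j * (2 * Real.pi) : ℝ) : ℂ) * Complex.I := by
        push_cast
        ring
      rw [e2] at him
      simp only [Complex.add_im, Complex.im_ofReal_mul, Complex.I_im, mul_one] at him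
      have hpi := Real.pi_ne_zero
      simp only [κ₂, ContinuousMap.coe_mk]
      rw [him]
      field_simp) (by simp only [κ₂, ContinuousMap.coe_mk]; rw [hper])
  rw [← hγ, Hol.comap_val] at c2
  have e3 : (g : C(P₂.Surface, P₁.Surface)).comp γ = (P₁.unroll a).comp κ₁ := by
    ext t
    exact hgγ t
  rw [e3] at c2
  exact c1.symm.trans c2

end PolygonScheme

/-! ### Short boundary cycles -/

/-- A list without repetitions can be completed to a cyclic order of the whole type. -/
theorem exists_sameCycle_apply_getElem {α : Type*} [Finite α] (L : List α) (hL : L.Nodup) :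
    ∃ r : Equiv.Perm α, (∀ x y, r.SameCycle x y) ∧
      ∀ (i : ℕ) (hi : i + 1 < L.length), r L[i] = L[i + 1] := by
  classical
  have := Fintype.ofFinite α
  let M := L ++ (Finset.univ.filter (· ∉ L)).toList
  have hM : M.Nodup := by
    refine List.Nodup.append hL (Finset.nodup_toList _) fun x hx hx' => ?_
    simp [hx] at hx'
  have hmem : ∀ x, x ∈ M := fun x => by
    by_cases hx : x ∈ L <;> simp [M, hx]
  refine ⟨M.formPerm, fun x y => (List.Nodup.isCycleOn_formPerm hM).2 (hmem x) (hmem y),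
    fun i hi => ?_⟩
  have h1 : i + 1 < M.length := hi.trans_le (by simp [M])
  have h2 := List.formPerm_apply_lt_getElem M hM i h1
  rwa [List.getElem_append_left (by omega), List.getElem_append_left hi] at h2

namespace PolygonScheme

variable (P : PolygonScheme) {G : Type*} [Group G] (ρ : Hol P.Surface G)

theorem val_unroll (a : P.side) (i : ℤ) :
    ρ.val ((P.unroll a).comp ⟨fun t => (t, 0), by fun_prop⟩) i (i + 1) =
      P.hol ρ ((P.next ^ i) a) := by
  have h := ρ.val_comp ((P.unroll a).comp ⟨fun t => (t, 0), by fun_prop⟩)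
    ⟨fun t : ℝ => i + t, by fun_prop⟩ 0 1
  simp only [ContinuousMap.coe_mk, add_zero] at h
  rw [← h]
  refine ρ.val_congr zero_le_one fun t h0 h1 => ?_
  change P.unrollFun a (i + t, 0) = _
  rw [P.unrollFun_eq a i (by linarith) (by linarith), edge_eq_rpt, add_sub_cancel_left]

theorem boundaryHol_eq_of_fixed {a : P.side} (h : P.next a = a) :
    P.boundaryHol ρ a = P.hol ρ a := by
  have hl : P.len a = 1 := Function.minimalPeriod_eq_one_iff_isFixedPt.2 h
  have := P.val_unroll ρ a 0
  simp only [Int.cast_zero, zero_add, zpow_zero, Equiv.Perm.one_apply] at this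
  rw [boundaryHol, hl, Nat.cast_one, this]

theorem boundaryHol_eq_mul {a b : P.side} (hab : a ≠ b) (h : P.next a = b) (h' : P.next b = a) :
    P.boundaryHol ρ a = P.hol ρ a * P.hol ρ b := by
  have hl : P.len a = 2 := by
    refine Function.minimalPeriod_eq_prime (p := 2) ?_ ?_
    · change P.next (P.next a) = a
      rw [h, h']
    · exact fun h1 => hab (h1.symm.trans h)
  have h0 := P.val_unroll ρ a 0
  have h1 := P.val_unroll ρ a 1
  simp only [Int.cast_zero, zero_add, zpow_zero, Equiv.Perm.one_apply] at h0
  simp only [Int.cast_one, zpow_one] at h1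
  rw [boundaryHol, hl, ← ρ.val_mul _ 0 1, h0, ← h, ← h1]
  norm_num

end PolygonScheme

/-! ### Infinitely many ribbon graph complexes meeting a given one -/

namespace Nil

theorem conj_central (x : Nil) (c d : ℤ) : x * ⟨0, 0, c, d⟩ * x⁻¹ = ⟨0, 0, c, d⟩ := by
  ext <;> simp
  ring

theorem zpow_d (x : Nil) (j : ℤ) : (x ^ j).d = j * x.d := by
  have := map_zpow dHom x j
  exact (congrArg Multiplicative.toAdd this).trans (by simp [dHom])

/-- A central element whose last coordinate is `1` is only conjugate to a power of `x` if it is `x`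
or its inverse. -/
theorem eq_or_eq_inv_of_isConj_zpow {c : ℤ} {x : Nil} {j : ℤ} (h : IsConj ⟨0, 0, c, 1⟩ (x ^ j)) :
    x = ⟨0, 0, c, 1⟩ ∨ x⁻¹ = ⟨0, 0, c, 1⟩ := by
  obtain ⟨y, hy⟩ := isConj_iff.1 h
  rw [conj_central] at hy
  have hd := congrArg Nil.d hy
  rw [zpow_d] at hd
  rcases Int.eq_one_or_neg_one_of_mul_eq_one hd.symm with rfl | rfl
  · exact .inl (by rw [hy, zpow_one])
  · exact .inr (by rw [hy, zpow_neg_one])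

end Nil

theorem singleton_mem_ribbonComplex {n : ℕ} {m : MarkedGraph n} {S : MarkedSurface n}
    (h : m.CanBeDrawnIn S) : {m} ∈ ribbonComplex S := by
  refine ⟨⟨Finset.singleton_nonempty m, ?_⟩, fun m' hm' => ?_⟩
  · rw [Finset.coe_singleton]
    exact Set.subsingleton_singleton.isChain
  · rwa [Finset.mem_singleton.1 hm']

/-- Two ribbon structures on the same graph and a sequence of homeomorphisms `T k` of the surface
of the first one give infinitely many neighbours, if some boundary curve of the second one is
mapped by the `T k` to curves that are told apart by a nilpotent quotient of the fundamental
group. -/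
theorem nerveNeighbors_infinite {n : ℕ} {Γ : Graph} (O O' : RibbonStructure Γ)
    (ρ : Hol O.Surface Nil) (T : ℕ → O.Surface ≃ₜ O.Surface) (a : Γ.H) (v : ℕ → ℤ)
    (hv : Function.Injective v)
    (hT : ∀ k, O'.scheme.boundaryHol
      (((ρ.comap (T k : C(O.Surface, O.Surface))).comap O.incl).comap O'.retr) a = ⟨0, 0, v k, 1⟩)
    (S : MarkedSurface n) (e : O.Surface ≃ₜ S.carrier) :
    (nerveNeighbors (ribbonComplex S)).Infinite := by
  have : PathConnectedSpace S.carrier := e.surjective.pathConnectedSpace e.continuous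
  -- The markings of the graph and of the surfaces.
  obtain ⟨t, ht⟩ := Marking.exists_carries_left e.toHomotopyEquiv S.marking
  have hg : ∀ k, ∃ g : Marking n Γ.Real,
      Marking.Carries ((T k : C(O.Surface, O.Surface)).comp O.incl) g t := fun k =>
    Marking.exists_carries_left (O.equiv.trans (T k).toHomotopyEquiv) t
  choose g hg using hg
  have hs : ∀ k, ∃ s : Marking n O'.Surface, Marking.Carries O'.incl (g k) s := fun k =>
    Marking.exists_carries_right O'.equiv (g k)
  choose s hs using hs
  let m : ℕ → MarkedGraph n := fun k => .mk ⟨Γ, g k⟩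
  let S' : ℕ → MarkedSurface n := fun k => ⟨O'.Surface, inferInstance, O'.isPuncturedSurface, s k⟩
  have hm : ∀ k, (m k).CanBeDrawnIn S := fun k =>
    ⟨⟨Γ, g k⟩, rfl, O, (T k).trans e, (hg k).comp ht⟩
  have hm' : ∀ k, (m k).CanBeDrawnIn (S' k) := fun k =>
    ⟨⟨Γ, g k⟩, rfl, O', .refl _, hs k⟩
  intro hfin
  have hmem : ∀ k, ribbonComplex (S' k) ∈
      nerveNeighbors (ribbonComplex S) ∪ {ribbonComplex S} := by
    intro k
    by_cases hR : ribbonComplex (S' k) = ribbonComplex S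
    · exact .inr hR
    refine .inl ⟨hR, by simp, fun R hR => ?_, {m k}, fun R hR => ?_⟩
    · rcases Finset.mem_insert.1 hR with rfl | hR
      · exact ⟨S, rfl⟩
      · exact ⟨S' k, Finset.mem_singleton.1 hR⟩
    · rcases Finset.mem_insert.1 hR with rfl | hR
      · exact singleton_mem_ribbonComplex (hm k)
      · rw [Finset.mem_singleton.1 hR]
        exact singleton_mem_ribbonComplex (hm' k)
  -- Infinitely many of the new complexes coincide with that of index `l`.
  have : Finite ↥(nerveNeighbors (ribbonComplex S) ∪ {ribbonComplex S}) :=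
    (hfin.union (Set.finite_singleton _)).to_subtype
  obtain ⟨R, hR⟩ := Finite.exists_infinite_fiber fun k =>
    (⟨_, hmem k⟩ : ↥(nerveNeighbors (ribbonComplex S) ∪ {ribbonComplex S}))
  rw [Set.infinite_coe_iff] at hR
  obtain ⟨l, hl⟩ := hR.nonempty
  let τ : ℕ → Hol Γ.Real Nil := fun k => (ρ.comap (T k : C(O.Surface, O.Surface))).comap O.incl
  have hτ : ∀ k w, IsConj ((τ k).pi ((g k).iso w)) (ρ.pi (t.iso w)) := fun k w =>
    ρ.isConj_of_carries (hg k) w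
  -- The holonomies of the boundary curves of all ribbon structures, for the marking of index `l`.
  let U : RibbonStructure Γ × Γ.H → Nil := fun q =>
    q.1.scheme.boundaryHol ((τ l).comap q.1.retr) q.2
  have hU : ∀ k, ribbonComplex (S' l) = ribbonComplex (S' k) →
      ∃ q, U q = ⟨0, 0, v k, 1⟩ ∨ (U q)⁻¹ = ⟨0, 0, v k, 1⟩ := by
    intro k hkl
    have hdraw : {m l} ∈ ribbonComplex (S' k) :=
      hkl ▸ singleton_mem_ribbonComplex (hm' l)
    obtain ⟨O'', h, hh⟩ := (MarkedGraph.canBeDrawnIn_mk_iff _ _).1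
      (hdraw.2 (m l) (Finset.mem_singleton_self _))
    have hh : Marking.Carries ((h : C(O''.Surface, O'.Surface)).comp O''.incl) (g l) (s k) := hh
    obtain ⟨t'', ht''⟩ := Marking.exists_carries_right O''.equiv (g l)
    obtain ⟨b, j, hj⟩ := PolygonScheme.exists_isConj_boundaryHol (P₁ := O'.scheme)
      (P₂ := O''.scheme) h ((τ k).comap O'.retr) a
    refine ⟨(O'', b), Nil.eq_or_eq_inv_of_isConj_zpow (j := j) ?_⟩
    rw [← hT k]
    refine hj.trans ?_
    -- Both structures on `|Γ, O''|` come from the same holonomy along the marking `t`.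
    have hpi : ∀ w, IsConj
        ((((τ k).comap O'.retr).comap (h : C(O''.Surface, O'.Surface))).pi (t''.iso w))
        (((τ l).comap O''.retr).pi (t''.iso w)) := by
      intro w
      have c1 := (((τ k).comap O'.retr).comap (h : C(O''.Surface, O'.Surface))).isConj_of_carries
        ht'' w
      have c2 := ((τ k).comap O'.retr).isConj_of_carries hh w
      have c3 := ((τ k).comap O'.retr).isConj_of_carries (hs k) w
      have c4 := ((τ l).comap O''.retr).isConj_of_carries ht'' w
      rw [← Hol.comap_comp] at c3 c4
      have e3 := O'.retr_comp_incl
      have e4 := O''.retr_comp_incl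
      erw [e3] at c3
      erw [e4] at c4
      exact c1.symm.trans (c2.trans (c3.symm.trans ((hτ k w).trans ((hτ l w).symm.trans c4))))
    obtain ⟨w, hw⟩ := Hol.exists_isConj_pi (G := Nil) t'' ((O''.scheme.unroll b).comp
      ⟨fun t => (t, 0), by fun_prop⟩) (a := 0) (b := O''.scheme.len b) (by
        have := O''.scheme.unroll_add b 1 0 0
        rw [Int.cast_one, one_mul, zero_add] at this
        exact this.symm)
    have hconj := ((hw (((τ k).comap O'.retr).comap (h : C(O''.Surface, O'.Surface)))).trans
      (hpi w)).trans (hw ((τ l).comap O''.retr)).symm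
    obtain ⟨y, hy⟩ := isConj_iff.1 hconj
    refine isConj_iff.2 ⟨y, ?_⟩
    rw [← conj_zpow]
    exact congrArg (· ^ j) hy
  have := Γ.finH
  refine hR (Set.Finite.of_finite_image (f := v) ?_ hv.injOn)
  refine ((Set.finite_range fun q => (U q).c).union
    (Set.finite_range fun q => ((U q)⁻¹).c)).subset ?_
  rintro _ ⟨k, hk, rfl⟩
  obtain ⟨q, hq | hq⟩ := hU k (congrArg Subtype.val (hl.trans (Eq.symm hk)))
  · exact .inl ⟨q, congrArg Nil.c hq⟩
  · exact .inr ⟨q, congrArg Nil.c hq⟩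

/-! ### Roses with a twist -/

/-- The graph with one vertex whose edges are the pairs of sides of a gluing scheme. -/
def PolygonScheme.rose (P : PolygonScheme) (h3 : 3 ≤ Nat.card P.side) : Graph where
  V := Unit
  H := P.side
  finV := inferInstance
  finH := P.finSide
  src _ := ()
  inv := P.inv
  inv_inv := P.inv_inv
  inv_ne := P.inv_ne
  nonempty := inferInstance
  valence _ := by
    rwa [Nat.card_congr (Equiv.subtypeUnivEquiv fun _ => rfl)]
  connected _ _ := .refl

/-- The ribbon structure on a rose given by a cyclic permutation of all half-edges. -/
def PolygonScheme.roseRibbon (P : PolygonScheme) (h3 : 3 ≤ Nat.card P.side) (r : Equiv.Perm P.side)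
    (hr : ∀ h h', r.SameCycle h h') : RibbonStructure (P.rose h3) where
  rot := r
  sameCycle_iff h h' := ⟨fun _ => rfl, fun _ => hr h h'⟩

/-- A cochain can be changed on one edge. -/
theorem Graph.exists_cochain_update {Γ : Graph} (φ : Γ.H → Nil)
    (hφ : ∀ h, φ (Γ.inv h) = (φ h)⁻¹) (e : Γ.H) (u : Nil) :
    ∃ ψ : Γ.H → Nil, (∀ h, ψ (Γ.inv h) = (ψ h)⁻¹) ∧ ψ e = u ∧
      ∀ h, h ≠ e → h ≠ Γ.inv e → ψ h = φ h := by
  classical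
  refine ⟨fun h => if h = e then u else if h = Γ.inv e then u⁻¹ else φ h, fun h => ?_, if_pos rfl,
    fun h h1 h2 => (if_neg h1).trans (if_neg h2)⟩
  by_cases h1 : h = e
  · subst h1
    simp [Γ.inv_ne]
  by_cases h2 : h = Γ.inv e
  · subst h2
    simp [Γ.inv_ne, Γ.inv_inv]
  · have h3 : Γ.inv h ≠ e := fun h' => h2 (by rw [← h', Γ.inv_inv])
    have h4 : Γ.inv h ≠ Γ.inv e := fun h' => h1 (by rw [← Γ.inv_inv h, h', Γ.inv_inv])
    simp [h1, h2, h3, h4, hφ]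

theorem RibbonStructure.exists_hol {Γ : Graph} (O : RibbonStructure Γ) (φ : Γ.H → Nil)
    (hφ : ∀ h, φ (Γ.inv h) = (φ h)⁻¹) : ∃ ρ : Hol O.Surface Nil, ∀ h, O.scheme.hol ρ h = φ h := by
  obtain ⟨ρ, hρ⟩ := Γ.exists_hol φ hφ
  refine ⟨ρ.comap O.retr, fun h => hρ h (O.retr.comp (O.scheme.edge h)) fun t => ?_⟩
  change O.retr (O.scheme.edge h t) = _
  rw [PolygonScheme.edge_apply]
  rfl

namespace PolygonScheme

variable (P : PolygonScheme) [DecidableEq P.side]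

/-- The powers of the twist along the loop `f` are told apart by a short curve: a loop `z` with one
half-edge in the block `Z` and the other one in `A`, or else the product of a loop with both
half-edges in `Z` and a loop with both half-edges in `A`. In a suitable ribbon structure this curve
is a boundary curve. -/
theorem IsBlockOrder.exists_boundaryHol {f : P.side} {Z A : List P.side} (hB : P.IsBlockOrder f Z A)
    (h3 : 3 ≤ Nat.card P.side) (O : RibbonStructure (P.rose h3))
    (hO : O.rot = (P.inv f :: Z ++ f :: A).formPerm) :
    ∃ (O' : RibbonStructure (P.rose h3)) (ρ : Hol O.Surface Nil) (T : ℕ → O.Surface ≃ₜ O.Surface)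
      (a : P.side) (v : ℕ → ℤ), Function.Injective v ∧ ∀ k, O'.scheme.boundaryHol
        (((ρ.comap (T k : C(O.Surface, O.Surface))).comap O.incl).comap O'.retr) a =
          ⟨0, 0, v k, 1⟩ := by
  have := P.finSide
  have hT : ∀ k, ∃ T : O.Surface ≃ₜ O.Surface, ∀ (ρ : Hol O.Surface Nil) (h : P.side),
      O.scheme.hol (ρ.comap (T : C(O.Surface, O.Surface))) h =
        (dragFactor {h | h ∈ Z} (O.scheme.hol ρ f ^ k) h)⁻¹ * O.scheme.hol ρ h *
          dragFactor {h | h ∈ Z} (O.scheme.hol ρ f ^ k) (P.inv h) := by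
    intro k
    have h := P.exists_twist hB.nodup k
    rw [← hO] at h
    obtain ⟨T, hT⟩ := h
    exact ⟨T, hT Nil⟩
  choose T hT using hT
  have hn := hB.nodup
  simp only [List.cons_append, List.nodup_cons, List.nodup_append, List.mem_append,
    List.mem_cons] at hn
  have hfZ : f ∉ Z := fun h => hn.2.2.2 f h f (.inl rfl) rfl
  have hfZ' : P.inv f ∉ Z := fun h => hn.1 (.inl h)
  have hfA : f ∉ A := hn.2.2.1.1
  have hfA' : P.inv f ∉ A := fun h => hn.1 (.inr (.inr h))
  have hZA : ∀ h ∈ Z, h ∉ A := fun h h1 h2 => hn.2.2.2 h h1 h (.inr h2) rfl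
  have hinv : ∀ {a b : P.side}, P.inv a = b → a = P.inv b := fun {a b} h => by
    rw [← h, P.inv_inv]
  -- Holonomies in the structure `O'` of the pullbacks.
  have hol_eq : ∀ (O' : RibbonStructure (P.rose h3)) (ρ : Hol O.Surface Nil) (φ : P.side → Nil),
      (∀ h, O.scheme.hol ρ h = φ h) → ∀ (k : ℕ) (h : P.side), O'.scheme.hol
        (((ρ.comap (T k : C(O.Surface, O.Surface))).comap O.incl).comap O'.retr) h =
          (dragFactor {h | h ∈ Z} (φ f ^ k) h)⁻¹ * φ h *
            dragFactor {h | h ∈ Z} (φ f ^ k) (P.inv h) := by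
    intro O' ρ φ hφ k h
    obtain rfl : O.scheme.hol ρ = φ := funext hφ
    exact hT k ρ h
  have one_odd : ∀ h : (P.rose h3).H, (fun _ => 1 : (P.rose h3).H → Nil) ((P.rose h3).inv h) =
      ((fun _ => 1 : (P.rose h3).H → Nil) h)⁻¹ := fun _ => inv_one.symm
  by_cases hcase : ∃ z ∈ Z, P.inv z ∉ Z
  · obtain ⟨z, hz, hz'⟩ := hcase
    -- The twist multiplies `z` from the left by the `k`-th power of the inverse of `f`.
    have hzf : z ≠ f := fun h => hfZ (h ▸ hz)
    have hzf' : z ≠ P.inv f := fun h => hfZ' (h ▸ hz)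
    obtain ⟨φ₁, hφ₁, e1, -⟩ := Graph.exists_cochain_update (Γ := P.rose h3) (fun _ => 1) one_odd f
      ⟨0, 0, 1, 0⟩
    obtain ⟨φ, hφ, e2, e2'⟩ := Graph.exists_cochain_update (Γ := P.rose h3) φ₁ hφ₁ z ⟨0, 0, 0, 1⟩
    obtain ⟨ρ, hρ⟩ := O.exists_hol φ hφ
    -- A monogon bounded by `z`.
    obtain ⟨r, hr, hr'⟩ := exists_sameCycle_apply_getElem [P.inv z, z] (by simp [P.inv_ne])
    have hrz : r (P.inv z) = z := hr' 0 (by simp)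
    let O' := P.roseRibbon h3 r hr
    have hφf : φ f = ⟨0, 0, 1, 0⟩ := (e2' f hzf.symm fun h => hzf' (hinv h.symm)).trans e1
    have hF : ∀ k : ℕ, φ f ^ k = ⟨0, 0, k, 0⟩ := fun k => by
      rw [hφf]
      induction k with
      | zero => rfl
      | succ k ih =>
        rw [pow_succ, ih]
        ext <;> simp
    refine ⟨O', ρ, T, z, fun k => -k, fun k k' h => by simpa using h, fun k => ?_⟩
    refine (boundaryHol_eq_of_fixed O'.scheme _ (show O'.scheme.next z = z from hrz)).trans
      ((hol_eq O' ρ φ hρ k z).trans ?_)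
    rw [dragFactor_of_mem (Z := {h | h ∈ Z}) _ hz, dragFactor_of_notMem (Z := {h | h ∈ Z}) _ hz',
      hF, e2]
    ext <;> simp
  · push Not at hcase
    -- Conjugation by the `k`-th power of `f` changes the central coordinate of `z₁` by `k`; the
    -- loop `z₂` makes the product central.
    obtain ⟨z₁, h1⟩ := List.exists_mem_of_ne_nil Z hB.left_ne
    obtain ⟨z₂, h2⟩ := List.exists_mem_of_ne_nil A hB.right_ne
    have h1' := hcase z₁ h1
    have h2Z : z₂ ∉ Z := fun h => hZA _ h h2
    have h2' : P.inv z₂ ∉ Z := fun h => h2Z (P.inv_inv z₂ ▸ hcase _ h)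
    have n1 : z₁ ≠ f := fun h => hfZ (h ▸ h1)
    have n1' : z₁ ≠ P.inv f := fun h => hfZ' (h ▸ h1)
    have n2 : z₂ ≠ f := fun h => hfA (h ▸ h2)
    have n2' : z₂ ≠ P.inv f := fun h => hfA' (h ▸ h2)
    have n3 : z₁ ≠ z₂ := fun h => h2Z (h ▸ h1)
    have n3' : z₁ ≠ P.inv z₂ := fun h => h2' (h ▸ h1)
    have n4 : P.inv z₁ ≠ z₂ := fun h => h2Z (h ▸ h1')
    have n4' : P.inv z₁ ≠ P.inv z₂ := fun h => h2' (h ▸ h1')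
    obtain ⟨φ₁, hφ₁, e1, -⟩ := Graph.exists_cochain_update (Γ := P.rose h3) (fun _ => 1) one_odd f
      ⟨0, 1, 0, 0⟩
    obtain ⟨φ₂, hφ₂, e2, e2'⟩ := Graph.exists_cochain_update (Γ := P.rose h3) φ₁ hφ₁ z₂
      ⟨-1, 0, 0, 0⟩
    obtain ⟨φ, hφ, e3, e3'⟩ := Graph.exists_cochain_update (Γ := P.rose h3) φ₂ hφ₂ z₁ ⟨1, 0, 0, 1⟩
    obtain ⟨ρ, hρ⟩ := O.exists_hol φ hφ
    -- A bigon bounded by `z₁` and `z₂`.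
    obtain ⟨r, hr, hr'⟩ := exists_sameCycle_apply_getElem [P.inv z₁, z₂, P.inv z₂, z₁]
      (by simp [P.inv_ne, n4, n4', n3.symm, n3'.symm, (P.inv_ne z₂).symm])
    have hr1 : r (P.inv z₁) = z₂ := hr' 0 (by simp)
    have hr2 : r (P.inv z₂) = z₁ := hr' 2 (by simp)
    let O' := P.roseRibbon h3 r hr
    have hφf : φ f = ⟨0, 1, 0, 0⟩ := (e3' f n1.symm fun h => n1' (hinv h.symm)).trans
      ((e2' f n2.symm fun h => n2' (hinv h.symm)).trans e1)
    have hφ2 : φ z₂ = ⟨-1, 0, 0, 0⟩ := (e3' z₂ n3.symm n4.symm).trans e2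
    have hF : ∀ k : ℕ, φ f ^ k = ⟨0, k, 0, 0⟩ := fun k => by
      rw [hφf]
      induction k with
      | zero => rfl
      | succ k ih =>
        rw [pow_succ, ih]
        ext <;> simp
    refine ⟨O', ρ, T, z₁, fun k => k, fun k k' h => by simpa using h, fun k => ?_⟩
    refine (boundaryHol_eq_mul O'.scheme _ n3 (show O'.scheme.next z₁ = z₂ from hr1)
      (show O'.scheme.next z₂ = z₁ from hr2)).trans
      ((congrArg₂ (· * ·) (hol_eq O' ρ φ hρ k z₁) (hol_eq O' ρ φ hρ k z₂)).trans ?_)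
    simp only
    rw [dragFactor_of_mem (Z := {h | h ∈ Z}) _ h1, dragFactor_of_mem (Z := {h | h ∈ Z}) _ h1',
      dragFactor_of_notMem (Z := {h | h ∈ Z}) _ h2Z, dragFactor_of_notMem (Z := {h | h ∈ Z}) _ h2',
      hF, e3, hφ2]
    ext <;> simp

end PolygonScheme

/-- A ribbon graph has no univalent vertices. -/
theorem RibbonStructure.scheme_next_ne {Γ : Graph} (O : RibbonStructure Γ) (h : Γ.H) :
    O.scheme.next h ≠ O.scheme.inv h := by
  intro h1
  have h1 : O.rot (Γ.inv h) = Γ.inv h := h1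
  have h2 := Γ.valence (Γ.src (Γ.inv h))
  have : Subsingleton {k : Γ.H // Γ.src k = Γ.src (Γ.inv h)} := by
    have key : ∀ k, Γ.src k = Γ.src (Γ.inv h) → k = Γ.inv h := fun k hk => by
      obtain ⟨i, hi⟩ := (O.sameCycle_iff _ _).2 hk.symm
      rw [← hi, Equiv.Perm.zpow_apply_eq_self_of_apply_eq_self h1]
    exact ⟨fun x y => Subtype.ext ((key x x.2).trans (key y y.2).symm)⟩
  have hfin := Γ.finH
  have h3 := Finite.card_le_one_iff_subsingleton.2 this
  omega

theorem nerveNeighbors_infinite_of_mem {n : ℕ} (hn : 3 ≤ n) {R : GraphComplex n}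
    (hR : {R} ∈ nerve n) : (nerveNeighbors R).Infinite := by
  classical
  obtain ⟨-, hS, s, hs⟩ := hR
  obtain ⟨S, rfl⟩ := hS R (Finset.mem_singleton_self R)
  have hs := hs _ (Finset.mem_singleton_self _)
  obtain ⟨m, hm⟩ := hs.1.1
  obtain ⟨A, rfl, O₀, e₀, -⟩ := hs.2 m hm
  have hfin := A.graph.finH
  -- Make the surface from polygons with a single vertex.
  obtain ⟨P, ⟨e⟩, hP⟩ := PolygonScheme.exists_one_vertex _ O₀.scheme le_rfl
    (inferInstanceAs (ConnectedSpace O₀.Surface)) O₀.scheme_next_ne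
  have : PathConnectedSpace P.Surface :=
    e.symm.surjective.pathConnectedSpace e.symm.continuous
  have : PathConnectedSpace S.carrier := e₀.surjective.pathConnectedSpace e₀.continuous
  obtain ⟨t, -⟩ := Marking.exists_carries_left (e.trans e₀).toHomotopyEquiv S.marking
  obtain ⟨b, -⟩ := P.exists_pt (Classical.arbitrary P.Surface)
  obtain ⟨f, Z, B, hB, ⟨e'⟩⟩ := P.exists_blockOrder hP
    (fun a b => PolygonScheme.exists_third_edge hP t hn a b) b
  have hfin := P.finSide
  have h3 : 3 ≤ Nat.card P.side := by
    have := Fintype.ofFinite P.side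
    rw [Nat.card_eq_fintype_card]
    refine le_trans ?_ hB.nodup.length_le_card
    have := List.length_pos_of_ne_nil hB.left_ne
    simp only [List.cons_append, List.length_cons, List.length_append]
    omega
  have hr : ∀ h h', (P.inv f :: Z ++ f :: B).formPerm.SameCycle h h' := fun h h' =>
    (List.Nodup.isCycleOn_formPerm hB.nodup).2 (hB.mem h) (hB.mem h')
  obtain ⟨O', ρ, T, a, v, hv, hT⟩ := hB.exists_boundaryHol P h3 (P.roseRibbon h3 _ hr) rfl
  exact nerveNeighbors_infinite _ O' ρ T a v hv hT S (e'.trans (e.trans e₀))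

end RibbonNerve
end

theorem mainTheorem9 (n : ℕ) (hn : 2 ≤ n) :
    Finite (MulAction.orbitRel.Quotient (RibbonNerve.Out n)ᵐᵒᵖ (RibbonNerve.nerveSimplices n)) ∧
    (∀ k : ℕ, Finite (MulAction.orbitRel.Quotient (RibbonNerve.Out n)ᵐᵒᵖ
      (RibbonNerve.nerveSimplicesOfDim n k))) ∧
    (3 ≤ n → ∀ R : RibbonNerve.GraphComplex n, {R} ∈ RibbonNerve.nerve n →
      (RibbonNerve.nerveNeighbors R).Infinite) :=
  ⟨RibbonNerve.finite_orbits_of_subset_nerve _ fun _ h => h,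
    fun _ => RibbonNerve.finite_orbits_of_subset_nerve _ fun _ h => h.1,
    fun h3 _ => RibbonNerve.nerveNeighbors_infinite_of_mem h3⟩
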